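/- **Setting.** Let $s_+$ be a measurable function on $\mathbb R$ with $|s_+|\le 1$, $s_+(\lambda)=\overline{s_+(-\lambda)}$ a.e. and $\int_{\mathbb R}\frac{\log(1-|s_+(\lambda)|^2)}{1+\lambda^2}\,d\lambda>-\infty$ (with $\log 0=-\infty$). Let $\nu_+=\sum_k\nu_+(\lambda_k)\delta_{\lambda_k}$ with $\nu_+(\lambda_k)>0$ be a discrete measure (not necessarily finite) carried by a set $\Lambda=\{\lambda_k\}$ of distinct points of the imaginary axis, $\lambda_k/i>0$, with $\sum_{\lambda_k/i\le1}\lambda_k/i<\infty$ and $\sum_{\lambda_k/i>1}i/\lambda_k<\infty$. Let $H^2$ and $H^\infty$ be the Hardy spaces of the upper half-plane $\mathbb C_+$. Let $s_e$ be the outer function in $\mathbb C_+$ with $|s_e|^2+|s_+|^2=1$ a.e. on $\mathbb R$ and $s_e(i)>0$. Let $B=\prod_k b_{\lambda_k}$, where $b_{\lambda_k}(\lambda)=\pm\frac{\lambda-\lambda_k}{\lambda-\bar\lambda_k}$ with sign $+$ if $\lambda_k/i\le1$ and $-$ if $\lambda_k/i>1$. Put $s=s_e/B$, and $s_-=-\frac{s}{\bar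 s}\,\overline{s_+}$ on $\mathbb R$. The space $L^2_{\{s_+,\nu_+\}}$ consists of the functions $f$ on $\mathbb R\cup\Lambda$ with $$\|f\|^2_{\{s_+,\nu_+\}}=\sum_{\lambda_k\in\Lambda}|f(\lambda_k)|^2\nu_+(\lambda_k)+\frac1{4\pi}\int_{\mathbb R}\begin{bmatrix}\overline{f(\lambda)}&-\overline{f(-\lambda)}\end{bmatrix}\begin{bmatrix}1&\overline{s_+(\lambda)}\\ s_+(\lambda)&1\end{bmatrix}\begin{bmatrix}f(\lambda)\\-f(-\lambda)\end{bmatrix}d\lambda<\infty .$$ $H^2_{\{s_+,\nu_+\}}$ is the closure in it of the functions $B'g$, where $g\in H^\infty\cap H^2$ and $B'$ is a divisor of $B$ such that $B/B'$ is a finite Blaschke product. $\hat H^2_{\{s_+,\nu_+\}}$ is the space of those $f\in L^2_{\{s_+,\nu_+\}}$ for which $g:=s_ef|_{\mathbb R}$ belongs to $H^2$ and $f(\lambda_k)=(g/s_e)(\lambda_k)$ for all $\lambda_k\in\Lambda$. The elements of both spaces continue analytically to $\mathbb C_+$ (as $g/s_e$), and both spaces have reproducing kernels at every point of $\mathbb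 C_+$. For $x\in\mathbb R$ let $k_x(\lambda,\lambda_0)$ and $\hat k_x(\lambda,\lambda_0)$ be the reproducing kernels of $H^2_{\{s_+e^{2i\lambda x},\,\nu_+e^{2i\lambda x}\}}$ and $\hat H^2_{\{s_+e^{2i\lambda x},\,\nu_+e^{2i\lambda x}\}}$, and put $k(\lambda,\lambda_0)=\frac{i}{\lambda-\bar\lambda_0}$. **Theorem.** Under these assumptions all the kernels $k_x(\cdot,\lambda_0)$, $\hat k_x(\cdot,\lambda_0)$ exist. For every $\lambda_0\in\mathbb C_+$, and with $\kappa_x$ standing either for $k_x$ (for all $x$) or for $\hat k_x$ (for all $x$): (i) On $\mathbb R$, in $L^2(\mathbb R)$, $$s\,\bigl(e^{i\lambda x}\kappa_x(\cdot,\lambda_0)\bigr)=s\,e^{i\lambda x}k(\cdot,\lambda_0)+o(1)\qquad(x\to+\infty),$$ and, if $\lambda_0\notin\Lambda$, $$s(-\bar\lambda_0)\,s\,\bigl(e^{i\lambda x}\kappa_x(\cdot,\lambda_0)\bigr)=e^{i\lambda x}k(\cdot,\lambda_0)+s_-e^{-i\lambda x}k(\cdot,-\lambda_0)+o(1)\qquad(x\to-\infty).$$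 (ii) On $\Lambda$, $e^{i\lambda x}\kappa_x(\cdot,\lambda_0)=o(1)$ in $L^2_{\nu_+}$ as $x\to+\infty$. Moreover, for every $\lambda_k\in\Lambda$, $$\lim_{x\to-\infty}e^{-2\,\mathrm{Im}\,\lambda_k\,x}\,\kappa_x(\lambda_k,\lambda_k)=\frac1{\nu_+(\lambda_k)} .$$ -/

import Mathlib

open Filter Topology MeasureTheory Matrix
open scoped ENNReal NNReal ComplexConjugate

noncomputable section

/-- Boundary value at the real point `t` of a function `F` on the upper half-plane (vertical limit;
for the functions used below it exists for almost every `t`). -/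
def boundaryValue (F : ℂ → ℂ) (t : ℝ) : ℂ :=
  limUnder (𝓝[>] (0 : ℝ)) (fun y : ℝ => F (t + y * Complex.I))

/-- `F` has the vertical boundary values `f` almost everywhere on the real line. -/
def HasBoundaryValues (F : ℂ → ℂ) (f : ℝ → ℂ) : Prop :=
  ∀ᵐ t : ℝ, Tendsto (fun y : ℝ => F (t + y * Complex.I)) (𝓝[>] (0 : ℝ)) (𝓝 (f t))

/-- The Hardy space `H²` of the upper half-plane. -/
def IsHardyTwo (G : ℂ → ℂ) : Prop :=
  DifferentiableOn ℂ G {z : ℂ | 0 < z.im} ∧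
    ∃ C : ℝ≥0, ∀ y : ℝ, 0 < y → ∫⁻ t : ℝ, ‖G (t + y * Complex.I)‖ₑ ^ 2 ≤ C

/-- The Hardy space `H^∞` of the upper half-plane. -/
def IsHardyInfty (G : ℂ → ℂ) : Prop :=
  DifferentiableOn ℂ G {z : ℂ | 0 < z.im} ∧
    ∃ C : ℝ, ∀ z : ℂ, 0 < z.im → ‖G z‖ ≤ C

/-- The reproducing kernel `k(z, μ) = i / (z - conj μ)` of the standard `H²`, for the norm
`‖f‖² = (1 / 2π) ∫ |f|²`. -/
def hardyKernel (z μ : ℂ) : ℂ := Complex.I / (z - conj μ)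

/-- The Blaschke factor with zero `a` on the positive imaginary axis, with its sign. -/
def blaschkeFactor (a z : ℂ) : ℂ :=
  if a.im ≤ 1 then (z - a) / (z - conj a) else -((z - a) / (z - conj a))

/-- The Blaschke product with simple zeros at the points of `A`. -/
def blaschke (A : Set ℂ) (z : ℂ) : ℂ := ∏' a : A, blaschkeFactor a z

/-- Scattering data `{s₊, ν₊}`: a symmetric contractive function `s` on the real line which
satisfies the Szegő condition, and a discrete measure with positive masses `ν l` at the points `l`
of a subset `Λ` of the positive imaginary axis which satisfies the Blaschke condition.
(With `log 0 = -∞` the Szegő condition includes `|s| < 1` almost everywhere; as `Real.log 0 = 0`,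
this has to be written out.) -/
structure ScatteringData where
  s : ℝ → ℂ
  Λ : Set ℂ
  ν : ℂ → ℝ
  aestronglyMeasurable : AEStronglyMeasurable s volume
  norm_lt_one : ∀ᵐ t : ℝ, ‖s t‖ < 1
  symm : ∀ᵐ t : ℝ, s t = conj (s (-t))
  szego : Integrable (fun t : ℝ => Real.log (1 - ‖s t‖ ^ 2) / (1 + t ^ 2)) volume
  mem_imag : ∀ l ∈ Λ, l.re = 0 ∧ 0 < l.im
  blaschke_small : Summable (fun l : {l : ℂ // l ∈ Λ ∧ l.im ≤ 1} => (l : ℂ).im)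
  blaschke_large : Summable (fun l : {l : ℂ // l ∈ Λ ∧ 1 < l.im} => 1 / (l : ℂ).im)
  ν_pos : ∀ l ∈ Λ, 0 < ν l

namespace ScatteringData

/-- The data `{s₊ e^{2i z x}, ν₊ e^{2i z x}}`; at a point `l = iκ` of `Λ`,
`e^{2i l x} = e^{-2κx}` is real and positive. -/
def twist (D : ScatteringData) (x : ℝ) : ScatteringData where
  s := fun t => D.s t * Complex.exp (2 * Complex.I * t * x)
  Λ := D.Λ
  ν := fun l => D.ν l * Real.exp (-2 * l.im * x)
  aestronglyMeasurable := by
    refine D.aestronglyMeasurable.mul (Continuous.aestronglyMeasurable ?_)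
    fun_prop
  norm_lt_one := by
    filter_upwards [D.norm_lt_one] with t ht
    simpa [Complex.norm_exp] using ht
  symm := by
    filter_upwards [D.symm] with t ht
    have h2 : (starRingEnd ℂ) 2 = 2 := Complex.conj_ofNat 2
    rw [map_mul, ← ht, ← Complex.exp_conj]
    simp [h2]
  szego := by
    have h : ∀ t : ℝ, ‖D.s t * Complex.exp (2 * Complex.I * t * x)‖ = ‖D.s t‖ := by
      intro t
      simp [Complex.norm_exp]
    simpa only [h] using D.szego
  mem_imag := D.mem_imag
  blaschke_small := D.blaschke_small
  blaschke_large := D.blaschke_large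
  ν_pos := fun l hl => mul_pos (D.ν_pos l hl) (Real.exp_pos _)

/-- The outer function `s_e` in the upper half-plane with `|s_e|² + |s₊|² = 1` almost everywhere on
the real line, normalized by `s_e(i) > 0`. -/
def outer (D : ScatteringData) (z : ℂ) : ℂ :=
  Complex.exp (1 / (Real.pi * Complex.I) *
    ∫ t : ℝ, (1 / ((t : ℂ) - z) - (t : ℂ) / (1 + (t : ℂ) ^ 2)) *
      (Real.log (Real.sqrt (1 - ‖D.s t‖ ^ 2)) : ℂ))

/-- The function `s = s_e / B` in the upper half-plane. -/
def trans (D : ScatteringData) (z : ℂ) : ℂ := D.outer z / blaschke D.Λ z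

/-- The function `s` on the real line. -/
def transLine (D : ScatteringData) (t : ℝ) : ℂ := boundaryValue D.trans t

/-- The function `s₋ = -(s / conj s) conj s₊` on the real line. -/
def sMinus (D : ScatteringData) (t : ℝ) : ℂ :=
  -(D.transLine t / conj (D.transLine t)) * conj (D.s t)

/-- The integrand `[conj g(t), -conj g(-t)] [[1, conj s₊(t)], [s₊(t), 1]] [f(t), -f(-t)]ᵀ`.
Here and below an element of `L²_{s₊,ν₊}` is a function `ℂ → ℂ` of which only the values on
`ℝ ∪ Λ` are used. -/
def form (D : ScatteringData) (f g : ℂ → ℂ) (t : ℝ) : ℂ :=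
  star ![g t, -g (-t)] ⬝ᵥ (!![1, conj (D.s t); D.s t, 1] *ᵥ ![f t, -f (-t)])

/-- The square of the norm of `L²_{s₊,ν₊}`, possibly infinite. -/
def normSq (D : ScatteringData) (f : ℂ → ℂ) : ℝ≥0∞ :=
  (∑' l : D.Λ, ENNReal.ofReal (‖f l‖ ^ 2 * D.ν l)) +
    ENNReal.ofReal (1 / (4 * Real.pi)) * ∫⁻ t : ℝ, ENNReal.ofReal (D.form f f t).re

/-- The scalar product of `L²_{s₊,ν₊}`, linear in the first argument. -/
def scalar (D : ScatteringData) (f g : ℂ → ℂ) : ℂ :=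
  (∑' l : D.Λ, f l * conj (g l) * (D.ν l : ℂ)) +
    1 / (4 * Real.pi) * ∫ t : ℝ, D.form f g t

/-- Membership in `L²_{s₊,ν₊}`. -/
def MemL2 (D : ScatteringData) (f : ℂ → ℂ) : Prop :=
  AEStronglyMeasurable (fun t : ℝ => f t) volume ∧ D.normSq f < ∞

/-- The functions `f = B' g` with `g ∈ H^∞ ∩ H²` and `B'` a divisor of the Blaschke product `B`
such that `B / B'` is a finite Blaschke product: on the real line through boundary values, on `Λ`
by evaluation. -/
def IsGenerator (D : ScatteringData) (f : ℂ → ℂ) : Prop :=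
  ∃ (S : Finset ℂ) (g : ℂ → ℂ), IsHardyInfty g ∧ IsHardyTwo g ∧
    HasBoundaryValues (fun z => blaschke (D.Λ \ S) z * g z) (fun t => f t) ∧
    ∀ l ∈ D.Λ, f l = blaschke (D.Λ \ S) l * g l

/-- The space `H²_{s₊,ν₊}`, the closure of the functions `B' g` in `L²_{s₊,ν₊}`. -/
def H2 (D : ScatteringData) : Set (ℂ → ℂ) :=
  {f | D.MemL2 f ∧ ∀ ε : ℝ≥0∞, 0 < ε → ∃ h, D.IsGenerator h ∧ D.normSq (f - h) < ε}

/-- `G` is a function of the standard `H²` with boundary values `s_e f` on the real line. -/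
def IsOuterMultiple (D : ScatteringData) (f G : ℂ → ℂ) : Prop :=
  IsHardyTwo G ∧ HasBoundaryValues G (fun t => boundaryValue D.outer t * f t)

/-- The space `Ĥ²_{s₊,ν₊}`. -/
def hatH2 (D : ScatteringData) : Set (ℂ → ℂ) :=
  {f | D.MemL2 f ∧ ∃ G, D.IsOuterMultiple f G ∧ ∀ l ∈ D.Λ, f l = G l / D.outer l}

/-- The analytic continuation of `f` from the real line to the upper half-plane, the quotient of
the `H²`-function `s_e f` by `s_e`, takes the value `v` at the point `z`. -/
def HasValue (D : ScatteringData) (f : ℂ → ℂ) (z v : ℂ) : Prop :=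
  ∃ G, D.IsOuterMultiple f G ∧ v = G z / D.outer z

/-- `k` is the reproducing kernel at the point `μ` of the space `H` of functions on `ℝ ∪ Λ` that
continue analytically to the upper half-plane: `k` belongs to `H`, is given in the upper
half-plane by its continuation, and `⟨f, k⟩ = f(μ)` for all `f ∈ H`. -/
def IsReproducingKernel (D : ScatteringData) (H : Set (ℂ → ℂ)) (μ : ℂ) (k : ℂ → ℂ) : Prop :=
  k ∈ H ∧ (∀ z : ℂ, 0 < z.im → D.HasValue k z (k z)) ∧
    ∀ f ∈ H, D.HasValue f μ (D.scalar f k)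

/-- The reproducing kernel `k_{s₊,ν₊}(z, μ)` of `H²_{s₊,ν₊}`. -/
def kernel (D : ScatteringData) (z μ : ℂ) : ℂ :=
  Classical.epsilon (D.IsReproducingKernel D.H2 μ) z

/-- The reproducing kernel of `Ĥ²_{s₊,ν₊}`. -/
def hatKernel (D : ScatteringData) (z μ : ℂ) : ℂ :=
  Classical.epsilon (D.IsReproducingKernel D.hatH2 μ) z

end ScatteringData

/-- `u x = v x + o(1)` in `L²(ℝ)` along the filter `F`. -/
def AsympL2 (F : Filter ℝ) (u v : ℝ → ℝ → ℂ) : Prop :=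
  Tendsto (fun x : ℝ => eLpNorm (fun t : ℝ => u x t - v x t) 2 volume) F (𝓝 0)

/-- `u x = o(1)` in `L²_{ν₊}(Λ)` along the filter `F`. -/
def VanishesL2Nu (D : ScatteringData) (F : Filter ℝ) (u : ℝ → ℂ → ℂ) : Prop :=
  Tendsto (fun x : ℝ => ∑' l : D.Λ, ENNReal.ofReal (‖u x l‖ ^ 2 * D.ν l)) F (𝓝 0)

end

/-! Completing the square (`form_eq`) turns the density of the norm into |f(-t) - s₊(t) f(t)|² + (1
- |s₊(t)|²) |f(t)|². So L²_{s₊,ν₊} embeds isometrically (`embed`) into ℓ² ⊕ L² ⊕ L², and ‖s_e f‖ in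
L²(ℝ) is bounded by a constant times the norm of f. Evaluations of f = g / s_e in the upper
half-plane are therefore continuous, and `Ĥ²` is closed (`isClosed_map_hatSubmodule`). Both `H²` and
`Ĥ²` are closed spaces lying between the generators B'g and `Ĥ²` (`IsHardySpace`); the whole
argument works for any such space, with constants that do not depend on it.

The kernels are located by one Hilbert space argument, `IsReproducingKernel.norm_sub_le`. If h
satisfies |⟨f, h⟩ - c f(μ)| ≤ ε‖f‖ on all of `Ĥ²` and lies within δ of a generator, then ‖c̄ κ_μ -
h‖ ≤ 2δ + ε. It remains to find h for the twisted data, in which all dependence on x is through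
e^{2itx} and the masses ν₊(l) e^{-2 Im l x}.

As x → +∞, h is nearly k_μ on ℝ and zero on Λ, with c = 1 (`tendsto_normSq_kernel_sub_atTop`). To
get an exact evaluation k_μ is multiplied by conj(s_e φ), with φ bounded, s_e(μ) φ(μ) = 1 and s_e φ
close to 1. The reflected part of the pairing is an integral of s_e f against e^{2itx} times a fixed
L² function, which is small uniformly on the unit ball of the Hardy space
(`eventually_integral_exp_mul_le`). A generator B' k_μ with B' a tail of the Blaschke product is
close to h, because its finitely many nonzero values on Λ carry vanishing masses.

As x → -∞, h = T(B k_μ) where T = `dualLift` satisfies ⟨f, T u⟩ = (1/2π) ∫ s_e f ū, and c = s(μ)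
(`tendsto_normSq_kernel_sub_atBot`). Pairing s_e f with B k_μ gives (s_e f)(μ) / B(μ) = s(μ) f(μ) up
to the values of f at finitely many points of Λ and a tail; those values are small since the masses
now blow up. Moreover T(B k_μ) is close to B times a sum of φ k_μ and e^{-2itx} times a fixed L²
function, and the latter approaches the Hardy space (`eventually_exp_mul_near_hardy`). On the line s
e^{itx} T(B k_μ) is exactly e^{itx} k_μ + s₋ e^{-itx} k_{-μ}.

The norm bounds ‖s_e f‖, with |s| = |s_e| on ℝ, and also bounds the sum over Λ, so these two
comparisons give the asymptotics on ℝ for both signs and on Λ as x → +∞. At l ∈ Λ the limit as x →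
-∞ follows from κ_l(l) = ‖κ_l‖²: one term of the norm bounds it from above, and Cauchy-Schwarz with
a generator vanishing on Λ except at l bounds it from below.

The classical facts on H² of the half-plane (boundary values, Cauchy formula, closedness, outer
functions, Blaschke products) are derived from contour shifts and Fatou's theorem. -/

/-! ### Poisson integrals on the half-plane and Fatou's theorem -/

/-- The Poisson kernel of the upper half-plane, up to the factor `1 / π`. -/
noncomputable def poissonHP (y u : ℝ) : ℝ := y / (u ^ 2 + y ^ 2)

lemma poissonHP_nonneg {y : ℝ} (hy : 0 < y) (u : ℝ) : 0 ≤ poissonHP y u := by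
  unfold poissonHP; positivity

lemma continuous_poissonHP {y : ℝ} (hy : 0 < y) : Continuous (poissonHP y) := by
  unfold poissonHP
  refine continuous_const.div (by fun_prop) fun u => by positivity

lemma poissonHP_eq {y : ℝ} (hy : 0 < y) (u : ℝ) :
    poissonHP y u = y⁻¹ * (1 + (u / y) ^ 2)⁻¹ := by
  unfold poissonHP; field_simp; ring

lemma integrable_poissonHP {y : ℝ} (hy : 0 < y) (x : ℝ) :
    Integrable fun t : ℝ => poissonHP y (t - x) := by
  simp_rw [poissonHP_eq hy]
  exact ((integrable_inv_one_add_sq.comp_div hy.ne').comp_sub_right x).const_mul _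

lemma integral_poissonHP {y : ℝ} (hy : 0 < y) (x : ℝ) :
    ∫ t : ℝ, poissonHP y (t - x) = Real.pi := by
  rw [integral_sub_right_eq_self (fun t : ℝ => poissonHP y t) x]
  simp_rw [poissonHP_eq hy]
  rw [integral_const_mul, Measure.integral_comp_div (fun t : ℝ => (1 + t ^ 2)⁻¹) y,
    integral_univ_inv_one_add_sq, abs_of_pos hy, smul_eq_mul]
  field_simp

/-- A dyadic majorant: the n-th ball has radius 2^n y and height 4 / (4^n y), so radius times height
is 4 / 2^n, summable with total 8. -/
lemma ofReal_poissonHP_le_tsum {y : ℝ} (hy : 0 < y) (x t : ℝ) :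
    ENNReal.ofReal (poissonHP y (t - x)) ≤ ∑' n : ℕ, ENNReal.ofReal (4 / (4 ^ n * y)) *
      (Metric.closedBall x (2 ^ n * y)).indicator 1 t := by
  have key : ∃ n : ℕ, |t - x| ≤ 2 ^ n * y ∧ poissonHP y (t - x) ≤ 4 / (4 ^ n * y) := by
    rcases le_total |t - x| y with h | h
    · refine ⟨0, by simpa using h, ?_⟩
      unfold poissonHP
      rw [div_le_div_iff₀ (by positivity) (by positivity)]
      nlinarith [sq_nonneg (t - x), mul_pos hy hy]
    · obtain ⟨n, h1, h2⟩ := exists_nat_pow_near ((one_le_div hy).2 h) one_lt_two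
      refine ⟨n + 1, ((div_lt_iff₀ hy).1 h2).le, ?_⟩
      rw [le_div_iff₀ hy] at h1
      have h3 : (2 ^ n * y) ^ 2 ≤ (t - x) ^ 2 := by
        rw [← sq_abs (t - x)]; gcongr
      have h4 : (4 : ℝ) ^ n = (2 ^ n) ^ 2 := by rw [← pow_mul, mul_comm, pow_mul]; norm_num
      unfold poissonHP
      rw [div_le_div_iff₀ (by positivity) (by positivity), pow_succ, h4]
      nlinarith [sq_nonneg (t - x), mul_pos hy hy]
  obtain ⟨n, h1, h2⟩ := key
  refine le_trans ?_ (ENNReal.le_tsum n)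
  rw [Set.indicator_of_mem (by simpa [Real.dist_eq] using h1)]
  simpa using ENNReal.ofReal_le_ofReal h2

/-- Each ball of the dyadic majorant contributes its height times at most ε times its radius, and
the geometric series sums to 8ε. The bound is uniform in y. -/
lemma lintegral_poissonHP_near_le {g : ℝ → ℝ≥0∞} (hg : AEMeasurable g) {x δ ε y : ℝ}
    (hδ : 0 < δ) (hε : 0 ≤ ε) (hy : 0 < y)
    (h : ∀ r, 0 < r → r ≤ δ → ∫⁻ t in Metric.closedBall x r, g t ≤ ENNReal.ofReal (ε * r)) :
    ∫⁻ t in Metric.closedBall x δ, ENNReal.ofReal (poissonHP y (t - x)) * g t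
      ≤ ENNReal.ofReal (8 * ε) := by
  calc ∫⁻ t in Metric.closedBall x δ, ENNReal.ofReal (poissonHP y (t - x)) * g t
      ≤ ∫⁻ t in Metric.closedBall x δ, ∑' n : ℕ, ENNReal.ofReal (4 / (4 ^ n * y)) *
        (Metric.closedBall x (2 ^ n * y)).indicator g t := by
        refine lintegral_mono fun t => ?_
        refine (mul_le_mul_left (ofReal_poissonHP_le_tsum hy x t) (g t)).trans ?_
        rw [← ENNReal.tsum_mul_right]
        refine ENNReal.tsum_le_tsum fun n => ?_
        rw [mul_assoc]
        gcongr
        by_cases ht : t ∈ Metric.closedBall x (2 ^ n * y) <;> simp [ht]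
    _ = ∑' n : ℕ, ENNReal.ofReal (4 / (4 ^ n * y)) *
        ∫⁻ t in Metric.closedBall x δ, (Metric.closedBall x (2 ^ n * y)).indicator g t := by
        rw [lintegral_tsum fun n => ((hg.indicator Metric.isClosed_closedBall.measurableSet).const_mul
          _).restrict]
        congr with n
        rw [lintegral_const_mul'' _
          (hg.indicator Metric.isClosed_closedBall.measurableSet).restrict]
    _ ≤ ∑' n : ℕ, ENNReal.ofReal (4 * ε * (1 / 2) ^ n) := by
        refine ENNReal.tsum_le_tsum fun n => ?_
        rw [lintegral_indicator Metric.isClosed_closedBall.measurableSet,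
          Measure.restrict_restrict Metric.isClosed_closedBall.measurableSet]
        have h1 : Metric.closedBall x (2 ^ n * y) ∩ Metric.closedBall x δ
            ⊆ Metric.closedBall x (min (2 ^ n * y) δ) := fun z hz => by
          simpa using hz
        refine (mul_le_mul_right ((lintegral_mono_set h1).trans
          (h _ (lt_min (by positivity) hδ) (min_le_right _ _))) _).trans ?_
        rw [← ENNReal.ofReal_mul (by positivity)]
        refine ENNReal.ofReal_le_ofReal ?_
        calc 4 / (4 ^ n * y) * (ε * min (2 ^ n * y) δ) ≤ 4 / (4 ^ n * y) * (ε * (2 ^ n * y)) := by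
              gcongr; exact min_le_left _ _
          _ = 4 * ε * (1 / 2) ^ n := by
              have h4 : (4 : ℝ) ^ n = 2 ^ n * 2 ^ n := by rw [← mul_pow]; norm_num
              rw [h4, one_div, inv_pow]; field_simp
    _ = ENNReal.ofReal (8 * ε) := by
        rw [← ENNReal.ofReal_tsum_of_nonneg (fun n => by positivity)
          (summable_geometric_two.mul_left _), tsum_mul_left, tsum_geometric_two]
        ring_nf

lemma integrable_poissonHP_smul {E : Type*} [NormedAddCommGroup E] [NormedSpace ℝ E] {f : ℝ → E}
    (hf : Integrable fun t : ℝ => (1 + t ^ 2)⁻¹ • f t) {y : ℝ} (hy : 0 < y) (x : ℝ) :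
    Integrable fun t : ℝ => poissonHP y (t - x) • f t := by
  -- The bound rests on 1 + t² ≤ 1 + 2x² + 2(t - x)², whose slack is (t - 2x)².
  have hb : ∀ t : ℝ, ‖poissonHP y (t - x) * (1 + t ^ 2)‖ ≤ y * (2 + (1 + 2 * x ^ 2) / y ^ 2) := by
    intro t
    rw [Real.norm_of_nonneg (mul_nonneg (poissonHP_nonneg hy _) (by positivity))]
    unfold poissonHP
    rw [div_mul_eq_mul_div, div_le_iff₀ (by positivity), mul_assoc]
    gcongr
    have h1 : (2 + (1 + 2 * x ^ 2) / y ^ 2) * ((t - x) ^ 2 + y ^ 2)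
        = 2 * (t - x) ^ 2 + 2 * y ^ 2 + (1 + 2 * x ^ 2) / y ^ 2 * (t - x) ^ 2 + (1 + 2 * x ^ 2) := by
      field_simp; ring
    have h2 : 0 ≤ (1 + 2 * x ^ 2) / y ^ 2 * (t - x) ^ 2 := by positivity
    rw [h1]
    nlinarith [sq_nonneg (t - 2 * x)]
  have := hf.bdd_smul
    (φ := fun t : ℝ => poissonHP y (t - x) * (1 + t ^ 2)) (y * (2 + (1 + 2 * x ^ 2) / y ^ 2)) ?_ (Eventually.of_forall hb)
  · refine this.congr (Eventually.of_forall fun t => ?_)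
    have : (1 + t ^ 2 : ℝ) ≠ 0 := by positivity
    simp [smul_smul, this]
  · exact (((continuous_poissonHP hy).comp (by fun_prop)).mul
      (by fun_prop)).aestronglyMeasurable

/-- **Fatou's theorem** for the upper half-plane: Poisson integrals converge vertically almost
everywhere. -/
theorem ae_tendsto_poisson {E : Type*} [NormedAddCommGroup E] [NormedSpace ℝ E] [CompleteSpace E]
    {f : ℝ → E} (hf : Integrable fun t : ℝ => (1 + t ^ 2)⁻¹ • f t) :
    ∀ᵐ x : ℝ, Tendsto (fun y : ℝ => Real.pi⁻¹ • ∫ t : ℝ, poissonHP y (t - x) • f t)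
      (𝓝[>] 0) (𝓝 (f x)) := by
  have hloc : LocallyIntegrable f := by
    rw [locallyIntegrable_iff]
    intro k hk
    refine (hf.integrableOn.continuousOn_smul (f := fun t : ℝ => 1 + t ^ 2)
      (by fun_prop) hk).congr (Eventually.of_forall fun t => ?_)
    have : (1 + t ^ 2 : ℝ) ≠ 0 := by positivity
    simp [smul_smul, this]
  -- Convergence is proved at every Lebesgue point x: near x the means of |f - f(x)| are small, and
  -- far from x the kernel is O(y).
  filter_upwards [IsUnifLocDoublingMeasure.ae_tendsto_average_norm_sub volume hloc 1] with x hx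
  have hx' := hx (fun _ : ℝ => x) id (l := 𝓝[>] 0) tendsto_id
    (by filter_upwards [self_mem_nhdsWithin] with r (hr : 0 < r)
        simpa using hr.le)
  have hmeas : AEMeasurable (fun t => ‖f t - f x‖ₑ) :=
    (hloc.aestronglyMeasurable.sub aestronglyMeasurable_const).enorm
  set M : ℝ≥0∞ := ∫⁻ t : ℝ, ‖(1 + t ^ 2)⁻¹ • (f t - f x)‖ₑ with hM
  have hMfin : M < ∞ := by
    have : Integrable fun t : ℝ => (1 + t ^ 2)⁻¹ • (f t - f x) := by
      simp_rw [smul_sub]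
      exact hf.sub (integrable_inv_one_add_sq.smul_const _)
    exact this.2
  have hfar : ∀ δ > 0, ∀ y > 0, ∫⁻ t in (Metric.closedBall x δ)ᶜ,
      ENNReal.ofReal (poissonHP y (t - x)) * ‖f t - f x‖ₑ
        ≤ ENNReal.ofReal (y * ((1 + 2 * x ^ 2) / δ ^ 2 + 2)) * M := by
    intro δ hδ y hy
    rw [hM, ← lintegral_const_mul' _ _ ENNReal.ofReal_ne_top]
    refine (setLIntegral_mono' Metric.isClosed_closedBall.measurableSet.compl
      fun t ht => ?_).trans (setLIntegral_le_lintegral _ _)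
    rw [enorm_smul, ← mul_assoc]
    gcongr
    rw [Real.enorm_of_nonneg (by positivity), ← ENNReal.ofReal_mul (by positivity)]
    refine ENNReal.ofReal_le_ofReal ?_
    have h1 : δ < |t - x| := by simpa [Real.dist_eq] using ht
    have h2 : δ ^ 2 ≤ (t - x) ^ 2 := by rw [← sq_abs (t - x)]; gcongr
    have h3 : 1 + 2 * x ^ 2 ≤ (1 + 2 * x ^ 2) / δ ^ 2 * (t - x) ^ 2 := by
      rw [div_mul_eq_mul_div, le_div_iff₀ (by positivity)]; gcongr
    have h4 : 0 < (t - x) ^ 2 := lt_of_lt_of_le (by positivity) h2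
    unfold poissonHP
    rw [← div_eq_mul_inv, div_le_div_iff₀ (by positivity) (by positivity), mul_assoc]
    gcongr
    have h5 : 1 + t ^ 2 ≤ ((1 + 2 * x ^ 2) / δ ^ 2 + 2) * (t - x) ^ 2 := by
      nlinarith [sq_nonneg (t - 2 * x)]
    refine h5.trans ?_
    gcongr
    nlinarith [sq_nonneg y]
  rw [tendsto_iff_edist_tendsto_0]
  rw [ENNReal.tendsto_nhds_zero]
  intro ε hε
  -- A ball of radius r has length 2r, so a mean below e bounds the integral by 2er; the near
  -- estimate then yields 8 · 2e.
  obtain ⟨e, he0, he⟩ : ∃ e : ℝ, 0 < e ∧ ENNReal.ofReal (8 * (e * 2)) ≤ ε / 2 := by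
    have : Tendsto (fun e : ℝ => ENNReal.ofReal (8 * (e * 2))) (𝓝[>] 0) (𝓝 0) := by
      have : Continuous fun e : ℝ => ENNReal.ofReal (8 * (e * 2)) :=
        ENNReal.continuous_ofReal.comp (by fun_prop)
      have h := this.tendsto 0
      simp only [zero_mul, mul_zero, ENNReal.ofReal_zero] at h
      exact h.mono_left nhdsWithin_le_nhds
    obtain ⟨e, h1, h2⟩ := ((ENNReal.tendsto_nhds_zero.1 this (ε / 2)
      (ENNReal.half_pos hε.ne')).and self_mem_nhdsWithin).exists
    exact ⟨e, h2, h1⟩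
  obtain ⟨δ, hδ0, hδ⟩ : ∃ δ : ℝ, 0 < δ ∧ ∀ r, 0 < r → r ≤ δ →
      ∫⁻ t in Metric.closedBall x r, ‖f t - f x‖ₑ ≤ ENNReal.ofReal (e * 2 * r) := by
    have h1 := hx'.eventually (gt_mem_nhds he0)
    rw [eventually_nhdsWithin_iff, Metric.eventually_nhds_iff] at h1
    obtain ⟨d, hd, h⟩ := h1
    refine ⟨d / 2, by positivity, fun r hr hrd => ?_⟩
    have h2 := h (y := r) (by rw [Real.dist_eq, sub_zero, abs_of_pos hr]; linarith) hr
    have h3 : IntegrableOn (fun t => f t - f x) (Metric.closedBall x r) :=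
      (hloc.integrableOn_isCompact (isCompact_closedBall x r)).sub
        (integrableOn_const (isCompact_closedBall x r).measure_lt_top.ne)
    rw [← ofReal_integral_norm_eq_lintegral_enorm h3]
    refine ENNReal.ofReal_le_ofReal ?_
    rw [setAverage_eq, measureReal_def, id, Real.volume_closedBall, ENNReal.toReal_ofReal
      (by positivity), smul_eq_mul, inv_mul_lt_iff₀ (by positivity)] at h2
    linarith
  have hfar0 : ∀ᶠ y in 𝓝[>] (0 : ℝ),
      ENNReal.ofReal (y * ((1 + 2 * x ^ 2) / δ ^ 2 + 2)) * M ≤ ε / 2 := by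
    have h1 : Tendsto (fun y : ℝ => ENNReal.ofReal (y * ((1 + 2 * x ^ 2) / δ ^ 2 + 2)) * M)
        (𝓝[>] 0) (𝓝 0) := by
      have : Continuous fun y : ℝ => ENNReal.ofReal (y * ((1 + 2 * x ^ 2) / δ ^ 2 + 2)) * M :=
        (ENNReal.continuous_mul_const hMfin.ne).comp (ENNReal.continuous_ofReal.comp (by fun_prop))
      have h := this.tendsto 0
      simp only [zero_mul, ENNReal.ofReal_zero] at h
      exact h.mono_left nhdsWithin_le_nhds
    exact ENNReal.tendsto_nhds_zero.1 h1 _ (ENNReal.half_pos hε.ne')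
  filter_upwards [hfar0, self_mem_nhdsWithin] with y hyf (hy : 0 < y)
  have hint := integrable_poissonHP_smul hf hy x
  have hint' := (integrable_poissonHP hy x).smul_const (f x)
  have heq : (Real.pi⁻¹ • ∫ t : ℝ, poissonHP y (t - x) • f t) - f x
      = Real.pi⁻¹ • ∫ t : ℝ, poissonHP y (t - x) • (f t - f x) := by
    simp_rw [smul_sub]
    rw [integral_sub hint hint', integral_smul_const, integral_poissonHP hy, smul_sub, smul_smul,
      inv_mul_cancel₀ Real.pi_ne_zero, one_smul]
  rw [edist_eq_enorm_sub, heq, enorm_smul]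
  have hpi : ‖Real.pi⁻¹‖ₑ ≤ 1 := by
    rw [Real.enorm_of_nonneg (by positivity)]
    refine ENNReal.ofReal_le_one.2 (inv_le_one_of_one_le₀ ?_)
    linarith [Real.pi_gt_three]
  calc ‖Real.pi⁻¹‖ₑ * ‖∫ t : ℝ, poissonHP y (t - x) • (f t - f x)‖ₑ
      ≤ 1 * ∫⁻ t : ℝ, ‖poissonHP y (t - x) • (f t - f x)‖ₑ := by
        gcongr
        exact enorm_integral_le_lintegral_enorm _
    _ = ∫⁻ t : ℝ, ENNReal.ofReal (poissonHP y (t - x)) * ‖f t - f x‖ₑ := by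
        rw [one_mul]
        congr with t
        rw [enorm_smul, Real.enorm_of_nonneg (poissonHP_nonneg hy _)]
    _ = (∫⁻ t in Metric.closedBall x δ, ENNReal.ofReal (poissonHP y (t - x)) * ‖f t - f x‖ₑ) +
        ∫⁻ t in (Metric.closedBall x δ)ᶜ,
          ENNReal.ofReal (poissonHP y (t - x)) * ‖f t - f x‖ₑ :=
        (lintegral_add_compl _ Metric.isClosed_closedBall.measurableSet).symm
    _ ≤ ε / 2 + ε / 2 := by
        gcongr
        · exact (lintegral_poissonHP_near_le hmeas hδ0 (by positivity) hy hδ).trans he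
        · exact (hfar δ hδ0 y hy).trans hyf
    _ = ε := ENNReal.add_halves ε

/-! ### Contour shifts and the Hardy space of the half-plane -/

lemma eLpNorm_two_sq {α E : Type*} [MeasurableSpace α] {μ : Measure α} [NormedAddCommGroup E]
    (f : α → E) : eLpNorm f 2 μ ^ 2 = ∫⁻ t, ‖f t‖ₑ ^ 2 ∂μ := by
  have := eLpNorm_nnreal_pow_eq_lintegral (f := f) (μ := μ) (p := 2) two_ne_zero
  simpa using this

lemma memLp_two_of_lintegral {α E : Type*} [MeasurableSpace α] {μ : Measure α}
    [NormedAddCommGroup E] {f : α → E} (hf : AEStronglyMeasurable f μ)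
    (h : ∫⁻ t, ‖f t‖ₑ ^ 2 ∂μ < ∞) : MemLp f 2 μ := by
  refine ⟨hf, ?_⟩
  rw [← eLpNorm_two_sq] at h
  by_contra h'
  simp only [not_lt, top_le_iff] at h'
  simp [h'] at h

lemma memLp_line {Φ : ℂ → ℂ} {a b y : ℝ} (hΦ : DifferentiableOn ℂ Φ {z | a < z.im ∧ z.im < b})
    (ha : a < y) (hb : y < b) : Continuous fun t : ℝ => Φ (t + y * Complex.I) := by
  refine continuousOn_univ.1 (hΦ.continuousOn.comp (by fun_prop) fun t _ => ?_)
  simp [ha, hb]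

/-- Supplies arbitrarily large R for which the vertical sides of a rectangular contour are
negligible, although no pointwise decay of the function is known. -/
lemma frequently_lt_of_lintegral {v : ℝ → ℝ≥0∞} (hv : ∫⁻ R, v R < ∞) {ε : ℝ≥0∞} (hε : 0 < ε) :
    ∃ᶠ R in atTop, v R < ε := by
  intro h
  obtain ⟨N, hN⟩ := eventually_atTop.1 h
  have h1 : ∫⁻ _ in Set.Ici N, ε ≤ ∫⁻ R, v R :=
    (setLIntegral_mono' measurableSet_Ici fun R hR => not_lt.1 (hN R hR)).trans
      (setLIntegral_le_lintegral _ _)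
  simp [hε.ne', ENNReal.mul_top] at h1
  exact hv.ne h1

/-- The integral over a horizontal line of a holomorphic function, integrable uniformly on lines,
does not depend on the line. -/
lemma integral_line_eq {Φ : ℂ → ℂ} {a b : ℝ}
    (hΦ : DifferentiableOn ℂ Φ {z | a < z.im ∧ z.im < b}) {C : ℝ≥0∞} (hC : C < ∞)
    (hb : ∀ y : ℝ, a < y → y < b → ∫⁻ t : ℝ, ‖Φ (t + y * Complex.I)‖ₑ ≤ C)
    {y₁ y₂ : ℝ} (h1 : a < y₁) (h12 : y₁ ≤ y₂) (h2 : y₂ < b) :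
    ∫ t : ℝ, Φ (t + y₁ * Complex.I) = ∫ t : ℝ, Φ (t + y₂ * Complex.I) := by
  have hint : ∀ y : ℝ, a < y → y < b → Integrable fun t : ℝ => Φ (t + y * Complex.I) :=
    fun y hy hy' => ⟨(memLp_line hΦ hy hy').aestronglyMeasurable, (hb y hy hy').trans_lt hC⟩
  -- `v R` bounds the integral over the vertical side at abscissa R. By Tonelli it is integrable in
  -- R, hence small for arbitrarily large R, on both sides of the rectangle at once.
  set v : ℝ → ℝ≥0∞ := fun R => ∫⁻ y in Set.Icc y₁ y₂, ‖Φ (R + y * Complex.I)‖ₑ with hv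
  have hmeas : AEMeasurable (fun p : ℝ × ℝ => ‖Φ (p.1 + p.2 * Complex.I)‖ₑ)
      ((volume : Measure ℝ).prod (volume.restrict (Set.Icc y₁ y₂))) := by
    have h3 : ContinuousOn (fun p : ℝ × ℝ => ‖Φ (p.1 + p.2 * Complex.I)‖ₑ)
        (Set.univ ×ˢ Set.Icc y₁ y₂) := by
      refine (hΦ.continuousOn.comp (by fun_prop) fun p hp => ?_).enorm
      have := hp.2
      simp only [Set.mem_Icc] at this
      simp only [Set.mem_ofPred_eq, Complex.add_im, Complex.ofReal_im, Complex.mul_im,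
        Complex.ofReal_re, Complex.I_im, Complex.I_re, mul_one, mul_zero, zero_add, add_zero]
      exact ⟨h1.trans_le this.1, this.2.trans_lt h2⟩
    have h4 := h3.aemeasurable (μ := (volume : Measure ℝ).prod volume)
      (MeasurableSet.univ.prod measurableSet_Icc)
    rwa [← Measure.prod_restrict, Measure.restrict_univ] at h4
  have hvfin : ∫⁻ R, v R < ∞ := by
    rw [hv, lintegral_lintegral_swap hmeas]
    calc ∫⁻ y in Set.Icc y₁ y₂, ∫⁻ t : ℝ, ‖Φ (t + y * Complex.I)‖ₑ
        ≤ ∫⁻ y in Set.Icc y₁ y₂, C := setLIntegral_mono' measurableSet_Icc fun y hy =>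
          hb y (h1.trans_le hy.1) (hy.2.trans_lt h2)
      _ < ∞ := by
          rw [setLIntegral_const, Real.volume_Icc]
          exact ENNReal.mul_lt_top hC ENNReal.ofReal_lt_top
  have hvfin' : ∫⁻ R, (v R + v (-R)) < ∞ := by
    have h5 : AEMeasurable v := hmeas.lintegral_prod_right'
    rw [lintegral_add_left' h5, lintegral_neg_eq_self v]
    exact ENNReal.add_lt_top.2 ⟨hvfin, hvfin⟩
  have hlim : Tendsto (fun R : ℝ => ‖(∫ t in (-R)..R, Φ (t + y₁ * Complex.I)) -
      ∫ t in (-R)..R, Φ (t + y₂ * Complex.I)‖) atTop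
      (𝓝 ‖(∫ t : ℝ, Φ (t + y₁ * Complex.I)) - ∫ t : ℝ, Φ (t + y₂ * Complex.I)‖) :=
    ((intervalIntegral_tendsto_integral (hint y₁ h1 (h12.trans_lt h2)) tendsto_neg_atTop_atBot
      tendsto_id).sub (intervalIntegral_tendsto_integral (hint y₂ (h1.trans_le h12) h2)
        tendsto_neg_atTop_atBot tendsto_id)).norm
  have hle : ∀ R : ℝ, v R + v (-R) < ∞ → ‖(∫ t in (-R)..R, Φ (t + y₁ * Complex.I)) -
      ∫ t in (-R)..R, Φ (t + y₂ * Complex.I)‖ ≤ (v R + v (-R)).toReal := by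
    intro R hR
    have hrect := Complex.integral_boundary_rect_eq_zero_of_differentiableOn Φ
      (-R + y₁ * Complex.I) (R + y₂ * Complex.I) (hΦ.mono ?_)
    · simp only [Complex.add_re, Complex.neg_re, Complex.ofReal_re, Complex.mul_re, Complex.I_re,
        mul_zero, Complex.ofReal_im, Complex.I_im, mul_one, sub_self, add_zero, Complex.add_im,
        Complex.neg_im, neg_zero, Complex.mul_im, zero_add, smul_eq_mul] at hrect
      have h6 : (∫ t in (-R)..R, Φ (t + y₁ * Complex.I)) -
          ∫ t in (-R)..R, Φ (t + y₂ * Complex.I) =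
          Complex.I * (∫ y in y₁..y₂, Φ ((-R : ℝ) + y * Complex.I)) -
          Complex.I * ∫ y in y₁..y₂, Φ (R + y * Complex.I) := by
        linear_combination hrect
      have h7 : ∀ R : ℝ, v R < ∞ →
          ‖Complex.I * ∫ y in y₁..y₂, Φ (R + y * Complex.I)‖ ≤ (v R).toReal := by
        intro R hR
        rw [norm_mul, Complex.norm_I, one_mul, intervalIntegral.integral_of_le h12]
        refine (norm_integral_le_lintegral_norm _).trans (ENNReal.toReal_mono hR.ne ?_)
        simp_rw [ofReal_norm]
        exact lintegral_mono_set Set.Ioc_subset_Icc_self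
      have h8 := ENNReal.add_lt_top.1 hR
      rw [h6, ENNReal.toReal_add h8.1.ne h8.2.ne, add_comm (v R).toReal]
      exact (norm_sub_le _ _).trans (add_le_add (h7 _ h8.2) (h7 _ h8.1))
    · intro z hz
      rw [Complex.mem_reProdIm] at hz
      have := hz.2
      simp only [Complex.add_im, Complex.neg_im, Complex.ofReal_im, Complex.mul_im,
        Complex.ofReal_re, Complex.I_im, Complex.I_re, mul_one, mul_zero, zero_add, add_zero,
        neg_zero, Set.uIcc_of_le h12] at this
      exact ⟨h1.trans_le this.1, this.2.trans_lt h2⟩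
  rw [← sub_eq_zero, ← norm_eq_zero]
  refine le_antisymm (le_of_forall_pos_le_add fun ε hε => ?_) (norm_nonneg _)
  rw [zero_add]
  refine le_of_tendsto_of_frequently hlim
    ((frequently_lt_of_lintegral hvfin' (ENNReal.ofReal_pos.2 hε)).mono fun R hR => ?_)
  refine (hle R (hR.trans ENNReal.ofReal_lt_top)).trans ?_
  exact ENNReal.toReal_le_of_le_ofReal hε.le hR.le

/-- The line can be pushed upwards without changing the integral, while the absolute integrals tend
to zero. -/
lemma integral_line_eq_zero {Φ : ℂ → ℂ} {a : ℝ} (hΦ : DifferentiableOn ℂ Φ {z | a < z.im})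
    {C : ℝ≥0∞} (hC : C < ∞) (hb : ∀ y : ℝ, a < y → ∫⁻ t : ℝ, ‖Φ (t + y * Complex.I)‖ₑ ≤ C)
    (h0 : Tendsto (fun y : ℝ => ∫⁻ t : ℝ, ‖Φ (t + y * Complex.I)‖ₑ) atTop (𝓝 0))
    {y₁ : ℝ} (h1 : a < y₁) : ∫ t : ℝ, Φ (t + y₁ * Complex.I) = 0 := by
  have h2 : ∀ᶠ y : ℝ in atTop, ‖∫ t : ℝ, Φ (t + y₁ * Complex.I)‖ₑ ≤
      ∫⁻ t : ℝ, ‖Φ (t + y * Complex.I)‖ₑ := by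
    filter_upwards [eventually_ge_atTop y₁] with y hy
    rw [integral_line_eq (a := a) (b := y + 1) (hΦ.mono fun z hz => hz.1) hC
      (fun y hy _ => hb y hy) h1 hy (by linarith)]
    exact enorm_integral_le_lintegral_enorm _
  have h3 := ge_of_tendsto h0 h2
  simpa using h3

/-! The Cauchy kernel on the line. -/

lemma sub_ne_zero_of_im {z : ℂ} (hz : z.im ≠ 0) (t : ℝ) : (t : ℂ) - z ≠ 0 := by
  intro h
  apply hz
  have := congrArg Complex.im h
  simpa using this

lemma norm_cauchy_sq {z : ℂ} (hz : z.im ≠ 0) (t : ℝ) :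
    ‖((t : ℂ) - z)⁻¹‖ ^ 2 = |z.im|⁻¹ * poissonHP |z.im| (t - z.re) := by
  have h1 : ‖(t : ℂ) - z‖ ^ 2 = (t - z.re) ^ 2 + |z.im| ^ 2 := by
    rw [← Complex.normSq_eq_norm_sq, Complex.normSq_apply, sq_abs]
    simp; ring
  rw [norm_inv, inv_pow, h1]
  unfold poissonHP
  have : |z.im| ≠ 0 := by simpa using hz
  field_simp

lemma lintegral_cauchy_sq {z : ℂ} (hz : z.im ≠ 0) :
    ∫⁻ t : ℝ, ‖((t : ℂ) - z)⁻¹‖ₑ ^ 2 = ENNReal.ofReal (Real.pi / |z.im|) := by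
  have h0 : 0 < |z.im| := by simpa using hz
  have h1 : ∀ t : ℝ, ‖((t : ℂ) - z)⁻¹‖ₑ ^ 2
      = ENNReal.ofReal (|z.im|⁻¹ * poissonHP |z.im| (t - z.re)) := by
    intro t
    rw [← norm_cauchy_sq hz, ENNReal.ofReal_pow (norm_nonneg _), ofReal_norm]
  simp_rw [h1]
  rw [← ofReal_integral_eq_lintegral_ofReal ((integrable_poissonHP h0 _).const_mul _)
    (Eventually.of_forall fun t => mul_nonneg (by positivity) (poissonHP_nonneg h0 _)),
    integral_const_mul, integral_poissonHP h0]
  congr 1; field_simp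

lemma continuous_cauchy {z : ℂ} (hz : z.im ≠ 0) : Continuous fun t : ℝ => ((t : ℂ) - z)⁻¹ :=
  Continuous.inv₀ (by fun_prop) (sub_ne_zero_of_im hz)

lemma memLp_cauchy {z : ℂ} (hz : z.im ≠ 0) : MemLp (fun t : ℝ => ((t : ℂ) - z)⁻¹) 2 volume :=
  memLp_two_of_lintegral (continuous_cauchy hz).aestronglyMeasurable
    (by rw [lintegral_cauchy_sq hz]; exact ENNReal.ofReal_lt_top)

lemma cauchy_sub_conj {z : ℂ} (hz : z.im ≠ 0) (t : ℝ) :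
    ((t : ℂ) - z)⁻¹ - ((t : ℂ) - conj z)⁻¹ = 2 * Complex.I * (poissonHP z.im (t - z.re) : ℂ) := by
  have hz' : (conj z).im ≠ 0 := by simpa using hz
  have h1 := sub_ne_zero_of_im hz t
  have h2 := sub_ne_zero_of_im hz' t
  have h3 : (((t - z.re) ^ 2 + z.im ^ 2 : ℝ) : ℂ) = (t - z) * (t - conj z) := by
    apply Complex.ext <;> simp [pow_two] <;> ring
  have h4 : z - conj z = 2 * Complex.I * z.im := by
    rw [Complex.sub_conj]; push_cast; ring
  unfold poissonHP
  rw [Complex.ofReal_div, h3]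
  field_simp
  linear_combination h4

lemma ennreal_mul_le_sq_add_sq (a b : ℝ≥0∞) : a * b ≤ a ^ 2 + b ^ 2 := by
  rcases le_total a b with h | h
  · calc a * b ≤ b * b := by gcongr
      _ = b ^ 2 := (sq b).symm
      _ ≤ _ := le_add_self
  · calc a * b ≤ a * a := by gcongr
      _ = a ^ 2 := (sq a).symm
      _ ≤ _ := le_self_add

lemma ennreal_add_sq_le (a b : ℝ≥0∞) : (a + b) ^ 2 ≤ 2 * (a ^ 2 + b ^ 2) := by
  have key : ∀ a c : ℝ≥0∞, (a + (a + c)) ^ 2 ≤ 2 * (a ^ 2 + (a + c) ^ 2) := fun a c => by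
    calc (a + (a + c)) ^ 2 ≤ (a + (a + c)) ^ 2 + c ^ 2 := le_self_add
      _ = _ := by ring
  rcases le_total a b with h | h
  · obtain ⟨c, rfl⟩ := exists_add_of_le h
    exact key a c
  · obtain ⟨c, rfl⟩ := exists_add_of_le h
    rw [add_comm (b + c) b, add_comm ((b + c) ^ 2)]
    exact key b c

/-- The free weight e can be chosen small against a factor that is only bounded, after which the
other factor is made small. -/
lemma lintegral_mul_le_weighted {f g : ℝ → ℂ} (hg : AEMeasurable g) (e : ℝ≥0) (he : e ≠ 0) :
    ∫⁻ t, ‖f t * g t‖ₑ ≤ e * (∫⁻ t, ‖f t‖ₑ ^ 2) + (e : ℝ≥0∞)⁻¹ * ∫⁻ t, ‖g t‖ₑ ^ 2 := by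
  have he' : (e : ℝ≥0∞) ≠ 0 := by simpa using he
  rw [← lintegral_const_mul'' _ (hg.enorm.pow_const 2),
    ← lintegral_const_mul' _ _ ENNReal.coe_ne_top,
    ← lintegral_add_right' _ ((hg.enorm.pow_const 2).const_mul _)]
  refine lintegral_mono fun t => ?_
  rw [enorm_mul]
  rcases le_total (e * ‖f t‖ₑ) ‖g t‖ₑ with h | h
  · refine le_trans ?_ le_add_self
    rw [← ENNReal.mul_le_iff_le_inv he' ENNReal.coe_ne_top]
    calc (e : ℝ≥0∞) * (‖f t‖ₑ * ‖g t‖ₑ) = (e * ‖f t‖ₑ) * ‖g t‖ₑ := by ring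
      _ ≤ ‖g t‖ₑ * ‖g t‖ₑ := by gcongr
      _ = _ := (sq _).symm
  · refine le_trans ?_ le_self_add
    calc ‖f t‖ₑ * ‖g t‖ₑ ≤ ‖f t‖ₑ * (e * ‖f t‖ₑ) := by gcongr
      _ = _ := by ring

/-- At height y the Cauchy kernel has squared norm π / (y - Im z), which tends to zero, while F
stays bounded in L². -/
lemma tendsto_lintegral_line_mul_cauchy {F : ℂ → ℂ} {a : ℝ} {z : ℂ} {C : ℝ≥0∞} (hC : C < ∞)
    (hF : ∀ y : ℝ, a < y → ∫⁻ t : ℝ, ‖F (t + y * Complex.I)‖ₑ ^ 2 ≤ C) :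
    Tendsto (fun y : ℝ => ∫⁻ t : ℝ, ‖F (t + y * Complex.I) * (t + y * Complex.I - z)⁻¹‖ₑ)
      atTop (𝓝 0) := by
  rw [ENNReal.tendsto_nhds_zero]
  intro ε hε
  obtain ⟨e, he0, he⟩ : ∃ e : ℝ≥0, e ≠ 0 ∧ e * C ≤ ε / 2 := by
    rcases eq_or_ne C 0 with h | h
    · exact ⟨1, one_ne_zero, by simp [h]⟩
    · have : ε / 2 / C ≠ 0 := by
        simp [hε.ne', hC.ne]
      obtain ⟨e, h1, h2⟩ := ENNReal.lt_iff_exists_nnreal_btwn.1 (pos_iff_ne_zero.2 this)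
      refine ⟨e, by simpa using h1.ne', ?_⟩
      exact (ENNReal.le_div_iff_mul_le (Or.inl h) (Or.inl hC.ne)).1 h2.le
  have h0 : Tendsto (fun y : ℝ => (e : ℝ≥0∞)⁻¹ * ENNReal.ofReal (Real.pi / |z.im - y|)) atTop
      (𝓝 ((e : ℝ≥0∞)⁻¹ * ENNReal.ofReal 0)) := by
    refine ENNReal.Tendsto.const_mul (ENNReal.tendsto_ofReal ?_) (Or.inr (by simpa using he0))
    refine Tendsto.div_atTop tendsto_const_nhds (tendsto_abs_atBot_atTop.comp ?_)
    exact tendsto_atBot_add_const_left _ _ tendsto_neg_atTop_atBot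
  rw [ENNReal.ofReal_zero, mul_zero] at h0
  filter_upwards [ENNReal.tendsto_nhds_zero.1 h0 _ (ENNReal.half_pos hε.ne'),
    eventually_gt_atTop a, eventually_gt_atTop z.im] with y hy hya hyz
  have him' : (z - y * Complex.I).im = z.im - y := by simp
  have him : (z - y * Complex.I).im ≠ 0 := by
    rw [him']; linarith
  have hc : ∀ t : ℝ, ((t : ℂ) + y * Complex.I - z)⁻¹ = ((t : ℂ) - (z - y * Complex.I))⁻¹ := by
    intro t; congr 1; ring
  simp_rw [hc]
  refine (lintegral_mul_le_weighted (continuous_cauchy him).measurable.aemeasurable e he0).trans ?_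
  rw [lintegral_cauchy_sq him]
  calc _ ≤ e * C + (e : ℝ≥0∞)⁻¹ * ENNReal.ofReal (Real.pi / |z.im - y|) := by
        rw [him']
        gcongr
        exact hF y hya
    _ ≤ ε / 2 + ε / 2 := add_le_add he hy
    _ = ε := ENNReal.add_halves ε

/-- For a function holomorphic in a neighbourhood of the closed half-plane: the lower half-plane
Cauchy integral vanishes. -/
lemma integral_mul_cauchy_conj_of_lt {F : ℂ → ℂ} {a : ℝ} (ha : a < 0)
    (hFd : DifferentiableOn ℂ F {z | a < z.im}) {C : ℝ≥0∞} (hC : C < ∞)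
    (hF : ∀ y : ℝ, a < y → ∫⁻ t : ℝ, ‖F (t + y * Complex.I)‖ₑ ^ 2 ≤ C) {μ : ℂ} (hμ : 0 < μ.im) :
    ∫ t : ℝ, F t * ((t : ℂ) - conj μ)⁻¹ = 0 := by
  -- This level is below the real line and still at distance at least Im μ / 2 above the pole conj
  -- μ.
  set b : ℝ := max a (-(μ.im / 2)) with hb
  have hb0 : b < 0 := max_lt ha (by linarith)
  have hbμ : -(μ.im / 2) ≤ b := le_max_right _ _
  have hsub : {z : ℂ | b < z.im} ⊆ {z : ℂ | a < z.im} := fun z (hz : b < z.im) =>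
    (le_max_left _ _ : a ≤ b).trans_lt hz
  have hΦ : DifferentiableOn ℂ (fun w => F w * (w - conj μ)⁻¹) {z | b < z.im} := by
    refine (hFd.mono hsub).mul
      (DifferentiableOn.inv (by fun_prop) fun z (hz : b < z.im) h => ?_)
    have h1 := congrArg Complex.im h
    simp only [Complex.sub_im, Complex.conj_im, Complex.zero_im, sub_neg_eq_add] at h1
    linarith
  have him : ∀ y : ℝ, b < y → (conj μ - y * Complex.I).im ≠ 0 := by
    intro y hy
    simp; linarith
  have hc : ∀ y t : ℝ, ((t : ℂ) + y * Complex.I - conj μ)⁻¹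
      = ((t : ℂ) - (conj μ - y * Complex.I))⁻¹ := by
    intro y t; congr 1; ring
  have := integral_line_eq_zero hΦ (C := C + ENNReal.ofReal (Real.pi / (μ.im / 2)))
    (ENNReal.add_lt_top.2 ⟨hC, ENNReal.ofReal_lt_top⟩) (fun y hy => ?_)
    (tendsto_lintegral_line_mul_cauchy hC hF) hb0
  · simpa using this
  · simp_rw [hc]
    refine (lintegral_mul_le_weighted (continuous_cauchy (him y hy)).measurable.aemeasurable 1
      one_ne_zero).trans ?_
    simp only [ENNReal.coe_one, one_mul, inv_one]
    gcongr
    · exact hF y ((le_max_left _ _ : a ≤ b).trans_lt hy)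
    · rw [lintegral_cauchy_sq (him y hy)]
      refine ENNReal.ofReal_le_ofReal ?_
      gcongr
      rw [le_abs]; right
      simp; linarith

/-- The Cauchy formula for a function holomorphic in a neighbourhood of the closed half-plane. -/
lemma integral_mul_cauchy_of_lt {F : ℂ → ℂ} {a : ℝ} (ha : a < 0)
    (hFd : DifferentiableOn ℂ F {z | a < z.im}) {C : ℝ≥0∞} (hC : C < ∞)
    (hF : ∀ y : ℝ, a < y → ∫⁻ t : ℝ, ‖F (t + y * Complex.I)‖ₑ ^ 2 ≤ C) {μ : ℂ} (hμ : 0 < μ.im) :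
    ∫ t : ℝ, F t * ((t : ℂ) - μ)⁻¹ = 2 * Real.pi * Complex.I * F μ := by
  set b : ℝ := max a (-(μ.im / 2)) with hb
  have hb0 : b < 0 := max_lt ha (by linarith)
  have hbμ : -(μ.im / 2) ≤ b := le_max_right _ _
  have hsub : {z : ℂ | b < z.im} ⊆ {z : ℂ | a < z.im} := fun z (hz : b < z.im) =>
    (le_max_left _ _ : a ≤ b).trans_lt hz
  have hμ' : (conj μ).im ≠ 0 := by simpa using hμ.ne'
  have hne : ∀ z : ℂ, b < z.im → z - conj μ ≠ 0 := by
    intro z hz h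
    have h1 := congrArg Complex.im h
    simp only [Complex.sub_im, Complex.conj_im, Complex.zero_im, sub_neg_eq_add] at h1
    linarith
  -- Subtracting a multiple of the kernel with pole at conj μ makes ψ vanish at μ, so ψ(w) / (w - μ)
  -- extends holomorphically as `dslope ψ μ` and integrates to zero. The subtracted term becomes
  -- F(μ) times 2i times the Poisson kernel, whose integral π gives the right-hand side.
  set ψ : ℂ → ℂ := fun w => F w - F μ * (μ - conj μ) * (w - conj μ)⁻¹ with hψ
  have hμμ : μ - conj μ ≠ 0 := hne μ (by linarith)
  have hψμ : ψ μ = 0 := by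
    simp only [hψ]; field_simp; simp
  have hopen : IsOpen {z : ℂ | b < z.im} := isOpen_lt continuous_const Complex.continuous_im
  have hψd : DifferentiableOn ℂ ψ {z | b < z.im} :=
    (hFd.mono hsub).sub
      ((DifferentiableOn.inv (by fun_prop) fun z (hz : b < z.im) => hne z hz).const_mul _)
  have hΦd : DifferentiableOn ℂ (dslope ψ μ) {z | b < z.im} :=
    (Complex.differentiableOn_dslope (hopen.mem_nhds (by
      change b < μ.im; linarith))).2 hψd
  have hΦ : ∀ w, w ≠ μ → dslope ψ μ w = ψ w * (w - μ)⁻¹ := by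
    intro w hw
    rw [dslope_of_ne _ hw, slope_def_field, hψμ, sub_zero, div_eq_mul_inv]
  have him : ∀ y : ℝ, b < y → (conj μ - y * Complex.I).im ≠ 0 := by
    intro y hy
    simp; linarith
  have hc : ∀ y t : ℝ, ((t : ℂ) + y * Complex.I - conj μ)⁻¹
      = ((t : ℂ) - (conj μ - y * Complex.I))⁻¹ := by
    intro y t; congr 1; ring
  set A : ℝ≥0∞ := ‖F μ * (μ - conj μ)‖ₑ ^ 2 * ENNReal.ofReal (Real.pi / (μ.im / 2)) with hA
  have hAfin : A < ∞ := ENNReal.mul_lt_top (ENNReal.pow_lt_top enorm_lt_top) ENNReal.ofReal_lt_top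
  have hψb : ∀ y : ℝ, b < y → ∫⁻ t : ℝ, ‖ψ (t + y * Complex.I)‖ₑ ^ 2 ≤ 2 * (C + A) := by
    intro y hy
    have hk : Measurable fun t : ℝ => ‖((t : ℂ) + y * Complex.I - conj μ)⁻¹‖ₑ ^ 2 := by
      simp_rw [hc]
      exact (continuous_cauchy (him y hy)).measurable.enorm.pow_const 2
    calc ∫⁻ t : ℝ, ‖ψ (t + y * Complex.I)‖ₑ ^ 2
        ≤ ∫⁻ t : ℝ, 2 * (‖F (t + y * Complex.I)‖ₑ ^ 2 + ‖F μ * (μ - conj μ)‖ₑ ^ 2 *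
          ‖((t : ℂ) + y * Complex.I - conj μ)⁻¹‖ₑ ^ 2) := by
          refine lintegral_mono fun t => ?_
          rw [← mul_pow, ← enorm_mul]
          calc _ ≤ (‖F (t + y * Complex.I)‖ₑ + ‖F μ * (μ - conj μ) *
                ((t : ℂ) + y * Complex.I - conj μ)⁻¹‖ₑ) ^ 2 := by
                gcongr; exact enorm_sub_le
            _ ≤ _ := by
                exact ennreal_add_sq_le _ _
      _ ≤ 2 * (C + A) := by
          rw [lintegral_const_mul' _ _ (by simp), lintegral_add_right' _ (hk.const_mul _).aemeasurable,
            lintegral_const_mul _ hk]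
          gcongr
          · exact hF y ((le_max_left _ _ : a ≤ b).trans_lt hy)
          · simp_rw [hc]
            rw [lintegral_cauchy_sq (him y hy), hA]
            gcongr
            rw [le_abs]; right
            simp; linarith
  have hCA : 2 * (C + A) < ∞ := ENNReal.mul_lt_top (by simp) (ENNReal.add_lt_top.2 ⟨hC, hAfin⟩)
  obtain ⟨M, hM⟩ : ∃ M : ℝ, ∀ w ∈ Metric.closedBall μ μ.im, ‖dslope ψ μ w‖ ≤ M := by
    refine (isCompact_closedBall μ μ.im).exists_bound_of_continuousOn
      (hΦd.continuousOn.mono fun w hw => ?_)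
    have h1 : |(w - μ).im| ≤ μ.im := (Complex.abs_im_le_norm _).trans (by
      simpa [dist_eq_norm] using hw)
    have h2 := (abs_le.1 h1).1
    simp only [Complex.sub_im] at h2
    change b < w.im
    linarith
  -- In the disc of radius Im μ about μ the quotient is bounded by compactness. Outside it is a
  -- product of two square integrable functions, and there |t - μ|² ≤ 2 |w - μ|² makes the bound
  -- independent of the height.
  have hL1 : ∀ y : ℝ, b < y → ∫⁻ t : ℝ, ‖dslope ψ μ (t + y * Complex.I)‖ₑ ≤
      ENNReal.ofReal M * ENNReal.ofReal (2 * μ.im) + (2 * (C + A) +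
        2 * ENNReal.ofReal (Real.pi / μ.im)) := by
    intro y hy
    have hpt : ∀ t : ℝ, ‖dslope ψ μ (t + y * Complex.I)‖ₑ ≤
        (Metric.closedBall μ.re μ.im).indicator (fun _ => ENNReal.ofReal M) t +
        (‖ψ (t + y * Complex.I)‖ₑ ^ 2 + 2 * ‖((t : ℂ) - μ)⁻¹‖ₑ ^ 2) := by
      intro t
      set w : ℂ := t + y * Complex.I with hw
      by_cases hball : w ∈ Metric.closedBall μ μ.im
      · have ht : t ∈ Metric.closedBall μ.re μ.im := by
          have h1 : |(w - μ).re| ≤ μ.im := (Complex.abs_re_le_norm _).trans (by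
            simpa [dist_eq_norm] using hball)
          simpa [hw, Real.dist_eq] using h1
        rw [Set.indicator_of_mem ht]
        refine le_trans ?_ le_self_add
        rw [← ofReal_norm]
        exact ENNReal.ofReal_le_ofReal (hM w hball)
      · have hne : w ≠ μ := by
          rintro h; apply hball; simp [h, hμ.le]
        rw [hΦ w hne, enorm_mul]
        refine le_trans ?_ le_add_self
        refine (ennreal_mul_le_sq_add_sq _ _).trans ?_
        gcongr
        have h5 : μ.im ≤ ‖w - μ‖ := by
          simp only [Metric.mem_closedBall, dist_eq_norm, not_le] at hball
          exact hball.le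
        have h6 : |t - μ.re| ≤ ‖w - μ‖ := by
          have := Complex.abs_re_le_norm (w - μ)
          simpa [hw] using this
        have h7 : ‖(t : ℂ) - μ‖ ^ 2 ≤ 2 * ‖w - μ‖ ^ 2 := by
          have h8 : ‖(t : ℂ) - μ‖ ^ 2 = |t - μ.re| ^ 2 + μ.im ^ 2 := by
            rw [← Complex.normSq_eq_norm_sq, Complex.normSq_apply, sq_abs]
            simp; ring
          rw [h8]
          have := pow_le_pow_left₀ hμ.le h5 2
          have := pow_le_pow_left₀ (abs_nonneg _) h6 2
          linarith
        have h9 : 0 < ‖(t : ℂ) - μ‖ := norm_pos_iff.2 (sub_ne_zero_of_im hμ.ne' t)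
        have h10 : 0 < ‖w - μ‖ := hμ.trans_le h5
        have h11 : ‖(w - μ)⁻¹‖ ^ 2 ≤ 2 * ‖((t : ℂ) - μ)⁻¹‖ ^ 2 := by
          rw [norm_inv, norm_inv, inv_pow, inv_pow, ← div_eq_mul_inv, inv_eq_one_div,
            div_le_div_iff₀ (by positivity) (by positivity)]
          linarith
        rw [← ofReal_norm, ← ofReal_norm, ← ENNReal.ofReal_pow (norm_nonneg _),
          ← ENNReal.ofReal_pow (norm_nonneg _)]
        refine (ENNReal.ofReal_le_ofReal h11).trans_eq ?_
        rw [ENNReal.ofReal_mul zero_le_two]; simp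
    refine (lintegral_mono hpt).trans ?_
    have hk : Measurable fun t : ℝ => 2 * ‖((t : ℂ) - μ)⁻¹‖ₑ ^ 2 :=
      ((continuous_cauchy hμ.ne').measurable.enorm.pow_const 2).const_mul _
    rw [lintegral_add_left (measurable_const.indicator Metric.isClosed_closedBall.measurableSet),
      lintegral_add_right _ hk, lintegral_indicator Metric.isClosed_closedBall.measurableSet,
      setLIntegral_const, Real.volume_closedBall, lintegral_const_mul' _ _ (by simp),
      lintegral_cauchy_sq hμ.ne', abs_of_pos hμ]
    gcongr
    exact hψb y hy
  have hzero : ∫ t : ℝ, dslope ψ μ (t + (0 : ℝ) * Complex.I) = 0 := by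
    refine integral_line_eq_zero hΦd ?_ hL1 ?_ hb0
    · exact ENNReal.add_lt_top.2 ⟨ENNReal.mul_lt_top ENNReal.ofReal_lt_top ENNReal.ofReal_lt_top,
        ENNReal.add_lt_top.2 ⟨hCA, ENNReal.mul_lt_top (by simp) ENNReal.ofReal_lt_top⟩⟩
    · refine (tendsto_lintegral_line_mul_cauchy hCA hψb (z := μ)).congr' ?_
      filter_upwards [eventually_gt_atTop μ.im] with y hy
      refine lintegral_congr fun t => ?_
      rw [hΦ]
      intro h
      have := congrArg Complex.im h
      simp at this
      exact hy.ne' this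
  have hF0 : MemLp (fun t : ℝ => F t) 2 volume := by
    refine memLp_two_of_lintegral ?_ ((?_ : _ ≤ C).trans_lt hC)
    · have := memLp_line (a := a) (b := 1) (y := 0) (hFd.mono fun z hz => hz.1) ha one_pos
      simpa using this.aestronglyMeasurable
    · simpa using hF 0 ha
  have hint1 : Integrable fun t : ℝ => F t * ((t : ℂ) - μ)⁻¹ :=
    hF0.integrable_mul (memLp_cauchy hμ.ne')
  have hint2 : Integrable fun t : ℝ =>
      F μ * (2 * Complex.I) * (poissonHP μ.im (t - μ.re) : ℂ) :=
    ((integrable_poissonHP hμ μ.re).ofReal).const_mul _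
  have hpt : ∀ t : ℝ, dslope ψ μ (t + (0 : ℝ) * Complex.I) = F t * ((t : ℂ) - μ)⁻¹ -
      F μ * (2 * Complex.I) * (poissonHP μ.im (t - μ.re) : ℂ) := by
    intro t
    have h1 := sub_ne_zero_of_im hμ.ne' t
    have h2 := sub_ne_zero_of_im hμ' t
    rw [Complex.ofReal_zero, zero_mul, add_zero, hΦ t (by simpa [sub_eq_zero] using h1),
      mul_assoc (F μ), ← cauchy_sub_conj hμ.ne']
    simp only [hψ]
    field_simp
    ring
  simp_rw [hpt] at hzero
  rw [integral_sub hint1 hint2, integral_const_mul, integral_complex_ofReal, integral_poissonHP hμ,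
    sub_eq_zero] at hzero
  rw [hzero]; ring

lemma enorm_integral_mul_le {α : Type*} [MeasurableSpace α] {μ : Measure α} {f g : α → ℂ}
    (hf : AEStronglyMeasurable f μ) (hg : AEStronglyMeasurable g μ) :
    ‖∫ t, f t * g t ∂μ‖ₑ ≤ eLpNorm f 2 μ * eLpNorm g 2 μ := by
  refine (enorm_integral_le_lintegral_enorm _).trans ?_
  have := eLpNorm_smul_le_mul_eLpNorm (p := 2) (q := 2) (r := 1) hg hf
  rw [eLpNorm_one_eq_lintegral_enorm] at this
  simpa using this

lemma integrable_mul_of_memLp_two {α : Type*} [MeasurableSpace α] {μ : Measure α} {f g : α → ℂ}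
    (hf : MemLp f 2 μ) (hg : MemLp g 2 μ) : Integrable (fun t => f t * g t) μ :=
  hf.integrable_mul hg

lemma tendsto_integral_mul_of_eLpNorm {α ι : Type*} [MeasurableSpace α] {μ : Measure α}
    {l : Filter ι} {f : ι → α → ℂ} {g q : α → ℂ} (hf : ∀ᶠ i in l, MemLp (f i) 2 μ)
    (hg : MemLp g 2 μ) (hq : MemLp q 2 μ)
    (h : Tendsto (fun i => eLpNorm (fun t => f i t - g t) 2 μ) l (𝓝 0)) :
    Tendsto (fun i => ∫ t, f i t * q t ∂μ) l (𝓝 (∫ t, g t * q t ∂μ)) := by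
  rw [tendsto_iff_edist_tendsto_0]
  have h1 : Tendsto (fun i => eLpNorm (fun t => f i t - g t) 2 μ * eLpNorm q 2 μ) l (𝓝 0) := by
    simpa using ENNReal.Tendsto.mul_const h (Or.inr hq.2.ne)
  refine tendsto_of_tendsto_of_tendsto_of_le_of_le' tendsto_const_nhds h1
    (Eventually.of_forall fun _ => zero_le) ?_
  filter_upwards [hf] with i hi
  rw [edist_eq_enorm_sub, ← integral_sub (integrable_mul_of_memLp_two hi hq)
    (integrable_mul_of_memLp_two hg hq)]
  simp_rw [← sub_mul]
  exact enorm_integral_mul_le (hi.1.sub hg.1) hq.1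

lemma inner_toLp {α : Type*} [MeasurableSpace α] {μ : Measure α} {f g : α → ℂ}
    (hf : MemLp f 2 μ) (hg : MemLp g 2 μ) :
    inner ℂ (hf.toLp f) (hg.toLp g) = ∫ t, g t * conj (f t) ∂μ := by
  rw [L2.inner_def]
  refine integral_congr_ae ?_
  filter_upwards [hf.coeFn_toLp, hg.coeFn_toLp] with t h1 h2
  rw [h1, h2, RCLike.inner_apply]

/-! ### Boundary values and Cauchy formulas for functions in H². -/

lemma IsHardyTwo.memLp_line {G : ℂ → ℂ} (hG : IsHardyTwo G) {y : ℝ} (hy : 0 < y) :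
    MemLp (fun t : ℝ => G (t + y * Complex.I)) 2 volume := by
  obtain ⟨C, hC⟩ := hG.2
  refine memLp_two_of_lintegral ?_ ((hC y hy).trans_lt ENNReal.coe_lt_top)
  exact (_root_.memLp_line (a := 0) (b := y + 1) (hG.1.mono fun z hz => hz.1) hy
    (by linarith)).aestronglyMeasurable

/-- The function G(z) conj(G(conj z + ic)) with c = y + y' is holomorphic in the strip 0 < Im z < c,
so its line integrals agree. Thus scalar products of the restrictions to two lines depend only on
the sum of the heights. -/
lemma IsHardyTwo.integral_line_mul_conj {G : ℂ → ℂ} (hG : IsHardyTwo G) {y y' : ℝ} (hy : 0 < y)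
    (hy' : 0 < y') :
    ∫ t : ℝ, G (t + y * Complex.I) * conj (G (t + y' * Complex.I)) =
      ∫ t : ℝ, G (t + ((y + y') / 2 : ℝ) * Complex.I) *
        conj (G (t + ((y + y') / 2 : ℝ) * Complex.I)) := by
  obtain ⟨C, hC⟩ := hG.2
  set c : ℝ := y + y' with hc
  set Φ : ℂ → ℂ := fun z => G z * conj (G (conj z + c * Complex.I)) with hΦ
  have hval : ∀ u t : ℝ, Φ (t + u * Complex.I) =
      G (t + u * Complex.I) * conj (G (t + (c - u : ℝ) * Complex.I)) := by
    intro u t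
    have : conj ((t : ℂ) + u * Complex.I) + c * Complex.I = t + (c - u : ℝ) * Complex.I := by
      simp; ring
    simp only [hΦ, this]
  have hd : DifferentiableOn ℂ Φ {z | 0 < z.im ∧ z.im < c} := by
    have hopen : IsOpen {z : ℂ | 0 < z.im} := isOpen_lt continuous_const Complex.continuous_im
    intro z hz
    have h1 : DifferentiableAt ℂ G z := hG.1.differentiableAt (hopen.mem_nhds hz.1)
    have h2 : DifferentiableAt ℂ G (conj z + c * Complex.I) := by
      refine hG.1.differentiableAt (hopen.mem_nhds ?_)
      have := hz.2
      simpa using this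
    have h3 : DifferentiableAt ℂ (fun w => G (w + c * Complex.I)) (conj z) :=
      DifferentiableAt.comp (conj z) (g := G) (f := fun w => w + c * Complex.I) h2 (by fun_prop)
    have h4 := h3.conj_conj
    rw [Complex.conj_conj] at h4
    exact (h1.mul h4).differentiableWithinAt
  have hb : ∀ u : ℝ, 0 < u → u < c → ∫⁻ t : ℝ, ‖Φ (t + u * Complex.I)‖ₑ ≤ C + C := by
    intro u hu huc
    have huc' : 0 < c - u := by linarith
    refine le_trans (lintegral_mono (g := fun t : ℝ => ‖G (t + u * Complex.I)‖ₑ ^ 2 +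
      ‖G (t + (c - u : ℝ) * Complex.I)‖ₑ ^ 2) fun t => ?_) ?_
    · rw [hval, enorm_mul]
      refine (ennreal_mul_le_sq_add_sq _ _).trans_eq ?_
      simp
    · rw [lintegral_add_left' ((hG.memLp_line hu).1.enorm.pow_const 2)]
      exact add_le_add (hC u hu) (hC _ huc')
  have hCC : (C : ℝ≥0∞) + C < ∞ := ENNReal.add_lt_top.2 ⟨ENNReal.coe_lt_top, ENNReal.coe_lt_top⟩
  have e1 : c - y = y' := by rw [hc]; ring
  have e2 : c - c / 2 = c / 2 := by ring
  have key : ∫ t : ℝ, Φ (t + y * Complex.I) = ∫ t : ℝ, Φ (t + (c / 2 : ℝ) * Complex.I) := by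
    rcases le_total y (c / 2) with h | h
    · exact integral_line_eq hd hCC hb hy h (by linarith)
    · exact (integral_line_eq hd hCC hb (by linarith) h (by linarith)).symm
  simpa only [hval, e1, e2] using key

/-- A midpoint convex function on a half-line that rises over one step rises at least as much over
every following step, so it cannot stay bounded above. -/
lemma antitone_of_midpoint {N : ℝ → ℝ} {C : ℝ} (hC : ∀ y, 0 < y → N y ≤ C)
    (hmid : ∀ y y', 0 < y → 0 < y' → 2 * N ((y + y') / 2) ≤ N y + N y') {a b : ℝ} (ha : 0 < a)
    (hab : a ≤ b) : N b ≤ N a := by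
  by_contra! h
  set d := b - a with hd
  have hd0 : 0 ≤ d := by linarith
  have hstep : ∀ n : ℕ, N b - N a ≤ N (a + (n + 1) * d) - N (a + n * d) := by
    intro n
    induction n with
    | zero => simp [hd]
    | succ n ih =>
      have h1 := hmid (a + n * d) (a + (n + 1 + 1) * d) (by positivity) (by positivity)
      have h2 : (a + n * d + (a + (n + 1 + 1) * d)) / 2 = a + (n + 1) * d := by ring
      rw [h2] at h1
      push_cast
      linarith
  have hgrow : ∀ n : ℕ, N a + n * (N b - N a) ≤ N (a + n * d) := by
    intro n
    induction n with
    | zero => simp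
    | succ n ih =>
      have := hstep n
      push_cast
      linarith
  obtain ⟨n, hn⟩ := exists_nat_gt ((C - N a) / (N b - N a))
  rw [div_lt_iff₀ (by linarith)] at hn
  have := hgrow n
  have := hC (a + n * d) (by positivity)
  linarith

/-- With N(y) the squared norm on the line at height y, the scalar products give ‖γ_y - γ_{y'}‖² =
N(y) + N(y') - 2 N((y + y')/2). Hence N is midpoint convex and bounded, so nonincreasing; its
convergence as y → 0 makes γ a Cauchy family, and monotonicity gives the final bound. -/
lemma IsHardyTwo.exists_tendsto_line {G : ℂ → ℂ} (hG : IsHardyTwo G) :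
    ∃ g : ℝ → ℂ, MemLp g 2 volume ∧
      Tendsto (fun y : ℝ => eLpNorm (fun t : ℝ => G (t + y * Complex.I) - g t) 2 volume)
        (𝓝[>] 0) (𝓝 0) ∧
      ∀ y : ℝ, 0 < y → ∫⁻ t : ℝ, ‖G (t + y * Complex.I)‖ₑ ^ 2 ≤ eLpNorm g 2 volume ^ 2 := by
  classical
  obtain ⟨C, hC⟩ := hG.2
  set γ : ℝ → Lp ℂ 2 (volume : Measure ℝ) := fun y =>
    if hy : 0 < y then (hG.memLp_line hy).toLp _ else 0 with hγ
  have hγv : ∀ y (hy : 0 < y), γ y = (hG.memLp_line hy).toLp _ := fun y hy => by simp [hγ, hy]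
  set N : ℝ → ℝ := fun y => ‖γ y‖ ^ 2 with hN
  have hinner : ∀ y y', 0 < y → 0 < y' → RCLike.re (inner ℂ (γ y) (γ y')) = N ((y + y') / 2) := by
    intro y y' hy hy'
    have hm : 0 < (y + y') / 2 := by linarith
    have h1 : inner ℂ (γ y) (γ y') = inner ℂ (γ ((y + y') / 2)) (γ ((y + y') / 2)) := by
      rw [hγv y hy, hγv y' hy', hγv _ hm, inner_toLp, inner_toLp,
        hG.integral_line_mul_conj hy' hy, add_comm y' y]
    rw [h1, hN, inner_self_eq_norm_sq]
  have hsub : ∀ y y', 0 < y → 0 < y' →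
      ‖γ y - γ y'‖ ^ 2 = N y + N y' - 2 * N ((y + y') / 2) := by
    intro y y' hy hy'
    rw [norm_sub_sq (𝕜 := ℂ), hinner y y' hy hy', hN]; ring
  have hNb : ∀ y, 0 < y → N y ≤ C := by
    intro y hy
    have h1 : ‖γ y‖ₑ ^ 2 ≤ C := by
      rw [hγv y hy, Lp.enorm_toLp, eLpNorm_two_sq]; exact hC y hy
    rw [← ofReal_norm, ← ENNReal.ofReal_pow (norm_nonneg _)] at h1
    have := ENNReal.toReal_mono ENNReal.coe_ne_top h1
    rwa [ENNReal.toReal_ofReal (by positivity)] at this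
  have hanti : ∀ a b, 0 < a → a ≤ b → N b ≤ N a := fun a b ha hab =>
    antitone_of_midpoint hNb (fun y y' hy hy' => by
      have := hsub y y' hy hy'
      nlinarith [sq_nonneg ‖γ y - γ y'‖]) ha hab
  have hbdd : BddAbove (N '' Set.Ioi 0) := ⟨C, by rintro _ ⟨y, hy, rfl⟩; exact hNb y hy⟩
  have hne : (N '' Set.Ioi 0).Nonempty := ⟨N 1, 1, by simp, rfl⟩
  have hcauchy : Cauchy (map γ (𝓝[>] 0)) := by
    rw [Metric.cauchy_iff]
    refine ⟨inferInstance, fun ε hε => ?_⟩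
    -- Below y₀ all values of N lie within ε²/2 of the supremum, so N(y) + N(y') - 2 N(midpoint) is
    -- less than ε².
    obtain ⟨_, ⟨y₀, hy₀, rfl⟩, h0⟩ := exists_lt_of_lt_csSup hne
      (show sSup (N '' Set.Ioi 0) - ε ^ 2 / 2 < sSup (N '' Set.Ioi 0) by
        have : 0 < ε ^ 2 := by positivity
        linarith)
    refine ⟨γ '' Set.Ioc 0 y₀, image_mem_map (Ioc_mem_nhdsGT hy₀), ?_⟩
    rintro _ ⟨y, hy, rfl⟩ _ ⟨y', hy', rfl⟩
    have hL : ∀ z, 0 < z → N z ≤ sSup (N '' Set.Ioi 0) := fun z hz => le_csSup hbdd ⟨z, hz, rfl⟩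
    have h1 := hsub y y' hy.1 hy'.1
    have h2 := hanti ((y + y') / 2) y₀ (by linarith [hy.1, hy'.1]) (by linarith [hy.2, hy'.2])
    have h3 := hL y hy.1
    have h4 := hL y' hy'.1
    rw [dist_eq_norm]
    refine lt_of_pow_lt_pow_left₀ 2 hε.le ?_
    linarith
  obtain ⟨g, hg⟩ := cauchy_map_iff_exists_tendsto.1 hcauchy
  refine ⟨g, Lp.memLp g, ?_, fun y hy => ?_⟩
  swap
  · have h1 : N y ≤ ‖g‖ ^ 2 := by
      refine ge_of_tendsto (hg.norm.pow 2) ?_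
      filter_upwards [Ioc_mem_nhdsGT hy] with u hu using hanti u y hu.1 hu.2
    rw [← eLpNorm_two_sq, ← Lp.enorm_toLp (hG.memLp_line hy), ← hγv y hy, ← Lp.enorm_def,
      ← ofReal_norm, ← ofReal_norm, ← ENNReal.ofReal_pow (norm_nonneg _),
      ← ENNReal.ofReal_pow (norm_nonneg _)]
    exact ENNReal.ofReal_le_ofReal h1
  rw [Lp.tendsto_Lp_iff_tendsto_eLpNorm'] at hg
  refine hg.congr' ?_
  filter_upwards [self_mem_nhdsWithin] with y (hy : 0 < y)
  refine eLpNorm_congr_ae ?_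
  rw [hγv y hy]
  filter_upwards [(hG.memLp_line hy).coeFn_toLp] with t ht
  simp [ht]

/-- The Poisson kernel is the difference of the Cauchy kernels at μ and conj μ, divided by 2i. -/
lemma integral_poisson_of_cauchy {g : ℝ → ℂ} (hg : MemLp g 2 volume) {μ v : ℂ} (hμ : 0 < μ.im)
    (h1 : ∫ t : ℝ, g t * ((t : ℂ) - μ)⁻¹ = 2 * Real.pi * Complex.I * v)
    (h2 : ∫ t : ℝ, g t * ((t : ℂ) - conj μ)⁻¹ = 0) :
    Real.pi⁻¹ • ∫ t : ℝ, poissonHP μ.im (t - μ.re) • g t = v := by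
  have hμ' : (conj μ).im ≠ 0 := by simpa using hμ.ne'
  have h3 : ∫ t : ℝ, g t * (((t : ℂ) - μ)⁻¹ - ((t : ℂ) - conj μ)⁻¹)
      = 2 * Real.pi * Complex.I * v := by
    simp_rw [mul_sub]
    rw [integral_sub (integrable_mul_of_memLp_two hg (memLp_cauchy hμ.ne'))
      (integrable_mul_of_memLp_two hg (memLp_cauchy hμ')), h1, h2, sub_zero]
  have h4 : ∀ t : ℝ, g t * (((t : ℂ) - μ)⁻¹ - ((t : ℂ) - conj μ)⁻¹)
      = 2 * Complex.I * (poissonHP μ.im (t - μ.re) • g t) := by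
    intro t
    rw [cauchy_sub_conj hμ.ne', Complex.real_smul]; ring
  simp_rw [h4] at h3
  rw [integral_const_mul] at h3
  have h5 : ∫ t : ℝ, poissonHP μ.im (t - μ.re) • g t = Real.pi * v := by
    have : (2 * Complex.I : ℂ) ≠ 0 := by simp
    apply mul_left_cancel₀ this
    rw [h3]; ring
  rw [h5, Complex.real_smul, ← mul_assoc]
  simp [Real.pi_ne_zero]

lemma integrable_inv_smul_of_memLp {g : ℝ → ℂ} (hg : MemLp g 2 volume) :
    Integrable fun t : ℝ => (1 + t ^ 2)⁻¹ • g t := by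
  have h1 : Integrable fun t : ℝ => g t * (((t : ℂ) - Complex.I)⁻¹ - ((t : ℂ) - conj Complex.I)⁻¹) := by
    simp_rw [mul_sub]
    exact (hg.integrable_mul (memLp_cauchy (by simp))).sub
      (hg.integrable_mul (memLp_cauchy (by simp)))
  refine (h1.const_mul (2 * Complex.I)⁻¹).congr (Eventually.of_forall fun t => ?_)
  have h2 : (2 * Complex.I : ℂ) ≠ 0 := by simp
  simp only
  rw [cauchy_sub_conj (by simp), Complex.real_smul]
  have h3 : poissonHP Complex.I.im (t - Complex.I.re) = (1 + t ^ 2)⁻¹ := by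
    simp [poissonHP, add_comm]
  rw [h3]
  field_simp

lemma hasBoundaryValues_of_poisson {G : ℂ → ℂ} {g : ℝ → ℂ} (hg : MemLp g 2 volume)
    (h : ∀ μ : ℂ, 0 < μ.im → Real.pi⁻¹ • ∫ t : ℝ, poissonHP μ.im (t - μ.re) • g t = G μ) :
    HasBoundaryValues G g := by
  filter_upwards [ae_tendsto_poisson (integrable_inv_smul_of_memLp hg)] with x hx
  refine hx.congr' ?_
  filter_upwards [self_mem_nhdsWithin] with y (hy : 0 < y)
  have := h (x + y * Complex.I) (by simpa using hy)
  simpa using this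

/-- A function of the Hardy space `H²` together with its boundary values. -/
structure HardyPair (G : ℂ → ℂ) (g : ℝ → ℂ) : Prop where
  hardy : IsHardyTwo G
  bv : HasBoundaryValues G g

lemma HasBoundaryValues.ae_eq {G : ℂ → ℂ} {g g' : ℝ → ℂ} (h : HasBoundaryValues G g)
    (h' : HasBoundaryValues G g') : g =ᵐ[volume] g' := by
  filter_upwards [h, h'] with t h1 h2 using tendsto_nhds_unique h1 h2

lemma HasBoundaryValues.congr_ae {G : ℂ → ℂ} {g g' : ℝ → ℂ} (h : HasBoundaryValues G g)
    (h' : g =ᵐ[volume] g') : HasBoundaryValues G g' := by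
  filter_upwards [h, h'] with t h1 h2
  rwa [← h2]

lemma HasBoundaryValues.boundaryValue_ae_eq {G : ℂ → ℂ} {g : ℝ → ℂ} (h : HasBoundaryValues G g) :
    boundaryValue G =ᵐ[volume] g := by
  filter_upwards [h] with t h1 using h1.limUnder_eq

lemma HasBoundaryValues.boundaryValue {G : ℂ → ℂ} {g : ℝ → ℂ} (h : HasBoundaryValues G g) :
    HasBoundaryValues G (boundaryValue G) :=
  h.congr_ae h.boundaryValue_ae_eq.symm

/-- The shifted function w ↦ G(w + iy) is holomorphic across the real line, where both Cauchy
formulas are known; they pass to the L² limit y → 0. The resulting Poisson representation and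
Fatou's theorem identify the L² limit with the vertical limits. -/
lemma IsHardyTwo.exists_boundary {G : ℂ → ℂ} (hG : IsHardyTwo G) :
    ∃ g : ℝ → ℂ, MemLp g 2 volume ∧
      Tendsto (fun y : ℝ => eLpNorm (fun t : ℝ => G (t + y * Complex.I) - g t) 2 volume)
        (𝓝[>] 0) (𝓝 0) ∧
      (∀ y : ℝ, 0 < y → ∫⁻ t : ℝ, ‖G (t + y * Complex.I)‖ₑ ^ 2 ≤ eLpNorm g 2 volume ^ 2) ∧
      (∀ μ : ℂ, 0 < μ.im → ∫ t : ℝ, g t * ((t : ℂ) - μ)⁻¹ = 2 * Real.pi * Complex.I * G μ) ∧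
      (∀ μ : ℂ, 0 < μ.im → ∫ t : ℝ, g t * ((t : ℂ) - conj μ)⁻¹ = 0) ∧ HasBoundaryValues G g := by
  obtain ⟨g, hg, hlim, hle⟩ := hG.exists_tendsto_line
  obtain ⟨C, hC⟩ := hG.2
  have hopen : IsOpen {z : ℂ | 0 < z.im} := isOpen_lt continuous_const Complex.continuous_im
  have hd : ∀ y : ℝ, 0 < y → DifferentiableOn ℂ (fun w => G (w + y * Complex.I)) {z | -y < z.im} := by
    intro y hy
    refine hG.1.comp (g := G) (f := fun w => w + y * Complex.I) (by fun_prop) fun z hz => ?_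
    have hz' : -y < z.im := hz
    simp only [Set.mem_ofPred_eq, Complex.add_im, Complex.mul_im, Complex.ofReal_re, Complex.I_im,
      mul_one, Complex.ofReal_im, Complex.I_re, mul_zero, add_zero]
    linarith
  have hb : ∀ y : ℝ, 0 < y → ∀ u : ℝ, -y < u →
      ∫⁻ t : ℝ, ‖G (t + u * Complex.I + y * Complex.I)‖ₑ ^ 2 ≤ C := by
    intro y hy u hu
    have := hC (u + y) (by linarith)
    push_cast at this
    simpa only [add_mul, ← add_assoc] using this
  have hev : ∀ᶠ y : ℝ in 𝓝[>] 0, MemLp (fun t : ℝ => G (t + y * Complex.I)) 2 volume := by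
    filter_upwards [self_mem_nhdsWithin] with y (hy : 0 < y) using hG.memLp_line hy
  have h1 : ∀ μ : ℂ, 0 < μ.im →
      ∫ t : ℝ, g t * ((t : ℂ) - μ)⁻¹ = 2 * Real.pi * Complex.I * G μ := by
    intro μ hμ
    have hL := tendsto_integral_mul_of_eLpNorm hev hg (memLp_cauchy hμ.ne') hlim
    refine tendsto_nhds_unique hL ?_
    have hcont : Tendsto (fun y : ℝ => 2 * Real.pi * Complex.I * G (μ + y * Complex.I)) (𝓝[>] 0)
        (𝓝 (2 * Real.pi * Complex.I * G μ)) := by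
      refine Tendsto.const_mul _ ?_
      have h3 : ContinuousAt G (μ + (0 : ℝ) * Complex.I) := by
        simpa using (hG.1.differentiableAt (hopen.mem_nhds hμ)).continuousAt
      have h4 : ContinuousAt (fun y : ℝ => G (μ + y * Complex.I)) 0 :=
        ContinuousAt.comp (g := G) (f := fun y : ℝ => μ + y * Complex.I) h3 (by fun_prop)
      have h5 := h4.tendsto
      simp only [Complex.ofReal_zero, zero_mul, add_zero] at h5
      exact h5.mono_left nhdsWithin_le_nhds
    refine hcont.congr' ?_
    filter_upwards [self_mem_nhdsWithin] with y (hy : 0 < y)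
    exact (integral_mul_cauchy_of_lt (neg_lt_zero.2 hy) (hd y hy) ENNReal.coe_lt_top (hb y hy)
      hμ).symm
  have h2 : ∀ μ : ℂ, 0 < μ.im → ∫ t : ℝ, g t * ((t : ℂ) - conj μ)⁻¹ = 0 := by
    intro μ hμ
    have hL := tendsto_integral_mul_of_eLpNorm hev hg
      (memLp_cauchy (z := conj μ) (by simpa using hμ.ne')) hlim
    refine tendsto_nhds_unique hL ?_
    refine tendsto_const_nhds.congr' ?_
    filter_upwards [self_mem_nhdsWithin] with y (hy : 0 < y)
    exact (integral_mul_cauchy_conj_of_lt (neg_lt_zero.2 hy) (hd y hy) ENNReal.coe_lt_top (hb y hy)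
      hμ).symm
  exact ⟨g, hg, hlim, hle, h1, h2, hasBoundaryValues_of_poisson hg fun μ hμ =>
    integral_poisson_of_cauchy hg hμ (h1 μ hμ) (h2 μ hμ)⟩

lemma IsHardyTwo.exists_pair {G : ℂ → ℂ} (hG : IsHardyTwo G) : ∃ g, HardyPair G g := by
  obtain ⟨g, -, -, -, -, -, h⟩ := hG.exists_boundary
  exact ⟨g, hG, h⟩

namespace HardyPair

variable {G : ℂ → ℂ} {g : ℝ → ℂ}

lemma boundary_props (h : HardyPair G g) : MemLp g 2 volume ∧
      Tendsto (fun y : ℝ => eLpNorm (fun t : ℝ => G (t + y * Complex.I) - g t) 2 volume)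
        (𝓝[>] 0) (𝓝 0) ∧
      (∀ y : ℝ, 0 < y → ∫⁻ t : ℝ, ‖G (t + y * Complex.I)‖ₑ ^ 2 ≤ eLpNorm g 2 volume ^ 2) ∧
      (∀ μ : ℂ, 0 < μ.im → ∫ t : ℝ, g t * ((t : ℂ) - μ)⁻¹ = 2 * Real.pi * Complex.I * G μ) ∧
      (∀ μ : ℂ, 0 < μ.im → ∫ t : ℝ, g t * ((t : ℂ) - conj μ)⁻¹ = 0) := by
  obtain ⟨g', h1, h2, h6, h3, h4, h5⟩ := h.hardy.exists_boundary
  have he := h5.ae_eq h.bv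
  refine ⟨h1.ae_eq he, ?_, fun y hy => ?_, fun μ hμ => ?_, fun μ hμ => ?_⟩
  · refine h2.congr fun y => eLpNorm_congr_ae ?_
    filter_upwards [he] with t ht
    rw [ht]
  · rw [← eLpNorm_congr_ae he]
    exact h6 y hy
  · rw [← h3 μ hμ]
    refine integral_congr_ae ?_
    filter_upwards [he] with t ht
    rw [ht]
  · rw [← h4 μ hμ]
    refine integral_congr_ae ?_
    filter_upwards [he] with t ht
    rw [ht]

lemma memLp (h : HardyPair G g) : MemLp g 2 volume := h.boundary_props.1

lemma tendsto_line (h : HardyPair G g) :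
    Tendsto (fun y : ℝ => eLpNorm (fun t : ℝ => G (t + y * Complex.I) - g t) 2 volume)
      (𝓝[>] 0) (𝓝 0) := h.boundary_props.2.1

lemma lintegral_line_le (h : HardyPair G g) {y : ℝ} (hy : 0 < y) :
    ∫⁻ t : ℝ, ‖G (t + y * Complex.I)‖ₑ ^ 2 ≤ eLpNorm g 2 volume ^ 2 := h.boundary_props.2.2.1 y hy

lemma cauchy (h : HardyPair G g) {μ : ℂ} (hμ : 0 < μ.im) :
    ∫ t : ℝ, g t * ((t : ℂ) - μ)⁻¹ = 2 * Real.pi * Complex.I * G μ := h.boundary_props.2.2.2.1 μ hμ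

lemma cauchy_conj (h : HardyPair G g) {μ : ℂ} (hμ : 0 < μ.im) :
    ∫ t : ℝ, g t * ((t : ℂ) - conj μ)⁻¹ = 0 := h.boundary_props.2.2.2.2 μ hμ

lemma congr_ae {g' : ℝ → ℂ} (h : HardyPair G g) (h' : g =ᵐ[volume] g') : HardyPair G g' :=
  ⟨h.hardy, h.bv.congr_ae h'⟩

lemma eq_of_ae_eq {G' : ℂ → ℂ} {g' : ℝ → ℂ} (h : HardyPair G g) (h' : HardyPair G' g')
    (he : g =ᵐ[volume] g') {μ : ℂ} (hμ : 0 < μ.im) : G μ = G' μ := by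
  have h1 := h.cauchy hμ
  have h2 := (h'.congr_ae he.symm).cauchy hμ
  have : (2 * Real.pi * Complex.I : ℂ) ≠ 0 := by simp [Real.pi_ne_zero]
  exact mul_left_cancel₀ this (h1.symm.trans h2)

end HardyPair

/-! ### The standard kernel and multiplication of H² by bounded functions. -/

lemma isOpen_upper : IsOpen {z : ℂ | 0 < z.im} := isOpen_lt continuous_const Complex.continuous_im

lemma line_mem_upper (t : ℝ) {y : ℝ} (hy : 0 < y) : 0 < ((t : ℂ) + y * Complex.I).im := by
  simpa using hy

lemma conj_hardyKernel (t : ℝ) (μ : ℂ) :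
    conj (hardyKernel t μ) = -Complex.I * ((t : ℂ) - μ)⁻¹ := by
  simp [hardyKernel, div_eq_mul_inv]

lemma hardyKernel_eq (z μ : ℂ) : hardyKernel z μ = Complex.I * (z - conj μ)⁻¹ := by
  simp [hardyKernel, div_eq_mul_inv]

lemma hardyKernel_self {μ : ℂ} (hμ : 0 < μ.im) : hardyKernel μ μ = (1 / (2 * μ.im) : ℝ) := by
  have h : μ - conj μ = 2 * μ.im * Complex.I := by rw [Complex.sub_conj]; push_cast; ring
  have h1 : (μ.im : ℂ) ≠ 0 := by exact_mod_cast hμ.ne'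
  rw [hardyKernel, h]
  push_cast
  field_simp

lemma memLp_hardyKernel {μ : ℂ} (hμ : μ.im ≠ 0) :
    MemLp (fun t : ℝ => hardyKernel t μ) 2 volume := by
  simp_rw [hardyKernel_eq]
  exact (memLp_cauchy (z := conj μ) (by simpa using hμ)).const_mul _

lemma upper_sub_conj_ne_zero {z μ : ℂ} (hz : 0 ≤ z.im) (hμ : 0 < μ.im) : z - conj μ ≠ 0 := by
  intro h
  have h1 := congrArg Complex.im h
  simp only [Complex.sub_im, Complex.conj_im, Complex.zero_im, sub_neg_eq_add] at h1
  linarith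

lemma hasBoundaryValues_of_continuousAt {G : ℂ → ℂ} (h : ∀ t : ℝ, ContinuousAt G t) :
    HasBoundaryValues G fun t => G t := by
  refine Eventually.of_forall fun t => ?_
  have h1 : ContinuousAt G ((t : ℂ) + (0 : ℝ) * Complex.I) := by simpa using h t
  have h2 : ContinuousAt (fun y : ℝ => G (t + y * Complex.I)) 0 :=
    ContinuousAt.comp (g := G) (f := fun y : ℝ => (t : ℂ) + y * Complex.I) h1 (by fun_prop)
  have h3 := h2.tendsto
  simp only [Complex.ofReal_zero, zero_mul, add_zero] at h3
  exact h3.mono_left nhdsWithin_le_nhds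

lemma continuousAt_hardyKernel {z μ : ℂ} (hz : 0 ≤ z.im) (hμ : 0 < μ.im) :
    ContinuousAt (fun z => hardyKernel z μ) z := by
  unfold hardyKernel
  exact continuousAt_const.div (by fun_prop) (upper_sub_conj_ne_zero hz hμ)

lemma hardyKernel_ne_zero {z μ : ℂ} (hz : 0 ≤ z.im) (hμ : 0 < μ.im) : hardyKernel z μ ≠ 0 :=
  div_ne_zero Complex.I_ne_zero (upper_sub_conj_ne_zero hz hμ)

lemma isHardyInfty_hardyKernel {μ : ℂ} (hμ : 0 < μ.im) :
    IsHardyInfty fun z => hardyKernel z μ := by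
  refine ⟨?_, 1 / μ.im, fun z hz => ?_⟩
  · unfold hardyKernel
    exact (differentiableOn_const _).div (by fun_prop) fun z (hz : 0 < z.im) =>
      upper_sub_conj_ne_zero hz.le hμ
  · simp only [hardyKernel, norm_div, Complex.norm_I]
    gcongr
    have := Complex.abs_im_le_norm (z - conj μ)
    simp only [Complex.sub_im, Complex.conj_im, sub_neg_eq_add] at this
    linarith [le_abs_self (z.im + μ.im)]

lemma hardyPair_hardyKernel {μ : ℂ} (hμ : 0 < μ.im) :
    HardyPair (fun z => hardyKernel z μ) fun t => hardyKernel t μ := by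
  refine ⟨⟨(isHardyInfty_hardyKernel hμ).1, (Real.pi / μ.im).toNNReal, fun y hy => ?_⟩,
    hasBoundaryValues_of_continuousAt fun t => continuousAt_hardyKernel (by simp) hμ⟩
  have him' : (conj μ - y * Complex.I).im = -μ.im - y := by simp
  have him : (conj μ - y * Complex.I).im ≠ 0 := by rw [him']; linarith
  have hc : ∀ t : ℝ, ‖hardyKernel (t + y * Complex.I) μ‖ₑ
      = ‖((t : ℂ) - (conj μ - y * Complex.I))⁻¹‖ₑ := by
    intro t
    rw [hardyKernel_eq, enorm_mul]
    have : ‖Complex.I‖ₑ = 1 := by rw [← ofReal_norm]; simp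
    rw [this, one_mul]; congr 2; ring
  simp_rw [hc]
  rw [lintegral_cauchy_sq him]
  change _ ≤ ENNReal.ofReal _
  refine ENNReal.ofReal_le_ofReal ?_
  gcongr
  rw [him', le_abs]
  right; linarith

lemma IsHardyInfty.exists_bound {θ : ℂ → ℂ} (h : IsHardyInfty θ) :
    ∃ C : ℝ, 0 ≤ C ∧ ∀ z : ℂ, 0 < z.im → ‖θ z‖ ≤ C := by
  obtain ⟨C, hC⟩ := h.2
  exact ⟨max C 0, le_max_right _ _, fun z hz => (hC z hz).trans (le_max_left _ _)⟩

lemma IsHardyInfty.mul_isHardyTwo {θ G : ℂ → ℂ} (hθ : IsHardyInfty θ) (hG : IsHardyTwo G) :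
    IsHardyTwo fun z => θ z * G z := by
  obtain ⟨C, hC⟩ := hθ.exists_bound
  obtain ⟨K, hK⟩ := hG.2
  refine ⟨hθ.1.mul hG.1, C.toNNReal ^ 2 * K, fun y hy => ?_⟩
  push_cast
  refine le_trans ?_ (mul_le_mul_right (hK y hy) _)
  rw [← lintegral_const_mul' _ _ (by simp)]
  refine lintegral_mono fun t => ?_
  rw [enorm_mul, mul_pow]
  gcongr
  rw [← ofReal_norm]
  exact ENNReal.ofReal_le_ofReal (hC.2 _ (line_mem_upper t hy))

lemma IsHardyInfty.mul {θ θ' : ℂ → ℂ} (h : IsHardyInfty θ) (h' : IsHardyInfty θ') :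
    IsHardyInfty fun z => θ z * θ' z := by
  obtain ⟨C, hC0, hC⟩ := h.exists_bound
  obtain ⟨C', hC0', hC'⟩ := h'.exists_bound
  refine ⟨h.1.mul h'.1, C * C', fun z hz => ?_⟩
  rw [norm_mul]
  exact mul_le_mul (hC z hz) (hC' z hz) (norm_nonneg _) hC0

lemma IsHardyInfty.add {θ θ' : ℂ → ℂ} (h : IsHardyInfty θ) (h' : IsHardyInfty θ') :
    IsHardyInfty fun z => θ z + θ' z := by
  obtain ⟨C, hC0, hC⟩ := h.exists_bound
  obtain ⟨C', hC0', hC'⟩ := h'.exists_bound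
  exact ⟨h.1.add h'.1, C + C', fun z hz => (norm_add_le _ _).trans (add_le_add (hC z hz) (hC' z hz))⟩

lemma IsHardyInfty.const (c : ℂ) : IsHardyInfty fun _ => c :=
  ⟨differentiableOn_const _, ‖c‖, fun _ _ => le_rfl⟩

lemma IsHardyTwo.add {G G' : ℂ → ℂ} (h : IsHardyTwo G) (h' : IsHardyTwo G') :
    IsHardyTwo fun z => G z + G' z := by
  obtain ⟨C, hC⟩ := h.2
  obtain ⟨C', hC'⟩ := h'.2
  refine ⟨h.1.add h'.1, 2 * (C + C'), fun y hy => ?_⟩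
  calc ∫⁻ t : ℝ, ‖G (t + y * Complex.I) + G' (t + y * Complex.I)‖ₑ ^ 2
      ≤ ∫⁻ t : ℝ, 2 * (‖G (t + y * Complex.I)‖ₑ ^ 2 + ‖G' (t + y * Complex.I)‖ₑ ^ 2) :=
        lintegral_mono fun t => (pow_le_pow_left' (enorm_add_le _ _) 2).trans (ennreal_add_sq_le _ _)
    _ ≤ _ := by
        rw [lintegral_const_mul' _ _ (by simp),
          lintegral_add_left' ((h.memLp_line hy).1.enorm.pow_const 2)]
        push_cast
        gcongr
        · exact hC y hy
        · exact hC' y hy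

lemma HasBoundaryValues.mul {G G' : ℂ → ℂ} {g g' : ℝ → ℂ} (h : HasBoundaryValues G g)
    (h' : HasBoundaryValues G' g') : HasBoundaryValues (fun z => G z * G' z) fun t => g t * g' t := by
  filter_upwards [h, h'] with t h1 h2 using h1.mul h2

lemma HasBoundaryValues.add {G G' : ℂ → ℂ} {g g' : ℝ → ℂ} (h : HasBoundaryValues G g)
    (h' : HasBoundaryValues G' g') : HasBoundaryValues (fun z => G z + G' z) fun t => g t + g' t := by
  filter_upwards [h, h'] with t h1 h2 using h1.add h2

lemma HasBoundaryValues.const (c : ℂ) : HasBoundaryValues (fun _ => c) fun _ => c :=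
  Eventually.of_forall fun _ => tendsto_const_nhds

lemma HasBoundaryValues.congr_upper {G G' : ℂ → ℂ} {g : ℝ → ℂ} (h : HasBoundaryValues G g)
    (he : ∀ z : ℂ, 0 < z.im → G z = G' z) : HasBoundaryValues G' g := by
  filter_upwards [h] with t ht
  refine ht.congr' ?_
  filter_upwards [self_mem_nhdsWithin] with y (hy : 0 < y)
  exact he _ (line_mem_upper t hy)

lemma HasBoundaryValues.aestronglyMeasurable {G : ℂ → ℂ} {g : ℝ → ℂ} (h : HasBoundaryValues G g)
    (hG : DifferentiableOn ℂ G {z | 0 < z.im}) : AEStronglyMeasurable g volume := by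
  have hu : Tendsto (fun n : ℕ => 1 / ((n : ℝ) + 1)) atTop (𝓝[>] 0) := by
    refine tendsto_nhdsWithin_iff.2 ⟨tendsto_one_div_add_atTop_nhds_zero_nat,
      Eventually.of_forall fun n => ?_⟩
    simp only [Set.mem_Ioi]; positivity
  refine aestronglyMeasurable_of_tendsto_ae atTop
    (f := fun n : ℕ => fun t : ℝ => G (t + (1 / ((n : ℝ) + 1) : ℝ) * Complex.I)) (fun n => ?_) ?_
  · exact (_root_.memLp_line (a := 0) (b := 1 / ((n : ℝ) + 1) + 1) (hG.mono fun z hz => hz.1)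
      (by positivity) (by linarith)).aestronglyMeasurable
  · filter_upwards [h] with t ht using ht.comp hu

lemma HasBoundaryValues.norm_le {G : ℂ → ℂ} {g : ℝ → ℂ} {C : ℝ} (h : HasBoundaryValues G g)
    (hC : ∀ z : ℂ, 0 < z.im → ‖G z‖ ≤ C) : ∀ᵐ t, ‖g t‖ ≤ C := by
  filter_upwards [h] with t ht
  refine le_of_tendsto ht.norm ?_
  filter_upwards [self_mem_nhdsWithin] with y (hy : 0 < y) using hC _ (line_mem_upper t hy)

/-- Bounded holomorphic functions have boundary values almost everywhere. -/
lemma IsHardyInfty.hasBoundaryValues {θ : ℂ → ℂ} (h : IsHardyInfty θ) :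
    HasBoundaryValues θ (boundaryValue θ) := by
  have hi : 0 < Complex.I.im := by simp
  -- Multiplying by a kernel, which has no zeros in the closed half-plane, lands in H²; its boundary
  -- value is divided out again.
  obtain ⟨g, hg⟩ := (h.mul_isHardyTwo (hardyPair_hardyKernel hi).hardy).exists_pair
  refine HasBoundaryValues.boundaryValue (g := fun t => g t / hardyKernel t Complex.I) ?_
  filter_upwards [hg.bv, (hardyPair_hardyKernel hi).bv] with t h1 h2
  have h3 : hardyKernel t Complex.I ≠ 0 := hardyKernel_ne_zero (by simp) hi
  refine (h1.div h2 h3).congr' ?_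
  filter_upwards [self_mem_nhdsWithin] with y (hy : 0 < y)
  simp only [Pi.div_apply]
  exact mul_div_cancel_right₀ _ (hardyKernel_ne_zero (line_mem_upper t hy).le hi)

/-! ### Point evaluations, closedness and bounded approximation in H². -/

namespace HardyPair

variable {G G' : ℂ → ℂ} {g g' : ℝ → ℂ}

lemma integral_mul_conj_kernel (h : HardyPair G g) {μ : ℂ} (hμ : 0 < μ.im) :
    ∫ t : ℝ, g t * conj (hardyKernel t μ) = 2 * Real.pi * G μ := by
  have : ∀ t : ℝ, g t * conj (hardyKernel t μ) = -Complex.I * (g t * ((t : ℂ) - μ)⁻¹) := by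
    intro t; rw [conj_hardyKernel]; ring
  simp_rw [this]
  rw [integral_const_mul, h.cauchy hμ]
  linear_combination (-2 * Real.pi * G μ) * Complex.I_mul_I

lemma add (h : HardyPair G g) (h' : HardyPair G' g') :
    HardyPair (fun z => G z + G' z) fun t => g t + g' t :=
  ⟨h.hardy.add h'.hardy, h.bv.add h'.bv⟩

lemma mul_left {θ : ℂ → ℂ} {θ' : ℝ → ℂ} (h : HardyPair G g) (hθ : IsHardyInfty θ)
    (hb : HasBoundaryValues θ θ') : HardyPair (fun z => θ z * G z) fun t => θ' t * g t :=
  ⟨hθ.mul_isHardyTwo h.hardy, hb.mul h.bv⟩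

lemma const_mul (h : HardyPair G g) (c : ℂ) : HardyPair (fun z => c * G z) fun t => c * g t :=
  h.mul_left (IsHardyInfty.const c) (HasBoundaryValues.const c)

lemma zero : HardyPair (fun _ => 0) fun _ => 0 :=
  ⟨⟨differentiableOn_const _, 0, fun _ _ => by simp⟩, HasBoundaryValues.const 0⟩

lemma sub (h : HardyPair G g) (h' : HardyPair G' g') :
    HardyPair (fun z => G z - G' z) fun t => g t - g' t := by
  have := h.add (h'.const_mul (-1))
  simpa only [neg_mul, one_mul, ← sub_eq_add_neg] using this

/-- Cauchy's formula and Cauchy-Schwarz, the kernel having squared norm π / Im μ. The factor 2π is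
discarded, being at least 1. -/
lemma enorm_sq_le (h : HardyPair G g) {μ : ℂ} (hμ : 0 < μ.im) :
    ‖G μ‖ₑ ^ 2 ≤ eLpNorm g 2 volume ^ 2 * ENNReal.ofReal (Real.pi / μ.im) := by
  have h1 := enorm_integral_mul_le h.memLp.1 (memLp_cauchy hμ.ne').1
  rw [h.cauchy hμ, enorm_mul] at h1
  have h2 : 1 ≤ ‖(2 * Real.pi * Complex.I : ℂ)‖ₑ := by
    rw [← ofReal_norm, ENNReal.one_le_ofReal]
    simp only [norm_mul, Complex.norm_ofNat, Complex.norm_real, Complex.norm_I, mul_one]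
    rw [Real.norm_of_nonneg Real.pi_pos.le]
    linarith [Real.pi_gt_three]
  have h3 : ‖G μ‖ₑ ≤ eLpNorm g 2 volume * eLpNorm (fun t : ℝ => ((t : ℂ) - μ)⁻¹) 2 volume :=
    (by simpa using mul_le_mul_left h2 ‖G μ‖ₑ : ‖G μ‖ₑ ≤ _).trans h1
  refine (pow_le_pow_left' h3 2).trans_eq ?_
  rw [mul_pow, eLpNorm_two_sq (fun t : ℝ => ((t : ℂ) - μ)⁻¹), lintegral_cauchy_sq hμ.ne',
    abs_of_pos hμ]

/-- The Hardy space is closed under `L²` limits of boundary values. -/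
lemma exists_of_tendsto {G : ℕ → ℂ → ℂ} {g : ℕ → ℝ → ℂ} {g' : ℝ → ℂ}
    (h : ∀ n, HardyPair (G n) (g n)) (hg' : MemLp g' 2 volume)
    (hlim : Tendsto (fun n => eLpNorm (fun t => g n t - g' t) 2 volume) atTop (𝓝 0)) :
    ∃ G' : ℂ → ℂ, HardyPair G' g' ∧
      ∀ z : ℂ, 0 < z.im → Tendsto (fun n => G n z) atTop (𝓝 (G' z)) := by
  have h2pi : (2 * Real.pi * Complex.I : ℂ) ≠ 0 := by simp [Real.pi_ne_zero]
  -- The only candidate for the limit is the Cauchy integral of the limiting boundary function.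
  set G' : ℂ → ℂ := fun z => (2 * Real.pi * Complex.I)⁻¹ * ∫ t : ℝ, g' t * ((t : ℂ) - z)⁻¹ with hG'
  have hpt : ∀ z : ℂ, 0 < z.im → Tendsto (fun n => G n z) atTop (𝓝 (G' z)) := by
    intro z hz
    have h1 := (tendsto_integral_mul_of_eLpNorm (Eventually.of_forall fun n => (h n).memLp) hg'
      (memLp_cauchy hz.ne') hlim).const_mul (2 * Real.pi * Complex.I : ℂ)⁻¹
    refine h1.congr fun n => ?_
    rw [(h n).cauchy hz, inv_mul_cancel_left₀ h2pi]
  have hest : ∀ n, ∀ z : ℂ, 0 < z.im → ‖G n z - G' z‖ₑ ^ 2 ≤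
      eLpNorm (fun t => g n t - g' t) 2 volume ^ 2 * ENNReal.ofReal (Real.pi / z.im) := by
    intro n z hz
    have h3 : Tendsto (fun m => eLpNorm (fun t => g n t - g m t) 2 volume ^ 2 *
        ENNReal.ofReal (Real.pi / z.im)) atTop
        (𝓝 (eLpNorm (fun t => g n t - g' t) 2 volume ^ 2 * ENNReal.ofReal (Real.pi / z.im))) := by
      refine ENNReal.Tendsto.mul_const ?_ (Or.inr ENNReal.ofReal_ne_top)
      refine ((ENNReal.continuous_pow 2).tendsto _).comp ?_
      have h4 : Tendsto (fun m => (((h n).memLp.sub (h m).memLp).toLp _)) atTop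
          (𝓝 ((((h n).memLp.sub hg').toLp _))) := by
        rw [Lp.tendsto_Lp_iff_tendsto_eLpNorm'']
        refine hlim.congr fun m => ?_
        rw [← eLpNorm_neg]
        congr 1; ext t; simp
      have h5 := h4.enorm
      simp only [Lp.enorm_toLp] at h5
      exact h5
    refine le_of_tendsto_of_tendsto ?_ h3
      (Eventually.of_forall fun m => ((h n).sub (h m)).enorm_sq_le hz)
    exact ((ENNReal.continuous_pow 2).tendsto _).comp (tendsto_const_nhds.sub (hpt z hz)).enorm
  -- The evaluation bound is uniform on Im w > Im z / 2, so L² convergence forces locally uniform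
  -- convergence and G' is holomorphic.
  have hloc : TendstoLocallyUniformlyOn G G' atTop {z : ℂ | 0 < z.im} := by
    rw [EMetric.tendstoLocallyUniformlyOn_iff]
    intro ε hε z hz
    have hz : 0 < z.im := hz
    refine ⟨{w : ℂ | z.im / 2 < w.im}, mem_nhdsWithin_of_mem_nhds
      ((isOpen_lt continuous_const Complex.continuous_im).mem_nhds (by
        change z.im / 2 < z.im; linarith)), ?_⟩
    have h6 : Tendsto (fun n => eLpNorm (fun t => g n t - g' t) 2 volume ^ 2 *
        ENNReal.ofReal (Real.pi / (z.im / 2))) atTop (𝓝 0) := by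
      have := ENNReal.Tendsto.mul_const (((ENNReal.continuous_pow 2).tendsto _).comp hlim)
        (b := ENNReal.ofReal (Real.pi / (z.im / 2))) (Or.inr ENNReal.ofReal_ne_top)
      simpa using this
    have hε2 : 0 < ε ^ 2 := ENNReal.pow_pos hε 2
    filter_upwards [h6.eventually (gt_mem_nhds hε2)] with n hn w hw
    have hw : z.im / 2 < w.im := hw
    rw [edist_comm, edist_eq_enorm_sub]
    refine lt_of_pow_lt_pow_left' 2 ?_
    refine lt_of_le_of_lt ((hest n w (by linarith)).trans ?_) hn
    gcongr
  have hd : DifferentiableOn ℂ G' {z : ℂ | 0 < z.im} :=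
    hloc.differentiableOn (Eventually.of_forall fun n => (h n).hardy.1) isOpen_upper
  refine ⟨G', ⟨⟨hd, ?_⟩, ?_⟩, hpt⟩
  · refine ⟨((eLpNorm g' 2 volume + 1) ^ 2).toNNReal, fun y hy => ?_⟩
    rw [ENNReal.coe_toNNReal (ENNReal.pow_lt_top (by simpa using hg'.2)).ne]
    have h7 : ∀ᶠ n in atTop, ∫⁻ t : ℝ, ‖G n (t + y * Complex.I)‖ₑ ^ 2
        ≤ (eLpNorm g' 2 volume + 1) ^ 2 := by
      filter_upwards [hlim.eventually (gt_mem_nhds one_pos)] with n hn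
      refine ((h n).lintegral_line_le hy).trans (pow_le_pow_left' ?_ 2)
      calc eLpNorm (g n) 2 volume = eLpNorm (g' + fun t => g n t - g' t) 2 volume := by
            congr 1; ext t; simp
        _ ≤ eLpNorm g' 2 volume + eLpNorm (fun t => g n t - g' t) 2 volume :=
            eLpNorm_add_le hg'.1 ((h n).memLp.1.sub hg'.1) one_le_two
        _ ≤ _ := by gcongr
    calc ∫⁻ t : ℝ, ‖G' (t + y * Complex.I)‖ₑ ^ 2
        = ∫⁻ t : ℝ, liminf (fun n => ‖G n (t + y * Complex.I)‖ₑ ^ 2) atTop := by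
          refine lintegral_congr fun t => ?_
          refine (Tendsto.liminf_eq ?_).symm
          exact ((ENNReal.continuous_pow 2).tendsto _).comp (hpt _ (line_mem_upper t hy)).enorm
      _ ≤ liminf (fun n => ∫⁻ t : ℝ, ‖G n (t + y * Complex.I)‖ₑ ^ 2) atTop :=
          lintegral_liminf_le' fun n => ((h n).hardy.memLp_line hy).1.enorm.pow_const 2
      _ ≤ _ := by
          refine liminf_le_of_frequently_le' h7.frequently
  · refine hasBoundaryValues_of_poisson hg' fun μ hμ => integral_poisson_of_cauchy hg' hμ ?_ ?_
    · simp only [hG']; rw [mul_inv_cancel_left₀ h2pi]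
    · refine tendsto_nhds_unique (tendsto_integral_mul_of_eLpNorm
        (Eventually.of_forall fun n => (h n).memLp) hg'
        (memLp_cauchy (z := conj μ) (by simpa using hμ.ne')) hlim) ?_
      refine tendsto_const_nhds.congr fun n => ((h n).cauchy_conj hμ).symm

/-- Bounded functions are dense in the Hardy space. -/
lemma exists_bounded_near (h : HardyPair G g) {ε : ℝ≥0∞} (hε : 0 < ε) :
    ∃ G' g', HardyPair G' g' ∧ IsHardyInfty G' ∧
      eLpNorm (fun t => g' t - g t) 2 volume ≤ ε := by
  obtain ⟨y, hy1, hy⟩ := ((ENNReal.tendsto_nhds_zero.1 h.tendsto_line ε hε).and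
    self_mem_nhdsWithin).exists
  have hy : 0 < y := hy
  have hmaps : Set.MapsTo (fun w : ℂ => w + y * Complex.I) {z | 0 < z.im} {z | 0 < z.im} := by
    intro z hz
    have hz : 0 < z.im := hz
    change 0 < (z + y * Complex.I).im
    simp; linarith
  have hd : DifferentiableOn ℂ (fun w => G (w + y * Complex.I)) {z | 0 < z.im} :=
    h.hardy.1.comp (g := G) (f := fun w => w + y * Complex.I) (by fun_prop) hmaps
  -- The approximant is an upward translate of G: it is close to G in L² for small y, and bounded by
  -- the evaluation bound at heights above y.
  refine ⟨fun w => G (w + y * Complex.I), fun t => G (t + y * Complex.I), ⟨⟨hd, ?_⟩, ?_⟩, ⟨hd, ?_⟩,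
    hy1⟩
  · obtain ⟨C, hC⟩ := h.hardy.2
    refine ⟨C, fun u hu => ?_⟩
    have := hC (u + y) (by linarith)
    push_cast at this
    simpa only [add_mul, ← add_assoc] using this
  · refine hasBoundaryValues_of_continuousAt fun t => ?_
    have h1 : ContinuousAt G (t + y * Complex.I) :=
      (h.hardy.1.differentiableAt (isOpen_upper.mem_nhds (line_mem_upper t hy))).continuousAt
    exact ContinuousAt.comp (g := G) (f := fun w : ℂ => w + y * Complex.I) h1 (by fun_prop)
  · set M : ℝ≥0∞ := eLpNorm g 2 volume ^ 2 * ENNReal.ofReal (Real.pi / y) with hM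
    have hMfin : M < ∞ := ENNReal.mul_lt_top (ENNReal.pow_lt_top h.memLp.2) ENNReal.ofReal_lt_top
    refine ⟨M.toReal + 1, fun z hz => ?_⟩
    have h2 := h.enorm_sq_le (hmaps hz)
    have h3 : ‖G (z + y * Complex.I)‖ₑ ^ 2 ≤ M := by
      refine h2.trans ?_
      rw [hM]
      gcongr
      simp; exact le_of_lt hz
    rw [← ofReal_norm, ← ENNReal.ofReal_pow (norm_nonneg _)] at h3
    have h4 := (ENNReal.ofReal_le_iff_le_toReal hMfin.ne).1 h3
    nlinarith [norm_nonneg (G (z + y * Complex.I)), sq_nonneg (‖G (z + y * Complex.I)‖ - 1)]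

end HardyPair

/-- An inner-like function close to `1` at a point is close to `1` on the line, in the mean with
weight `|k_μ|²`. -/
lemma lintegral_sub_one_mul_kernel_le {θ : ℂ → ℂ} {θ' : ℝ → ℂ} (hd : DifferentiableOn ℂ θ
    {z | 0 < z.im}) (h1 : ∀ z : ℂ, 0 < z.im → ‖θ z‖ ≤ 1) (hb : HasBoundaryValues θ θ')
    {μ : ℂ} (hμ : 0 < μ.im) :
    ∫⁻ t : ℝ, ‖(θ' t - 1) * hardyKernel t μ‖ₑ ^ 2 ≤
      ENNReal.ofReal (4 * Real.pi * ((1 - (θ μ).re) / (2 * μ.im))) := by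
  have hk := hardyPair_hardyKernel hμ
  have hθ : IsHardyInfty θ := ⟨hd, 1, h1⟩
  have hθk := hk.mul_left hθ hb
  have hi1 : Integrable fun t : ℝ => hardyKernel t μ * conj (hardyKernel t μ) :=
    integrable_mul_of_memLp_two hk.memLp (hk.memLp.star)
  have hi2 : Integrable fun t : ℝ => θ' t * hardyKernel t μ * conj (hardyKernel t μ) :=
    integrable_mul_of_memLp_two hθk.memLp (hk.memLp.star)
  have e1 := hk.integral_mul_conj_kernel hμ
  have e2 := hθk.integral_mul_conj_kernel hμ
  have hi : Integrable fun t : ℝ => 2 * (hardyKernel t μ * conj (hardyKernel t μ) -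
      θ' t * hardyKernel t μ * conj (hardyKernel t μ)) := (hi1.sub hi2).const_mul 2
  -- For |θ| ≤ 1 one has |θ - 1|² ≤ 2 (1 - Re θ). The integral of θ |k_μ|² is 2π θ(μ) k_μ(μ) with
  -- k_μ(μ) = 1 / (2 Im μ), so only the value at μ remains.
  have hpt : ∀ t : ℝ, (2 * (hardyKernel t μ * conj (hardyKernel t μ) -
      θ' t * hardyKernel t μ * conj (hardyKernel t μ))).re =
        2 * (1 - (θ' t).re) * ‖hardyKernel t μ‖ ^ 2 := by
    intro t
    rw [mul_assoc (θ' t), Complex.mul_conj, Complex.normSq_eq_norm_sq]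
    have : (2 : ℂ) * (((‖hardyKernel t μ‖ ^ 2 : ℝ) : ℂ) - θ' t * ((‖hardyKernel t μ‖ ^ 2 : ℝ) : ℂ))
      = ((2 * ‖hardyKernel t μ‖ ^ 2 : ℝ) : ℂ) * (1 - θ' t) := by push_cast; ring
    rw [this, Complex.re_ofReal_mul]
    simp; ring
  have hle : ∀ᵐ t : ℝ, ‖(θ' t - 1) * hardyKernel t μ‖ₑ ^ 2 ≤
      ENNReal.ofReal (2 * (hardyKernel t μ * conj (hardyKernel t μ) -
      θ' t * hardyKernel t μ * conj (hardyKernel t μ))).re := by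
    filter_upwards [hb.norm_le h1] with t ht
    rw [← ofReal_norm, ← ENNReal.ofReal_pow (norm_nonneg _)]
    refine ENNReal.ofReal_le_ofReal ?_
    rw [hpt, norm_mul, mul_pow]
    gcongr
    have h3 : ‖θ' t - 1‖ ^ 2 = ‖θ' t‖ ^ 2 - 2 * (θ' t).re + 1 := by
      rw [← Complex.normSq_eq_norm_sq, ← Complex.normSq_eq_norm_sq, Complex.normSq_apply,
        Complex.normSq_apply]
      simp; ring
    rw [h3]
    nlinarith [norm_nonneg (θ' t)]
  refine (lintegral_mono_ae hle).trans ?_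
  have hire : Integrable fun t : ℝ => (2 * (hardyKernel t μ * conj (hardyKernel t μ) -
      θ' t * hardyKernel t μ * conj (hardyKernel t μ))).re := hi.re
  rw [← ofReal_integral_eq_lintegral_ofReal hire]
  · refine ENNReal.ofReal_le_ofReal (le_of_eq ?_)
    have h3 := integral_re hi
    simp only [RCLike.re_to_complex] at h3
    rw [h3, integral_const_mul, integral_sub hi1 hi2, e1, e2, hardyKernel_self hμ]
    have : (2 : ℂ) * (2 * Real.pi * ((1 / (2 * μ.im) : ℝ) : ℂ) -
        2 * Real.pi * (θ μ * ((1 / (2 * μ.im) : ℝ) : ℂ)))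
        = ((4 * Real.pi * (1 / (2 * μ.im)) : ℝ) : ℂ) * (1 - θ μ) := by push_cast; ring
    rw [this, Complex.re_ofReal_mul]
    simp; ring
  · filter_upwards [hb.norm_le h1] with t ht
    rw [Pi.zero_apply, hpt]
    have := (Complex.re_le_norm (θ' t)).trans ht
    have h5 : 0 ≤ 1 - (θ' t).re := by linarith
    positivity

/-! ### Density of Cauchy kernels and translation of the spectrum -/

/-- All Poisson integrals of f vanish, and they converge to f almost everywhere. -/
lemma ae_eq_zero_of_orthogonal_cauchy {f : ℝ → ℂ} (hf : MemLp f 2 volume)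
    (h : ∀ z : ℂ, z.im ≠ 0 → ∫ t : ℝ, f t * ((t : ℂ) - z)⁻¹ = 0) : f =ᵐ[volume] 0 := by
  have h1 : HasBoundaryValues (fun _ => 0) f :=
    hasBoundaryValues_of_poisson hf fun μ hμ => integral_poisson_of_cauchy hf hμ
      (by rw [h μ hμ.ne', mul_zero]) (h _ (by simpa using hμ.ne'))
  exact h1.ae_eq (HasBoundaryValues.const 0)

/-- A closed linear property of functions in `L²(ℝ)` holds for all of them if it holds for the
Cauchy kernels. -/
lemma memLp_two_induction_cauchy (P : (ℝ → ℂ) → Prop)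
    (hae : ∀ f g, f =ᵐ[volume] g → P f → P g)
    (hk : ∀ z : ℂ, z.im ≠ 0 → P fun t => ((t : ℂ) - z)⁻¹)
    (hadd : ∀ f g, MemLp f 2 volume → MemLp g 2 volume → P f → P g → P (f + g))
    (hsmul : ∀ (c : ℂ) f, MemLp f 2 volume → P f → P (c • f))
    (hlim : ∀ f, MemLp f 2 volume →
      (∀ ε : ℝ≥0∞, 0 < ε → ∃ g, MemLp g 2 volume ∧ P g ∧ eLpNorm (f - g) 2 volume ≤ ε) → P f)
    {f : ℝ → ℂ} (hf : MemLp f 2 volume) : P f := by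
  set K : {z : ℂ // z.im ≠ 0} → Lp ℂ 2 (volume : Measure ℝ) := fun z => (memLp_cauchy z.2).toLp _
    with hK
  set S : Submodule ℂ (Lp ℂ 2 (volume : Measure ℝ)) := Submodule.span ℂ (Set.range K) with hS
  have hSP : ∀ v ∈ S, P v := by
    intro v hv
    induction hv using Submodule.span_induction with
    | mem x hx =>
      obtain ⟨z, rfl⟩ := hx
      exact hae _ _ (memLp_cauchy z.2).coeFn_toLp.symm (hk z z.2)
    | zero =>
      have := hsmul 0 _ (memLp_cauchy (z := Complex.I) (by simp)) (hk Complex.I (by simp))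
      rw [zero_smul] at this
      exact hae _ _ (Lp.coeFn_zero _ _ _).symm this
    | add x y _ _ hx hy =>
      exact hae _ _ (Lp.coeFn_add x y).symm (hadd _ _ (Lp.memLp x) (Lp.memLp y) hx hy)
    | smul c x _ hx => exact hae _ _ (Lp.coeFn_smul c x).symm (hsmul c _ (Lp.memLp x) hx)
  have htop : S.topologicalClosure = ⊤ := by
    rw [Submodule.topologicalClosure_eq_top_iff, Submodule.eq_bot_iff]
    intro v hv
    rw [Submodule.mem_orthogonal] at hv
    have h1 : (v : ℝ → ℂ) =ᵐ[volume] 0 := by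
      refine ae_eq_zero_of_orthogonal_cauchy (Lp.memLp v) fun z hz => ?_
      have hz' : (conj z).im ≠ 0 := by simpa using hz
      have h2 := hv (K ⟨conj z, hz'⟩) (Submodule.subset_span ⟨_, rfl⟩)
      have h3 : v = (Lp.memLp v).toLp v := (Lp.toLp_coeFn v _).symm
      rw [hK] at h2
      simp only at h2
      rw [h3, inner_toLp] at h2
      rw [← h2]
      refine integral_congr_ae (Eventually.of_forall fun t => ?_)
      simp
    exact (Lp.eq_zero_iff_ae_eq_zero).2 h1
  refine hlim f hf fun ε hε => ?_
  have hmem : hf.toLp f ∈ closure (S : Set (Lp ℂ 2 (volume : Measure ℝ))) := by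
    have : hf.toLp f ∈ S.topologicalClosure := by rw [htop]; trivial
    exact this
  obtain ⟨v, hv, hd⟩ := EMetric.mem_closure_iff.1 hmem ε hε
  refine ⟨v, Lp.memLp v, hSP v hv, ?_⟩
  have h4 : edist (hf.toLp f) v = eLpNorm (f - (v : ℝ → ℂ)) 2 volume := by
    conv_lhs => rw [← Lp.toLp_coeFn v (Lp.memLp v)]
    rw [Lp.edist_toLp_toLp]
  rw [← h4]
  exact hd.le

lemma norm_exp_two_I_mul (t x : ℝ) : ‖Complex.exp (2 * Complex.I * t * x)‖ = 1 := by
  simp [Complex.norm_exp]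

lemma isHardyInfty_exp {x : ℝ} (hx : 0 ≤ x) :
    IsHardyInfty fun z => Complex.exp (2 * Complex.I * z * x) := by
  refine ⟨by fun_prop, 1, fun z hz => ?_⟩
  rw [Complex.norm_exp, Real.exp_le_one_iff]
  simp
  positivity

lemma hasBoundaryValues_exp (x : ℝ) : HasBoundaryValues
    (fun z => Complex.exp (2 * Complex.I * z * x)) fun t => Complex.exp (2 * Complex.I * t * x) :=
  hasBoundaryValues_of_continuousAt fun t => by fun_prop

lemma norm_exp_sub_exp_le {a b : ℂ} (ha : a.re ≤ 0) (hb : b.re ≤ 0) :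
    ‖Complex.exp a - Complex.exp b‖ ≤ ‖a - b‖ := by
  have := Convex.norm_image_sub_le_of_norm_deriv_le (𝕜 := ℂ) (f := Complex.exp) (C := 1)
    (s := {z | z.re ≤ 0}) (x := b) (y := a) (fun z _ => Complex.differentiable_exp z)
    (fun z hz => ?_) (convex_halfSpace_re_le 0) hb ha
  · simpa using this
  · rw [Complex.deriv_exp, Complex.norm_exp, Real.exp_le_one_iff]
    exact hz

lemma aestronglyMeasurable_exp (x : ℝ) :
    AEStronglyMeasurable (fun t : ℝ => Complex.exp (2 * Complex.I * t * x)) volume :=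
  Continuous.aestronglyMeasurable (by fun_prop)

lemma eLpNorm_exp_mul (x : ℝ) (f : ℝ → ℂ) :
    eLpNorm (fun t : ℝ => Complex.exp (2 * Complex.I * t * x) * f t) 2 volume
      = eLpNorm f 2 volume := by
  refine eLpNorm_congr_norm_ae (Eventually.of_forall fun t => ?_)
  rw [norm_mul, norm_exp_two_I_mul, one_mul]

lemma memLp_exp_mul (x : ℝ) {f : ℝ → ℂ} (hf : MemLp f 2 volume) :
    MemLp (fun t : ℝ => Complex.exp (2 * Complex.I * t * x) * f t) 2 volume :=
  ⟨(aestronglyMeasurable_exp x).mul hf.1, by rw [eLpNorm_exp_mul]; exact hf.2⟩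

/-- Subtracting the value at μ removes the pole. The quotient is at most 2x and at most 2 / |w - μ|,
so its square is dominated by a multiple of x times the Poisson kernel of height 1/x. It stands in
for e^{2itx} / (t - μ), with an error carrying the decaying factor e^{2iμx}. -/
lemma hardyPair_exp_sub_exp_div {x : ℝ} (hx : 0 < x) {μ : ℂ} (hμ : 0 < μ.im) :
    HardyPair (dslope (fun w => Complex.exp (2 * Complex.I * w * x)) μ) fun t =>
      (Complex.exp (2 * Complex.I * t * x) - Complex.exp (2 * Complex.I * μ * x)) *
        ((t : ℂ) - μ)⁻¹ := by
  set E : ℂ → ℂ := fun w => Complex.exp (2 * Complex.I * w * x) with hE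
  have hEd : Differentiable ℂ E := by fun_prop
  have hd : Differentiable ℂ (dslope E μ) := by
    rw [← differentiableOn_univ, Complex.differentiableOn_dslope univ_mem]
    exact hEd.differentiableOn
  have hE1 : ∀ w : ℂ, 0 < w.im → ‖E w‖ ≤ 1 := by
    intro w hw
    rw [hE, Complex.norm_exp, Real.exp_le_one_iff]
    simp; positivity
  have hbound1 : ∀ w : ℂ, 0 < w.im → ‖w - μ‖ * ‖dslope E μ w‖ ≤ 2 := by
    intro w hw
    rw [← norm_smul, sub_smul_dslope]
    linarith [norm_sub_le (E w) (E μ), hE1 w hw, hE1 μ hμ]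
  have hbound2 : ∀ w : ℂ, 0 < w.im → ‖dslope E μ w‖ ≤ 2 * x := by
    intro w hw
    by_cases hwμ : w = μ
    · rw [hwμ, dslope_same]
      have : HasDerivAt E (Complex.exp (2 * Complex.I * μ * x) * (2 * Complex.I * 1 * x)) μ :=
        (((hasDerivAt_id μ).const_mul (2 * Complex.I)).mul_const (x : ℂ)).cexp
      rw [this.deriv, norm_mul]
      have h1 := hE1 μ hμ
      have h2 : ‖(2 * Complex.I * 1 * x : ℂ)‖ = 2 * x := by
        simp [abs_of_pos hx]
      rw [h2]
      calc _ ≤ 1 * (2 * x) := by gcongr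
        _ = 2 * x := one_mul _
    · have h0 : 0 < ‖w - μ‖ := norm_pos_iff.2 (sub_ne_zero.2 hwμ)
      have h1 : ‖E w - E μ‖ ≤ ‖2 * Complex.I * w * x - 2 * Complex.I * μ * x‖ := by
        apply norm_exp_sub_exp_le
        · simp; positivity
        · simp; positivity
      have h2 : ‖2 * Complex.I * w * x - 2 * Complex.I * μ * x‖ = ‖w - μ‖ * (2 * x) := by
        rw [show 2 * Complex.I * w * x - 2 * Complex.I * μ * x = (w - μ) * (2 * Complex.I * x) by ring,
          norm_mul]
        simp [abs_of_pos hx]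
      rw [← sub_smul_dslope, norm_smul, h2] at h1
      exact le_of_mul_le_mul_left h1 h0
  refine ⟨⟨hd.differentiableOn, (8 * (x * Real.pi)).toNNReal, fun y hy => ?_⟩, ?_⟩
  · have hxi : 0 < x⁻¹ := inv_pos.2 hx
    calc ∫⁻ t : ℝ, ‖dslope E μ (t + y * Complex.I)‖ₑ ^ 2
        ≤ ∫⁻ t : ℝ, ENNReal.ofReal (8 * (x * poissonHP x⁻¹ (t - μ.re))) := by
          refine lintegral_mono fun t => ?_
          set w : ℂ := t + y * Complex.I with hw
          have hwim : 0 < w.im := line_mem_upper t hy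
          rw [← ofReal_norm, ← ENNReal.ofReal_pow (norm_nonneg _)]
          refine ENNReal.ofReal_le_ofReal ?_
          have h1 := hbound1 w hwim
          have h2 := hbound2 w hwim
          have h3 : |t - μ.re| ≤ ‖w - μ‖ := by
            have := Complex.abs_re_le_norm (w - μ)
            simpa [hw] using this
          have h4 : (t - μ.re) ^ 2 * ‖dslope E μ w‖ ^ 2 ≤ 4 := by
            rw [← sq_abs, ← mul_pow]
            have h5 : |t - μ.re| * ‖dslope E μ w‖ ≤ 2 :=
              (mul_le_mul_of_nonneg_right h3 (norm_nonneg _)).trans h1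
            have := pow_le_pow_left₀ (by positivity) h5 2
            linarith
          have h6 : (x⁻¹) ^ 2 * ‖dslope E μ w‖ ^ 2 ≤ 4 := by
            rw [← mul_pow]
            have h5 : x⁻¹ * ‖dslope E μ w‖ ≤ 2 := by
              rw [inv_mul_le_iff₀ hx]; linarith
            have := pow_le_pow_left₀ (by positivity) h5 2
            linarith
          unfold poissonHP
          rw [mul_div_assoc', mul_inv_cancel₀ hx.ne', mul_one_div, le_div_iff₀ (by positivity)]
          linarith
      _ ≤ _ := by
          rw [← ofReal_integral_eq_lintegral_ofReal
            (((integrable_poissonHP hxi _).const_mul _).const_mul _)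
            (Eventually.of_forall fun t => mul_nonneg (by norm_num)
              (mul_nonneg hx.le (poissonHP_nonneg hxi _))),
            integral_const_mul, integral_const_mul, integral_poissonHP hxi]
          exact le_rfl
  · refine (hasBoundaryValues_of_continuousAt fun t => (hd _).continuousAt).congr_ae
      (Eventually.of_forall fun t => ?_)
    have h1 := sub_ne_zero_of_im hμ.ne' t
    simp only
    rw [dslope_of_ne _ (sub_ne_zero.1 h1), slope_def_field, div_eq_mul_inv]

lemma tendsto_exp_atTop {μ : ℂ} (hμ : 0 < μ.im) :
    Tendsto (fun x : ℝ => Complex.exp (2 * Complex.I * μ * x)) atTop (𝓝 0) := by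
  rw [tendsto_zero_iff_norm_tendsto_zero]
  have h1 : ∀ x : ℝ, ‖Complex.exp (2 * Complex.I * μ * x)‖ = Real.exp (-(2 * μ.im * x)) := by
    intro x
    rw [Complex.norm_exp]
    congr 1
    simp
  simp_rw [h1]
  exact Real.tendsto_exp_neg_atTop_nhds_zero.comp (tendsto_id.const_mul_atTop (by positivity))

/-- After multiplication by `e^{2itx}`, `x → +∞`, a function in `L²` gets close to the Hardy
space. -/
lemma eventually_exp_mul_near_hardy {f : ℝ → ℂ} (hf : MemLp f 2 volume) :
    ∀ ε : ℝ≥0∞, 0 < ε → ∀ᶠ x : ℝ in atTop, ∃ G g, HardyPair G g ∧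
      eLpNorm (fun t : ℝ => Complex.exp (2 * Complex.I * t * x) * f t - g t) 2 volume ≤ ε := by
  refine memLp_two_induction_cauchy (fun f => ∀ ε : ℝ≥0∞, 0 < ε → ∀ᶠ x : ℝ in atTop, ∃ G g,
    HardyPair G g ∧
      eLpNorm (fun t : ℝ => Complex.exp (2 * Complex.I * t * x) * f t - g t) 2 volume ≤ ε)
    ?_ ?_ ?_ ?_ ?_ hf
  · intro f f' hff h ε hε
    filter_upwards [h ε hε] with x hx
    obtain ⟨G, g, h1, h2⟩ := hx
    refine ⟨G, g, h1, (eLpNorm_congr_ae ?_).trans_le h2⟩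
    filter_upwards [hff] with t ht
    rw [ht]
  · intro z hz ε hε
    -- A kernel with pole in the lower half-plane already belongs to H² and stays there. A pole in
    -- the upper half-plane is cancelled by subtracting e^{2izx}, which tends to zero.
    rcases lt_or_gt_of_ne hz with hneg | hpos
    · filter_upwards [eventually_ge_atTop 0] with x hx
      have hμ : 0 < (conj z).im := by simpa using hneg
      have h1 := ((hardyPair_hardyKernel hμ).const_mul (-Complex.I)).mul_left (isHardyInfty_exp hx)
        (hasBoundaryValues_exp x)
      refine ⟨_, _, h1, ?_⟩
      have h2 : ∀ t : ℝ, Complex.exp (2 * Complex.I * t * x) * ((t : ℂ) - z)⁻¹ -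
          Complex.exp (2 * Complex.I * t * x) * (-Complex.I * hardyKernel t (conj z)) = 0 := by
        intro t
        rw [hardyKernel_eq, Complex.conj_conj, ← mul_assoc (-Complex.I), neg_mul, Complex.I_mul_I]
        ring
      simp_rw [h2]
      simp
    · have h0 : Tendsto (fun x : ℝ => ‖Complex.exp (2 * Complex.I * z * x)‖ₑ *
          eLpNorm (fun t : ℝ => ((t : ℂ) - z)⁻¹) 2 volume) atTop (𝓝 0) := by
        have := ENNReal.Tendsto.mul_const (tendsto_exp_atTop hpos).enorm
          (b := eLpNorm (fun t : ℝ => ((t : ℂ) - z)⁻¹) 2 volume) (Or.inr (memLp_cauchy hz).2.ne)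
        simpa using this
      filter_upwards [eventually_gt_atTop 0, ENNReal.tendsto_nhds_zero.1 h0 ε hε] with x hx hxε
      refine ⟨_, _, hardyPair_exp_sub_exp_div hx hpos, ?_⟩
      have h2 : (fun t : ℝ => Complex.exp (2 * Complex.I * t * x) * ((t : ℂ) - z)⁻¹ -
          (Complex.exp (2 * Complex.I * t * x) - Complex.exp (2 * Complex.I * z * x)) *
          ((t : ℂ) - z)⁻¹) = Complex.exp (2 * Complex.I * z * x) • fun t : ℝ => ((t : ℂ) - z)⁻¹ := by
        ext t; simp; ring
      rw [h2, eLpNorm_const_smul]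
      exact hxε
  · intro f f' hf hf' h h' ε hε
    filter_upwards [h _ (ENNReal.half_pos hε.ne'), h' _ (ENNReal.half_pos hε.ne')] with x hx hx'
    obtain ⟨G, g, h1, h2⟩ := hx
    obtain ⟨G', g', h1', h2'⟩ := hx'
    refine ⟨_, _, h1.add h1', ?_⟩
    have h3 : (fun t : ℝ => Complex.exp (2 * Complex.I * t * x) * (f + f') t - (g t + g' t)) =
        (fun t : ℝ => Complex.exp (2 * Complex.I * t * x) * f t - g t) +
        fun t : ℝ => Complex.exp (2 * Complex.I * t * x) * f' t - g' t := by
      ext t; simp; ring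
    rw [h3, ← ENNReal.add_halves ε]
    exact (eLpNorm_add_le ((memLp_exp_mul x hf).sub h1.memLp).1
      ((memLp_exp_mul x hf').sub h1'.memLp).1 one_le_two).trans (add_le_add h2 h2')
  · intro c f hf h ε hε
    rcases eq_or_ne c 0 with rfl | hc
    · refine Eventually.of_forall fun x => ⟨_, _, HardyPair.zero, ?_⟩
      simp
    have hc' : ‖c‖ₑ ≠ 0 := by simpa using hc
    have hε' : 0 < ε / ‖c‖ₑ := ENNReal.div_pos hε.ne' enorm_ne_top
    filter_upwards [h _ hε'] with x hx
    obtain ⟨G, g, h1, h2⟩ := hx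
    refine ⟨_, _, h1.const_mul c, ?_⟩
    have h3 : (fun t : ℝ => Complex.exp (2 * Complex.I * t * x) * (c • f) t - c * g t) =
        c • fun t : ℝ => Complex.exp (2 * Complex.I * t * x) * f t - g t := by
      ext t; simp; ring
    rw [h3, eLpNorm_const_smul]
    calc ‖c‖ₑ * _ ≤ ‖c‖ₑ * (ε / ‖c‖ₑ) := by gcongr
      _ = ε := ENNReal.mul_div_cancel hc' enorm_ne_top
  · intro f hf h ε hε
    obtain ⟨f', hf', hP, hd⟩ := h _ (ENNReal.half_pos hε.ne')
    filter_upwards [hP _ (ENNReal.half_pos hε.ne')] with x hx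
    obtain ⟨G, g, h1, h2⟩ := hx
    refine ⟨G, g, h1, ?_⟩
    have h3 : (fun t : ℝ => Complex.exp (2 * Complex.I * t * x) * f t - g t) =
        (fun t : ℝ => Complex.exp (2 * Complex.I * t * x) * (f - f') t) +
        fun t : ℝ => Complex.exp (2 * Complex.I * t * x) * f' t - g t := by
      ext t; simp; ring
    rw [h3, ← ENNReal.add_halves ε]
    refine (eLpNorm_add_le (memLp_exp_mul x (hf.sub hf')).1
      ((memLp_exp_mul x hf').sub h1.memLp).1 one_le_two).trans (add_le_add ?_ h2)
    rw [eLpNorm_exp_mul]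
    exact hd

/-- The pairing of the Hardy space with `e^{2itx} f` tends to zero in norm as `x → +∞`. -/
lemma eventually_integral_exp_mul_le {f : ℝ → ℂ} (hf : MemLp f 2 volume) :
    ∀ ε : ℝ≥0∞, 0 < ε → ∀ᶠ x : ℝ in atTop, ∀ A a, HardyPair A a →
      ‖∫ t : ℝ, a t * (Complex.exp (2 * Complex.I * t * x) * f t)‖ₑ ≤ ε * eLpNorm a 2 volume := by
  refine memLp_two_induction_cauchy (fun f => ∀ ε : ℝ≥0∞, 0 < ε → ∀ᶠ x : ℝ in atTop, ∀ A a,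
    HardyPair A a →
      ‖∫ t : ℝ, a t * (Complex.exp (2 * Complex.I * t * x) * f t)‖ₑ ≤ ε * eLpNorm a 2 volume)
    ?_ ?_ ?_ ?_ ?_ hf
  · intro f f' hff h ε hε
    filter_upwards [h ε hε] with x hx A a ha
    refine (le_of_eq ?_).trans (hx A a ha)
    congr 1
    refine integral_congr_ae ?_
    filter_upwards [hff] with t ht
    rw [ht]
  · intro z hz ε hε
    have hre : ∀ (x : ℝ) (a : ℝ → ℂ), ∫ t : ℝ, a t * (Complex.exp (2 * Complex.I * t * x) *
        ((t : ℂ) - z)⁻¹) = ∫ t : ℝ, (Complex.exp (2 * Complex.I * t * x) * a t) *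
        ((t : ℂ) - z)⁻¹ := by
      intro x a; congr with t; ring
    -- A pole in the lower half-plane pairs to zero with e^{2itx} a. A pole at z in the upper
    -- half-plane gives 2πi e^{2izx} A(z), where A(z) is controlled by the norm of a.
    rcases lt_or_gt_of_ne hz with hneg | hpos
    · filter_upwards [eventually_ge_atTop 0] with x hx A a ha
      have hμ : 0 < (conj z).im := by simpa using hneg
      have := (ha.mul_left (isHardyInfty_exp hx) (hasBoundaryValues_exp x)).cauchy_conj hμ
      rw [Complex.conj_conj] at this
      rw [hre, this]
      simp
    · set M : ℝ≥0∞ := ENNReal.ofReal (Real.pi / z.im) ^ (1 / 2 : ℝ) with hM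
      have hMt : M ≠ ∞ := ENNReal.rpow_ne_top_of_nonneg (by norm_num) ENNReal.ofReal_ne_top
      have h0 : Tendsto (fun x : ℝ => ‖2 * Real.pi * Complex.I * Complex.exp (2 * Complex.I * z * x)‖ₑ
          * M) atTop (𝓝 0) := by
        have := ENNReal.Tendsto.mul_const ((tendsto_exp_atTop hpos).const_mul
          (2 * Real.pi * Complex.I)).enorm (b := M) (Or.inr hMt)
        simpa using this
      filter_upwards [eventually_ge_atTop 0, ENNReal.tendsto_nhds_zero.1 h0 ε hε] with x hx hxε A a ha
      rw [hre, (ha.mul_left (isHardyInfty_exp hx) (hasBoundaryValues_exp x)).cauchy hpos, ← mul_assoc,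
        enorm_mul]
      have h1 : ‖A z‖ₑ ≤ eLpNorm a 2 volume * M := by
        have h2 := ha.enorm_sq_le hpos
        have h3 : M ^ 2 = ENNReal.ofReal (Real.pi / z.im) := by
          rw [hM, ← ENNReal.rpow_natCast, ← ENNReal.rpow_mul]; norm_num
        rw [← h3, ← mul_pow] at h2
        exact (ENNReal.pow_le_pow_left_iff two_ne_zero).1 h2
      calc _ ≤ ‖2 * Real.pi * Complex.I * Complex.exp (2 * Complex.I * z * x)‖ₑ *
            (eLpNorm a 2 volume * M) := by gcongr
        _ = ‖2 * Real.pi * Complex.I * Complex.exp (2 * Complex.I * z * x)‖ₑ * M *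
            eLpNorm a 2 volume := by ring
        _ ≤ _ := by gcongr
  · intro f f' hf hf' h h' ε hε
    filter_upwards [h _ (ENNReal.half_pos hε.ne'), h' _ (ENNReal.half_pos hε.ne')] with x hx hx' A a ha
    have h3 : ∀ t : ℝ, a t * (Complex.exp (2 * Complex.I * t * x) * (f + f') t) =
        a t * (Complex.exp (2 * Complex.I * t * x) * f t) +
        a t * (Complex.exp (2 * Complex.I * t * x) * f' t) := by
      intro t; simp; ring
    simp_rw [h3]
    rw [integral_add (integrable_mul_of_memLp_two ha.memLp (memLp_exp_mul x hf))
      (integrable_mul_of_memLp_two ha.memLp (memLp_exp_mul x hf')), ← ENNReal.add_halves ε, add_mul]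
    exact (enorm_add_le _ _).trans (add_le_add (hx A a ha) (hx' A a ha))
  · intro c f hf h ε hε
    rcases eq_or_ne c 0 with rfl | hc
    · refine Eventually.of_forall fun x A a _ => ?_
      simp
    have hc' : ‖c‖ₑ ≠ 0 := by simpa using hc
    have hε' : 0 < ε / ‖c‖ₑ := ENNReal.div_pos hε.ne' enorm_ne_top
    filter_upwards [h _ hε'] with x hx A a ha
    have h3 : ∀ t : ℝ, a t * (Complex.exp (2 * Complex.I * t * x) * (c • f) t) =
        c * (a t * (Complex.exp (2 * Complex.I * t * x) * f t)) := by
      intro t; simp; ring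
    simp_rw [h3]
    rw [integral_const_mul, enorm_mul]
    calc ‖c‖ₑ * _ ≤ ‖c‖ₑ * (ε / ‖c‖ₑ * eLpNorm a 2 volume) := by gcongr; exact hx A a ha
      _ = ‖c‖ₑ * (ε / ‖c‖ₑ) * eLpNorm a 2 volume := by ring
      _ = ε * eLpNorm a 2 volume := by rw [ENNReal.mul_div_cancel hc' enorm_ne_top]
  · intro f hf h ε hε
    obtain ⟨f', hf', hP, hd⟩ := h _ (ENNReal.half_pos hε.ne')
    filter_upwards [hP _ (ENNReal.half_pos hε.ne')] with x hx A a ha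
    have h3 : ∀ t : ℝ, a t * (Complex.exp (2 * Complex.I * t * x) * f t) =
        a t * (Complex.exp (2 * Complex.I * t * x) * (f - f') t) +
        a t * (Complex.exp (2 * Complex.I * t * x) * f' t) := by
      intro t; simp; ring
    simp_rw [h3]
    rw [integral_add (integrable_mul_of_memLp_two ha.memLp (memLp_exp_mul x (hf.sub hf')))
      (integrable_mul_of_memLp_two ha.memLp (memLp_exp_mul x hf')), ← ENNReal.add_halves ε, add_mul]
    refine (enorm_add_le _ _).trans (add_le_add ?_ (hx A a ha))
    refine (enorm_integral_mul_le ha.memLp.1 (memLp_exp_mul x (hf.sub hf')).1).trans ?_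
    rw [eLpNorm_exp_mul, mul_comm]
    gcongr

/-! ### Outer functions -/

/-- The outer function of the upper half-plane with modulus `e^w` on the real line. -/
noncomputable def outerFn (w : ℝ → ℝ) (z : ℂ) : ℂ :=
  Complex.exp (1 / (Real.pi * Complex.I) *
    ∫ t : ℝ, (1 / ((t : ℂ) - z) - (t : ℂ) / (1 + (t : ℂ) ^ 2)) * (w t : ℂ))

lemma one_add_sq_ne_zero (t : ℝ) : (1 + (t : ℂ) ^ 2) ≠ 0 := by
  have : ((1 + t ^ 2 : ℝ) : ℂ) ≠ 0 := by
    rw [Complex.ofReal_ne_zero]; positivity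
  simpa using this

/-- Expresses the integrand through the integrable function w / (1 + t²) and the Cauchy kernel,
which yields both integrability and holomorphy in z. -/
lemma outer_integrand_eq {z : ℂ} (hz : z.im ≠ 0) (w : ℝ → ℝ) (t : ℝ) :
    (1 / ((t : ℂ) - z) - (t : ℂ) / (1 + (t : ℂ) ^ 2)) * (w t : ℂ)
      = z * ((w t / (1 + t ^ 2) : ℝ) : ℂ) +
        (1 + z ^ 2) * (((t : ℂ) - z)⁻¹ * ((w t / (1 + t ^ 2) : ℝ) : ℂ)) := by
  have h1 := sub_ne_zero_of_im hz t
  have h2 := one_add_sq_ne_zero t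
  push_cast
  field_simp
  ring

lemma norm_cauchy_le {z : ℂ} (hz : 0 < z.im) (t : ℝ) : ‖((t : ℂ) - z)⁻¹‖ ≤ z.im⁻¹ := by
  rw [norm_inv]
  gcongr
  have := Complex.abs_im_le_norm ((t : ℂ) - z)
  simpa [abs_of_pos hz] using this

lemma integrable_cauchy_mul {v : ℝ → ℂ} (hv : Integrable v) {z : ℂ} (hz : 0 < z.im) :
    Integrable fun t : ℝ => ((t : ℂ) - z)⁻¹ * v t :=
  hv.bdd_mul (continuous_cauchy hz.ne').aestronglyMeasurable
    (Eventually.of_forall (norm_cauchy_le hz))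

lemma differentiableOn_cauchy_integral {v : ℝ → ℂ} (hv : Integrable v) :
    DifferentiableOn ℂ (fun z : ℂ => ∫ t : ℝ, ((t : ℂ) - z)⁻¹ * v t) {z | 0 < z.im} := by
  intro z hz
  have hz : 0 < z.im := hz
  set U : Set ℂ := {w | z.im / 2 < w.im} with hU
  have hUo : U ∈ 𝓝 z := (isOpen_lt continuous_const Complex.continuous_im).mem_nhds (by
    change z.im / 2 < z.im; linarith)
  have hpos : ∀ w ∈ U, 0 < w.im := fun w hw => by
    have : z.im / 2 < w.im := hw
    linarith
  have h1 := hasDerivAt_integral_of_dominated_loc_of_deriv_le (𝕜 := ℂ) (μ := (volume : Measure ℝ))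
    (F := fun w (t : ℝ) => ((t : ℂ) - w)⁻¹ * v t) (x₀ := z) (s := U)
    (F' := fun w (t : ℝ) => (((t : ℂ) - w)⁻¹) ^ 2 * v t)
    (bound := fun t => ((z.im / 2)⁻¹) ^ 2 * ‖v t‖) hUo
    (by
      filter_upwards [hUo] with w hw
      exact (integrable_cauchy_mul hv (hpos w hw)).1)
    (integrable_cauchy_mul hv hz)
    (((continuous_cauchy hz.ne').pow 2).aestronglyMeasurable.mul hv.1)
    (Eventually.of_forall fun t w hw => by
      rw [norm_mul, norm_pow]
      gcongr
      refine (norm_cauchy_le (hpos w hw) t).trans ?_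
      have hw : z.im / 2 < w.im := hw
      gcongr)
    (hv.norm.const_mul _)
    (Eventually.of_forall fun t w hw => by
      have h2 := sub_ne_zero_of_im (hpos w hw).ne' t
      have h3 : HasDerivAt (fun w : ℂ => (t : ℂ) - w) (-1) w := by
        simpa using (hasDerivAt_id w).const_sub (t : ℂ)
      have h4 := (h3.fun_inv h2).mul_const (v t)
      have h5 : - -1 / ((t : ℂ) - w) ^ 2 * v t = (((t : ℂ) - w)⁻¹) ^ 2 * v t := by
        rw [neg_neg, one_div, inv_pow]
      rw [h5] at h4
      exact h4)
  exact h1.2.differentiableAt.differentiableWithinAt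

lemma integrable_ofReal_div {w : ℝ → ℝ} (hw : Integrable fun t => w t / (1 + t ^ 2)) :
    Integrable fun t : ℝ => ((w t / (1 + t ^ 2) : ℝ) : ℂ) := hw.ofReal

lemma integrable_outer {w : ℝ → ℝ} (hw : Integrable fun t => w t / (1 + t ^ 2)) {z : ℂ}
    (hz : 0 < z.im) : Integrable fun t : ℝ =>
      (1 / ((t : ℂ) - z) - (t : ℂ) / (1 + (t : ℂ) ^ 2)) * (w t : ℂ) := by
  simp_rw [outer_integrand_eq hz.ne']
  exact ((integrable_ofReal_div hw).const_mul _).add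
    ((integrable_cauchy_mul (integrable_ofReal_div hw) hz).const_mul _)

lemma differentiableOn_outerFn {w : ℝ → ℝ} (hw : Integrable fun t => w t / (1 + t ^ 2)) :
    DifferentiableOn ℂ (outerFn w) {z | 0 < z.im} := by
  have hv := integrable_ofReal_div hw
  have h1 : DifferentiableOn ℂ (fun z : ℂ => z * (∫ t : ℝ, ((w t / (1 + t ^ 2) : ℝ) : ℂ)) +
      (1 + z ^ 2) * ∫ t : ℝ, ((t : ℂ) - z)⁻¹ * ((w t / (1 + t ^ 2) : ℝ) : ℂ)) {z | 0 < z.im} :=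
    (DifferentiableOn.mul_const (by fun_prop) _).add
      (DifferentiableOn.mul (by fun_prop) (differentiableOn_cauchy_integral hv))
  refine (h1.const_mul (1 / (Real.pi * Complex.I))).cexp.congr fun z hz => ?_
  have hz : 0 < z.im := hz
  unfold outerFn
  simp_rw [outer_integrand_eq hz.ne']
  rw [integral_add (hv.const_mul _) ((integrable_cauchy_mul hv hz).const_mul _),
    integral_const_mul, integral_const_mul]

lemma outerFn_ne_zero (w : ℝ → ℝ) (z : ℂ) : outerFn w z ≠ 0 := Complex.exp_ne_zero _

lemma integrable_smul_of_div {w : ℝ → ℝ} (hw : Integrable fun t => w t / (1 + t ^ 2)) :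
    Integrable fun t : ℝ => (1 + t ^ 2)⁻¹ • w t := by
  refine hw.congr (Eventually.of_forall fun t => ?_)
  simp only [smul_eq_mul]; rw [div_eq_inv_mul]

/-- The imaginary part of 1 / (t - z) is the Poisson kernel. The normalizing term t / (1 + t²) is
real and drops out of the real part after division by i. -/
lemma norm_outerFn {w : ℝ → ℝ} (hw : Integrable fun t => w t / (1 + t ^ 2)) {z : ℂ}
    (hz : 0 < z.im) :
    ‖outerFn w z‖ = Real.exp (Real.pi⁻¹ • ∫ t : ℝ, poissonHP z.im (t - z.re) • w t) := by
  unfold outerFn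
  rw [Complex.norm_exp, ← integral_const_mul]
  congr 1
  have h1 := integral_re ((integrable_outer hw hz).const_mul (1 / (Real.pi * Complex.I) : ℂ))
  simp only [RCLike.re_to_complex] at h1
  rw [← h1, smul_eq_mul, ← integral_const_mul]
  congr with t
  have h2 := cauchy_sub_conj hz.ne' t
  have h3 : ((t : ℂ) - conj z)⁻¹ = conj (((t : ℂ) - z)⁻¹) := by simp
  rw [h3, Complex.sub_conj] at h2
  have h4 : (((t : ℂ) - z)⁻¹).im = poissonHP z.im (t - z.re) := by
    have h5 := congrArg Complex.im h2
    simp at h5 ⊢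
    linarith
  have h6 : (t : ℂ) / (1 + (t : ℂ) ^ 2) = ((t / (1 + t ^ 2) : ℝ) : ℂ) := by push_cast; rfl
  rw [h6, ← mul_assoc, Complex.re_mul_ofReal, smul_eq_mul, ← mul_assoc, ← h4]
  congr 1
  have h7 : (1 / (Real.pi * Complex.I) : ℂ) = ((Real.pi⁻¹ : ℝ) : ℂ) * -Complex.I := by
    have : (Real.pi : ℂ) ≠ 0 := by exact_mod_cast Real.pi_ne_zero
    push_cast
    rw [one_div, mul_inv, Complex.inv_I]
  rw [h7, mul_assoc, Complex.re_ofReal_mul, one_div]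
  congr 1
  simp only [neg_mul, Complex.neg_re, Complex.I_mul_re, Complex.sub_im, Complex.ofReal_im]
  ring

/-- The modulus of an outer function tends to the prescribed boundary modulus. -/
lemma ae_tendsto_norm_outerFn {w : ℝ → ℝ} (hw : Integrable fun t => w t / (1 + t ^ 2)) :
    ∀ᵐ t : ℝ, Tendsto (fun y : ℝ => ‖outerFn w (t + y * Complex.I)‖) (𝓝[>] 0)
      (𝓝 (Real.exp (w t))) := by
  filter_upwards [ae_tendsto_poisson (integrable_smul_of_div hw)] with t ht
  refine ((Real.continuous_exp.tendsto _).comp ht).congr' ?_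
  filter_upwards [self_mem_nhdsWithin] with y (hy : 0 < y)
  rw [norm_outerFn hw (line_mem_upper t hy)]
  simp

lemma norm_outerFn_le {w : ℝ → ℝ} (hw : Integrable fun t => w t / (1 + t ^ 2)) {M : ℝ}
    (hM : ∀ t, w t ≤ M) {z : ℂ} (hz : 0 < z.im) : ‖outerFn w z‖ ≤ Real.exp M := by
  rw [norm_outerFn hw hz, Real.exp_le_exp, smul_eq_mul, inv_mul_le_iff₀ Real.pi_pos]
  calc ∫ t : ℝ, poissonHP z.im (t - z.re) • w t
      ≤ ∫ t : ℝ, poissonHP z.im (t - z.re) * M := by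
        refine integral_mono (integrable_poissonHP_smul (integrable_smul_of_div hw) hz z.re)
          ((integrable_poissonHP hz z.re).mul_const M) fun t => ?_
        simp only [smul_eq_mul]
        exact mul_le_mul_of_nonneg_left (hM t) (poissonHP_nonneg hz _)
    _ = Real.pi * M := by rw [integral_mul_const, integral_poissonHP hz]

lemma outerFn_add {w w' : ℝ → ℝ} (hw : Integrable fun t => w t / (1 + t ^ 2))
    (hw' : Integrable fun t => w' t / (1 + t ^ 2)) {z : ℂ} (hz : 0 < z.im) :
    outerFn (fun t => w t + w' t) z = outerFn w z * outerFn w' z := by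
  unfold outerFn
  rw [← Complex.exp_add, ← mul_add, ← integral_add (integrable_outer hw hz)
    (integrable_outer hw' hz)]
  congr 3 with t
  push_cast; ring

lemma outerFn_neg_conj {w : ℝ → ℝ} (heven : ∀ᵐ t, w (-t) = w t) (z : ℂ) :
    outerFn w (-conj z) = conj (outerFn w z) := by
  unfold outerFn
  rw [← Complex.exp_conj, map_mul, ← integral_conj]
  congr 1
  have h1 : conj (1 / (Real.pi * Complex.I) : ℂ) = -(1 / (Real.pi * Complex.I)) := by
    simp
  rw [h1, neg_mul, ← mul_neg, ← integral_neg, ← integral_neg_eq_self]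
  congr 1
  refine integral_congr_ae ?_
  filter_upwards [heven] with t ht
  simp only [map_mul, map_sub, map_div₀, map_add, map_pow, map_one, Complex.conj_ofReal]
  rw [ht]
  push_cast
  rw [neg_sq, ← neg_mul]
  congr 1
  have : -(t : ℂ) - -conj z = -((t : ℂ) - conj z) := by ring
  rw [this, one_div_neg_eq_neg_one_div]
  ring

/-- Bounded approximations of the inverse of an outer function. -/
noncomputable def outerInvApprox (w : ℝ → ℝ) (n : ℕ) : ℂ → ℂ := outerFn fun t => min (-w t) n

lemma integrable_min_div {w : ℝ → ℝ} (hw0 : ∀ t, w t ≤ 0)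
    (hw : Integrable fun t => w t / (1 + t ^ 2)) (n : ℕ) :
    Integrable fun t => min (-w t) n / (1 + t ^ 2) := by
  have hm : AEStronglyMeasurable w volume := by
    have h1 : AEStronglyMeasurable (fun t : ℝ => w t / (1 + t ^ 2) * (1 + t ^ 2)) volume :=
      hw.1.mul (Continuous.aestronglyMeasurable (by fun_prop))
    refine h1.congr (Eventually.of_forall fun t => ?_)
    have : (1 + t ^ 2 : ℝ) ≠ 0 := by positivity
    simp [this]
  have hinv : AEStronglyMeasurable (fun t : ℝ => (1 + t ^ 2)⁻¹) volume :=
    integrable_inv_one_add_sq.1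
  refine hw.mono ?_ (Eventually.of_forall fun t => ?_)
  · simp_rw [div_eq_mul_inv]
    exact (hm.neg.inf aestronglyMeasurable_const).mul hinv
  · rw [norm_div, norm_div]
    gcongr
    have h1 := hw0 t
    rw [Real.norm_of_nonneg (le_min (by linarith) (Nat.cast_nonneg n)), Real.norm_of_nonpos h1]
    exact min_le_left _ _

lemma isHardyInfty_outerFn {w : ℝ → ℝ} (hw : Integrable fun t => w t / (1 + t ^ 2)) {M : ℝ}
    (hM : ∀ t, w t ≤ M) : IsHardyInfty (outerFn w) :=
  ⟨differentiableOn_outerFn hw, Real.exp M, fun _ hz => norm_outerFn_le hw hM hz⟩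

lemma isHardyInfty_outerInvApprox {w : ℝ → ℝ} (hw0 : ∀ t, w t ≤ 0)
    (hw : Integrable fun t => w t / (1 + t ^ 2)) (n : ℕ) : IsHardyInfty (outerInvApprox w n) :=
  isHardyInfty_outerFn (integrable_min_div hw0 hw n) (M := n) fun _ => min_le_right _ _

lemma outerFn_mul_outerInvApprox {w : ℝ → ℝ} (hw0 : ∀ t, w t ≤ 0)
    (hw : Integrable fun t => w t / (1 + t ^ 2)) (n : ℕ) {z : ℂ} (hz : 0 < z.im) :
    outerFn w z * outerInvApprox w n z = outerFn (fun t => w t + min (-w t) n) z :=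
  (outerFn_add hw (integrable_min_div hw0 hw n) hz).symm

lemma norm_outerFn_mul_outerInvApprox_le {w : ℝ → ℝ} (hw0 : ∀ t, w t ≤ 0)
    (hw : Integrable fun t => w t / (1 + t ^ 2)) (n : ℕ) {z : ℂ} (hz : 0 < z.im) :
    ‖outerFn w z * outerInvApprox w n z‖ ≤ 1 := by
  rw [outerFn_mul_outerInvApprox hw0 hw n hz]
  have h1 : Integrable fun t => (w t + min (-w t) n) / (1 + t ^ 2) := by
    simp_rw [add_div]
    exact hw.add (integrable_min_div hw0 hw n)
  refine (norm_outerFn_le h1 (M := 0) (fun t => ?_) hz).trans_eq Real.exp_zero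
  linarith [min_le_left (-w t) (n : ℝ)]

/-- The product is the outer function of w + min(-w, n), which lies between w and 0 and vanishes at
t as soon as n ≥ -w(t); dominated convergence applies to the exponent. -/
lemma tendsto_outerFn_mul_outerInvApprox {w : ℝ → ℝ} (hw0 : ∀ t, w t ≤ 0)
    (hw : Integrable fun t => w t / (1 + t ^ 2)) {z : ℂ} (hz : 0 < z.im) :
    Tendsto (fun n => outerFn w z * outerInvApprox w n z) atTop (𝓝 1) := by
  simp_rw [outerFn_mul_outerInvApprox hw0 hw _ hz]
  unfold outerFn
  have h1 : ∀ n : ℕ, Integrable fun t => (w t + min (-w t) n) / (1 + t ^ 2) := by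
    intro n
    simp_rw [add_div]
    exact hw.add (integrable_min_div hw0 hw n)
  have h2 : Tendsto (fun n : ℕ => ∫ t : ℝ, (1 / ((t : ℂ) - z) - (t : ℂ) / (1 + (t : ℂ) ^ 2)) *
      ((w t + min (-w t) n : ℝ) : ℂ)) atTop (𝓝 (∫ _ : ℝ, 0)) := by
    refine tendsto_integral_of_dominated_convergence
      (fun t : ℝ => ‖(1 / ((t : ℂ) - z) - (t : ℂ) / (1 + (t : ℂ) ^ 2)) * (w t : ℂ)‖)
      (fun n => (integrable_outer (h1 n) hz).1) (integrable_outer hw hz).norm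
      (fun n => Eventually.of_forall fun t => ?_) (Eventually.of_forall fun t => ?_)
    · rw [norm_mul, norm_mul, Complex.norm_real, Complex.norm_real]
      gcongr
      have h3 := hw0 t
      have h4 : 0 ≤ min (-w t) n := le_min (by linarith) (Nat.cast_nonneg n)
      have h5 := min_le_left (-w t) (n : ℝ)
      rw [Real.norm_of_nonpos h3, Real.norm_of_nonpos (by linarith)]
      linarith
    · refine tendsto_const_nhds.congr' ?_
      obtain ⟨N, hN⟩ := exists_nat_ge (-w t)
      filter_upwards [eventually_ge_atTop N] with n hn
      have : -w t ≤ n := hN.trans (by exact_mod_cast hn)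
      rw [min_eq_left this]
      simp
  rw [integral_zero] at h2
  have h3 := (h2.const_mul (1 / (Real.pi * Complex.I) : ℂ)).cexp
  simpa using h3

/-! ### Blaschke products with zeros on the imaginary axis -/

/-- A subset of the positive imaginary axis which satisfies the Blaschke condition. -/
structure BlaschkeSet (A : Set ℂ) : Prop where
  mem_imag : ∀ a ∈ A, a.re = 0 ∧ 0 < a.im
  summable : Summable (A.indicator fun a => min a.im a.im⁻¹)

lemma BlaschkeSet.mono {A A' : Set ℂ} (h : BlaschkeSet A) (hA : A' ⊆ A) : BlaschkeSet A' := by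
  refine ⟨fun a ha => h.mem_imag a (hA ha), h.summable.of_nonneg_of_le (fun a => ?_) fun a => ?_⟩
  · refine Set.indicator_nonneg (fun a ha => ?_) a
    have := (h.mem_imag a (hA ha)).2
    positivity
  · by_cases ha : a ∈ A'
    · rw [Set.indicator_of_mem ha, Set.indicator_of_mem (hA ha)]
    · rw [Set.indicator_of_notMem ha]
      refine Set.indicator_nonneg (fun a ha => ?_) a
      have := (h.mem_imag a ha).2
      positivity

lemma conj_of_re_eq_zero {a : ℂ} (ha : a.re = 0) : conj a = -a := by
  apply Complex.ext <;> simp [ha]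

lemma differentiableAt_blaschkeFactor {a z : ℂ} (ha : 0 < a.im) (hz : 0 ≤ z.im) :
    DifferentiableAt ℂ (blaschkeFactor a) z := by
  have h := upper_sub_conj_ne_zero hz ha
  unfold blaschkeFactor
  split_ifs
  · exact (differentiableAt_id.sub_const a).div (differentiableAt_id.sub_const (conj a)) h
  · exact ((differentiableAt_id.sub_const a).div (differentiableAt_id.sub_const (conj a)) h).neg

lemma norm_blaschkeFactor (a z : ℂ) : ‖blaschkeFactor a z‖ = ‖z - a‖ / ‖z - conj a‖ := by
  unfold blaschkeFactor
  split_ifs <;> simp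

lemma norm_blaschkeFactor_le_one {a z : ℂ} (ha : 0 < a.im) (hz : 0 ≤ z.im) :
    ‖blaschkeFactor a z‖ ≤ 1 := by
  rw [norm_blaschkeFactor]
  refine div_le_one_of_le₀ ?_ (norm_nonneg _)
  refine le_of_sq_le_sq ?_ (norm_nonneg _)
  rw [← Complex.normSq_eq_norm_sq, ← Complex.normSq_eq_norm_sq, Complex.normSq_apply,
    Complex.normSq_apply]
  simp
  nlinarith [mul_nonneg hz ha.le]

lemma norm_blaschkeFactor_ofReal {a : ℂ} (ha : 0 < a.im) (t : ℝ) : ‖blaschkeFactor a t‖ = 1 := by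
  have h1 : (t : ℂ) - conj a = conj ((t : ℂ) - a) := by simp
  have h2 := sub_ne_zero_of_im ha.ne' t
  rw [norm_blaschkeFactor, h1, RCLike.norm_conj, div_self (norm_ne_zero_iff.2 h2)]

lemma blaschkeFactor_self (a : ℂ) : blaschkeFactor a a = 0 := by
  unfold blaschkeFactor; split_ifs <;> simp

lemma blaschkeFactor_ne_zero {a z : ℂ} (ha : 0 < a.im) (hz : 0 ≤ z.im) (h : z ≠ a) :
    blaschkeFactor a z ≠ 0 := by
  rw [← norm_ne_zero_iff, norm_blaschkeFactor]
  exact div_ne_zero (norm_ne_zero_iff.2 (sub_ne_zero.2 h))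
    (norm_ne_zero_iff.2 (upper_sub_conj_ne_zero hz ha))

lemma blaschkeFactor_neg_conj {a : ℂ} (ha : a.re = 0) (z : ℂ) :
    blaschkeFactor a (-conj z) = conj (blaschkeFactor a z) := by
  have h1 := conj_of_re_eq_zero ha
  have h2 : (-conj z - a) / (-conj z - conj a) = conj ((z - a) / (z - conj a)) := by
    rw [← neg_div_neg_eq]
    simp only [map_div₀, map_sub, h1, map_neg]
    ring
  unfold blaschkeFactor
  split_ifs <;> simp [h2]

/-- The sign in the factor is chosen so that it tends to 1 both for a → 0 and for a → i∞: the
difference from 1 is -2a / (z - conj a) in the first case and -2z / (z - conj a) in the second. This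
is where conj a = -a is used, and it gives convergence of the product under the Blaschke condition.
-/
lemma norm_blaschkeFactor_sub_one_le {a z : ℂ} (ha : a.re = 0) (ha' : 0 < a.im) (hz : 0 < z.im) :
    ‖blaschkeFactor a z - 1‖ ≤ (2 / z.im + 2 * ‖z‖) * min a.im a.im⁻¹ := by
  have h := upper_sub_conj_ne_zero hz.le ha'
  have h1 := conj_of_re_eq_zero ha
  have hpos := norm_pos_iff.2 h
  have h2 : z.im + a.im ≤ ‖z - conj a‖ := by
    have := Complex.abs_im_le_norm (z - conj a)
    simp only [Complex.sub_im, Complex.conj_im, sub_neg_eq_add] at this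
    exact (le_abs_self _).trans this
  have ha2 : ‖a‖ = a.im := by
    have : a = a.im * Complex.I := by apply Complex.ext <;> simp [ha]
    rw [this]; simp [abs_of_pos ha']
  unfold blaschkeFactor
  split_ifs with hle
  · have h3 : (z - a) / (z - conj a) - 1 = -(2 * a) / (z - conj a) := by
      rw [eq_div_iff h, sub_mul, div_mul_cancel₀ _ h, h1]; ring
    rw [h3, norm_div, norm_neg, norm_mul, Complex.norm_ofNat, ha2,
      min_eq_left (hle.trans (one_le_inv_iff₀.2 ⟨ha', hle⟩)), add_mul, div_mul_eq_mul_div]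
    have : 2 * a.im / ‖z - conj a‖ ≤ 2 * a.im / z.im := by gcongr; linarith
    have : 0 ≤ 2 * ‖z‖ * a.im := by positivity
    linarith
  · push Not at hle
    have h3 : -((z - a) / (z - conj a)) - 1 = -(2 * z) / (z - conj a) := by
      rw [eq_div_iff h, sub_mul, neg_mul, div_mul_cancel₀ _ h, h1]; ring
    rw [h3, norm_div, norm_neg, norm_mul, Complex.norm_ofNat,
      min_eq_right ((inv_le_one_of_one_le₀ hle.le).trans hle.le), add_mul]
    have : 2 * ‖z‖ / ‖z - conj a‖ ≤ 2 * ‖z‖ * a.im⁻¹ := by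
      rw [← div_eq_mul_inv]; gcongr; linarith
    have : 0 ≤ 2 / z.im * a.im⁻¹ := by positivity
    linarith

/-- With ℂ as a common index set, products over different subsets can be multiplied and compared
termwise. -/
lemma blaschke_eq_tprod (A : Set ℂ) (z : ℂ) :
    blaschke A z = ∏' a : ℂ, (1 + A.indicator (fun a => blaschkeFactor a z - 1) a) := by
  unfold blaschke
  rw [tprod_subtype A (fun a => blaschkeFactor a z)]
  congr with a
  by_cases ha : a ∈ A <;> simp [ha]

lemma prod_indicator_eq (A : Set ℂ) (S : Finset ℂ) (z : ℂ) [DecidablePred (· ∈ A)] :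
    ∏ a ∈ S, (1 + A.indicator (fun a => blaschkeFactor a z - 1) a)
      = ∏ a ∈ S with a ∈ A, blaschkeFactor a z := by
  rw [Finset.prod_filter]
  refine Finset.prod_congr rfl fun a _ => ?_
  by_cases ha : a ∈ A <;> simp [ha]

lemma blaschke_coe (S : Finset ℂ) (z : ℂ) : blaschke (S : Set ℂ) z = ∏ a ∈ S, blaschkeFactor a z :=
  S.tprod_subtype' fun a => blaschkeFactor a z

namespace BlaschkeSet

variable {A : Set ℂ}

lemma norm_indicator_le (h : BlaschkeSet A) {z : ℂ} (hz : 0 < z.im) (a : ℂ) :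
    ‖A.indicator (fun a => blaschkeFactor a z - 1) a‖ ≤
      (2 / z.im + 2 * ‖z‖) * A.indicator (fun a => min a.im a.im⁻¹) a := by
  by_cases ha : a ∈ A
  · rw [Set.indicator_of_mem ha, Set.indicator_of_mem ha]
    exact norm_blaschkeFactor_sub_one_le (h.mem_imag a ha).1 (h.mem_imag a ha).2 hz
  · simp [ha]

lemma summable_norm (h : BlaschkeSet A) {z : ℂ} (hz : 0 < z.im) :
    Summable fun a => ‖A.indicator (fun a => blaschkeFactor a z - 1) a‖ :=
  (h.summable.mul_left _).of_nonneg_of_le (fun _ => norm_nonneg _) (h.norm_indicator_le hz)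

lemma multipliable (h : BlaschkeSet A) {z : ℂ} (hz : 0 < z.im) :
    Multipliable fun a => 1 + A.indicator (fun a => blaschkeFactor a z - 1) a :=
  multipliable_one_add_of_summable (h.summable_norm hz)

lemma hasProd (h : BlaschkeSet A) {z : ℂ} (hz : 0 < z.im) :
    HasProd (fun a => 1 + A.indicator (fun a => blaschkeFactor a z - 1) a) (blaschke A z) := by
  rw [blaschke_eq_tprod]
  exact (h.multipliable hz).hasProd

lemma differentiableOn (h : BlaschkeSet A) : DifferentiableOn ℂ (blaschke A) {z | 0 < z.im} := by
  intro z hz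
  have hz : 0 < z.im := hz
  -- On this neighbourhood the bound for the factors is uniform, so the product converges locally
  -- uniformly.
  set K : Set ℂ := {w | z.im / 2 < w.im} ∩ Metric.ball 0 (‖z‖ + 1) with hK
  have hKo : IsOpen K := (isOpen_lt continuous_const Complex.continuous_im).inter Metric.isOpen_ball
  have hzK : z ∈ K := ⟨by change z.im / 2 < z.im; linarith, by simp⟩
  have hpos : ∀ w ∈ K, 0 < w.im := fun w hw => by
    have : z.im / 2 < w.im := hw.1
    linarith
  have hfac : ∀ a, DifferentiableOn ℂ (fun w => A.indicator (fun a => blaschkeFactor a w - 1) a) K := by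
    intro a w hw
    by_cases ha : a ∈ A
    · simp only [Set.indicator_of_mem ha]
      exact ((differentiableAt_blaschkeFactor (h.mem_imag a ha).2
        (hpos w hw).le).sub_const 1).differentiableWithinAt
    · simp only [Set.indicator_of_notMem ha]
      exact differentiableWithinAt_const _
  have hprod := Summable.hasProdLocallyUniformlyOn_one_add (K := K)
    (f := fun a w => A.indicator (fun a => blaschkeFactor a w - 1) a)
    (u := fun a => (2 / (z.im / 2) + 2 * (‖z‖ + 1)) * A.indicator (fun a => min a.im a.im⁻¹) a)
    hKo (h.summable.mul_left _)
    (Eventually.of_forall fun a w hw => by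
      refine (h.norm_indicator_le (hpos w hw) a).trans ?_
      have h1 : 0 ≤ A.indicator (fun a => min a.im a.im⁻¹) a :=
        Set.indicator_nonneg (fun a ha => by
          have := (h.mem_imag a ha).2
          positivity) a
      have h2 : z.im / 2 < w.im := hw.1
      have h3 : ‖w‖ ≤ ‖z‖ + 1 := by simpa using (Metric.mem_ball.1 hw.2).le
      gcongr)
    fun a => (hfac a).continuousOn
  have hd := hprod.differentiableOn (Eventually.of_forall fun S => by
    simpa [Finset.prod_fn] using
      DifferentiableOn.finsetProd (fun a _ => (differentiableOn_const 1).add (hfac a))) hKo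
  have h4 : DifferentiableAt ℂ (blaschke A) z := by
    refine (hd.differentiableAt (hKo.mem_nhds hzK)).congr_of_eventuallyEq ?_
    exact Eventually.of_forall fun w => blaschke_eq_tprod A w
  exact h4.differentiableWithinAt

lemma norm_le_one (h : BlaschkeSet A) {z : ℂ} (hz : 0 < z.im) : ‖blaschke A z‖ ≤ 1 := by
  classical
  refine le_of_tendsto (h.hasProd hz).norm (Eventually.of_forall fun S => ?_)
  rw [← norm_prod, prod_indicator_eq, norm_prod]
  exact Finset.prod_le_one (fun _ _ => norm_nonneg _) fun a ha =>
    norm_blaschkeFactor_le_one (h.mem_imag a (Finset.mem_filter.1 ha).2).2 hz.le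

lemma isHardyInfty (h : BlaschkeSet A) : IsHardyInfty (blaschke A) :=
  ⟨h.differentiableOn, 1, fun _ hz => h.norm_le_one hz⟩

lemma blaschke_union {A' : Set ℂ} (h : BlaschkeSet A) (h' : BlaschkeSet A') (hd : Disjoint A A')
    {z : ℂ} (hz : 0 < z.im) : blaschke (A ∪ A') z = blaschke A z * blaschke A' z := by
  rw [blaschke_eq_tprod, blaschke_eq_tprod, blaschke_eq_tprod,
    ← (h.multipliable hz).tprod_mul (h'.multipliable hz)]
  congr with a
  by_cases ha : a ∈ A
  · have ha' : a ∉ A' := Set.disjoint_left.1 hd ha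
    simp [ha, ha']
  · by_cases ha' : a ∈ A' <;> simp [ha, ha']

lemma coe_inter [DecidablePred (· ∈ A)] (S : Finset ℂ) :
    ((S.filter (· ∈ A) : Finset ℂ) : Set ℂ) = A ∩ S := by
  ext a; simp [and_comm]

lemma blaschke_eq_mul (h : BlaschkeSet A) [DecidablePred (· ∈ A)] (S : Finset ℂ) {z : ℂ}
    (hz : 0 < z.im) :
    blaschke A z = (∏ a ∈ S with a ∈ A, blaschkeFactor a z) * blaschke (A \ S) z := by
  have h1 : A = (A ∩ S) ∪ (A \ S) := (Set.inter_union_sdiff A S).symm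
  rw [← blaschke_coe, coe_inter]
  conv_lhs => rw [h1]
  exact blaschke_union (h.mono Set.inter_subset_left) (h.mono Set.sdiff_subset)
    Set.disjoint_sdiff_inter.symm hz

lemma eq_zero_of_mem (h : BlaschkeSet A) {a : ℂ} (ha : a ∈ A) : blaschke A a = 0 := by
  classical
  rw [h.blaschke_eq_mul {a} (h.mem_imag a ha).2, Finset.filter_singleton, if_pos ha]
  simp [blaschkeFactor_self]

/-- A product of factors 1 + u differs from 1 by at most exp(∑ |u|) - 1, and the sum over the
complement of S tends to zero. -/
lemma tendsto_diff (h : BlaschkeSet A) {z : ℂ} (hz : 0 < z.im) :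
    Tendsto (fun S : Finset ℂ => blaschke (A \ S) z) atTop (𝓝 1) := by
  have hle : ∀ S : Finset ℂ, ‖blaschke (A \ S) z - 1‖ ≤
      Real.exp (∑' a : {a // a ∉ S}, ‖A.indicator (fun a => blaschkeFactor a z - 1) (a : ℂ)‖) - 1 := by
    intro S
    have hS := h.mono (A' := A \ S) Set.sdiff_subset
    refine le_of_tendsto ((hS.hasProd hz).sub_const 1).norm (Eventually.of_forall fun T => ?_)
    refine (T.norm_prod_one_add_sub_one_le _).trans ?_
    gcongr
    refine ((hS.summable_norm hz).sum_le_tsum T fun _ _ => norm_nonneg _).trans (le_of_eq ?_)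
    have h1 := tsum_subtype ((S : Set ℂ)ᶜ)
      (fun a => ‖A.indicator (fun a => blaschkeFactor a z - 1) a‖)
    refine Eq.trans ?_ h1.symm
    congr with a
    by_cases ha : a ∈ S <;> by_cases ha' : a ∈ A <;> simp [ha, ha']
  have hlim : Tendsto (fun S : Finset ℂ =>
      Real.exp (∑' a : {a // a ∉ S}, ‖A.indicator (fun a => blaschkeFactor a z - 1) (a : ℂ)‖) - 1)
      atTop (𝓝 0) := by
    have h2 := tendsto_tsum_compl_atTop_zero
      (fun a => ‖A.indicator (fun a => blaschkeFactor a z - 1) a‖)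
    have h3 := ((Real.continuous_exp.tendsto 0).comp h2).sub_const 1
    simpa using h3
  rw [tendsto_iff_norm_sub_tendsto_zero]
  exact squeeze_zero (fun _ => norm_nonneg _) hle hlim

lemma prod_ne_zero (h : BlaschkeSet A) [DecidablePred (· ∈ A)] (S : Finset ℂ) {z : ℂ}
    (hz : 0 < z.im) (hzA : z ∉ A) : ∏ a ∈ S with a ∈ A, blaschkeFactor a z ≠ 0 :=
  Finset.prod_ne_zero_iff.2 fun a ha => by
    have haA := (Finset.mem_filter.1 ha).2
    refine blaschkeFactor_ne_zero (h.mem_imag a haA).2 hz.le ?_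
    rintro rfl
    exact hzA haA

/-- Some tail product is close to 1 and hence nonzero, and the finitely many factors removed vanish
only at points of A. -/
lemma ne_zero (h : BlaschkeSet A) {z : ℂ} (hz : 0 < z.im) (hzA : z ∉ A) : blaschke A z ≠ 0 := by
  classical
  obtain ⟨S, hS⟩ := ((h.tendsto_diff hz).eventually_ne one_ne_zero).exists
  rw [h.blaschke_eq_mul S hz]
  exact mul_ne_zero (h.prod_ne_zero S hz hzA) hS

lemma neg_conj (h : BlaschkeSet A) (z : ℂ) : blaschke A (-conj z) = conj (blaschke A z) := by
  unfold blaschke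
  rw [Function.LeftInverse.map_tprod (g := starRingEnd ℂ) (g' := starRingEnd ℂ) _
    Complex.continuous_conj Complex.continuous_conj Complex.conj_conj]
  congr with a
  exact blaschkeFactor_neg_conj (h.mem_imag a a.2).1 z

lemma hasBoundaryValues_prod (h : BlaschkeSet A) [DecidablePred (· ∈ A)] (S : Finset ℂ) :
    HasBoundaryValues (fun z => ∏ a ∈ S with a ∈ A, blaschkeFactor a z)
      fun t => ∏ a ∈ S with a ∈ A, blaschkeFactor a t :=
  hasBoundaryValues_of_continuousAt fun t => by
    refine tendsto_finsetProd _ fun a ha => ?_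
    exact (differentiableAt_blaschkeFactor (h.mem_imag a (Finset.mem_filter.1 ha).2).2
      (by simp)).continuousAt

/-- The boundary values of a Blaschke product are unimodular. -/
lemma norm_boundaryValue (h : BlaschkeSet A) : ∀ᵐ t : ℝ, ‖boundaryValue (blaschke A) t‖ = 1 := by
  classical
  have hi : 0 < Complex.I.im := by simp
  have hbv := h.isHardyInfty.hasBoundaryValues
  have hle : ∀ᵐ t : ℝ, ‖boundaryValue (blaschke A) t‖ ≤ 1 := hbv.norm_le fun z hz => h.norm_le_one hz
  -- Finitely many factors are unimodular on ℝ, so |B| equals the modulus of any tail product there,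
  -- and 1 - |B| is at most the distance of that tail from 1. Its weighted mean square is controlled
  -- by the value of the tail at i, which tends to 1.
  have hS : ∀ S : Finset ℂ,
      ∫⁻ t : ℝ, ‖((1 - ‖boundaryValue (blaschke A) t‖ : ℝ) : ℂ) * hardyKernel t Complex.I‖ₑ ^ 2 ≤
        ENNReal.ofReal (4 * Real.pi * ((1 - (blaschke (A \ S) Complex.I).re) / (2 * Complex.I.im))) := by
    intro S
    have hAS := h.mono (A' := A \ S) Set.sdiff_subset
    refine le_trans (lintegral_mono_ae ?_) (lintegral_sub_one_mul_kernel_le hAS.differentiableOn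
      (fun z hz => hAS.norm_le_one hz) hAS.isHardyInfty.hasBoundaryValues hi)
    have h1 : HasBoundaryValues (blaschke A) _ :=
      ((h.hasBoundaryValues_prod S).mul hAS.isHardyInfty.hasBoundaryValues).congr_upper
        fun z hz => (h.blaschke_eq_mul S hz).symm
    filter_upwards [hbv.ae_eq h1, hle] with t ht ht1
    have h2 : ‖boundaryValue (blaschke A) t‖ = ‖boundaryValue (blaschke (A \ S)) t‖ := by
      rw [ht, norm_mul, norm_prod, Finset.prod_eq_one, one_mul]
      exact fun a ha => norm_blaschkeFactor_ofReal (h.mem_imag a (Finset.mem_filter.1 ha).2).2 t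
    rw [enorm_mul, enorm_mul]
    gcongr
    rw [← ofReal_norm, ← ofReal_norm, Complex.norm_real, h2]
    refine ENNReal.ofReal_le_ofReal ?_
    rw [Real.norm_eq_abs, ← norm_one (α := ℂ), norm_sub_rev _ (1 : ℂ)]
    exact abs_norm_sub_norm_le _ _
  have hlim : Tendsto (fun S : Finset ℂ => ENNReal.ofReal (4 * Real.pi *
      ((1 - (blaschke (A \ S) Complex.I).re) / (2 * Complex.I.im)))) atTop (𝓝 0) := by
    have h3 := (Complex.continuous_re.tendsto _).comp (h.tendsto_diff hi)
    have h4 := ENNReal.tendsto_ofReal (((h3.const_sub 1).div_const (2 * Complex.I.im)).const_mul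
      (4 * Real.pi))
    simpa using h4
  have h0 : ∫⁻ t : ℝ, ‖((1 - ‖boundaryValue (blaschke A) t‖ : ℝ) : ℂ) *
      hardyKernel t Complex.I‖ₑ ^ 2 = 0 := le_antisymm (ge_of_tendsto' hlim hS) zero_le
  have hm : AEStronglyMeasurable (boundaryValue (blaschke A)) volume :=
    hbv.aestronglyMeasurable h.differentiableOn
  have hm2 : AEMeasurable (fun t : ℝ => ‖((1 - ‖boundaryValue (blaschke A) t‖ : ℝ) : ℂ) *
      hardyKernel t Complex.I‖ₑ ^ 2) :=
    ((Complex.continuous_ofReal.comp_aestronglyMeasurable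
      (aestronglyMeasurable_const.sub hm.norm)).mul
        (memLp_hardyKernel hi.ne').1).enorm.pow_const 2
  rw [lintegral_eq_zero_iff' hm2] at h0
  filter_upwards [h0] with t ht
  have h5 := hardyKernel_ne_zero (z := (t : ℂ)) (by simp) hi
  simp only [Pi.zero_apply, ne_eq, OfNat.ofNat_ne_zero, not_false_eq_true, pow_eq_zero_iff,
    enorm_eq_zero, mul_eq_zero, h5, or_false, Complex.ofReal_eq_zero] at ht
  linarith

end BlaschkeSet

/-- On the line the conjugate of a Blaschke factor is its inverse, so this is the partial fraction
decomposition with simple poles at μ and a. -/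
lemma conj_blaschkeFactor_mul_conj_kernel {a μ : ℂ} (ha : 0 < a.im) (hμ : 0 < μ.im) (h : μ ≠ a)
    (t : ℝ) :
    conj (blaschkeFactor a t) * conj (hardyKernel t μ) =
      (blaschkeFactor a μ)⁻¹ * conj (hardyKernel t μ) +
      ((if a.im ≤ 1 then 1 else -1) * ((a - conj a) / (a - μ))) * conj (hardyKernel t a) := by
  have h1 := sub_ne_zero_of_im ha.ne' t
  have h2 := sub_ne_zero_of_im hμ.ne' t
  have h3 : μ - a ≠ 0 := sub_ne_zero.2 h
  have h4 : a - μ ≠ 0 := sub_ne_zero.2 h.symm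
  have h5 := upper_sub_conj_ne_zero hμ.le ha
  have key : (t - conj a) / (t - a) * (-Complex.I * ((t : ℂ) - μ)⁻¹) =
      ((μ - a) / (μ - conj a))⁻¹ * (-Complex.I * ((t : ℂ) - μ)⁻¹) +
      (a - conj a) / (a - μ) * (-Complex.I * ((t : ℂ) - a)⁻¹) := by
    rw [inv_div]
    have h6 : a - μ = -(μ - a) := by ring
    rw [h6]
    field_simp
    ring
  rw [conj_hardyKernel, conj_hardyKernel]
  unfold blaschkeFactor
  split_ifs
  · simp only [map_div₀, map_sub, Complex.conj_ofReal, Complex.conj_conj, one_mul]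
    exact key
  · simp only [map_neg, map_div₀, map_sub, Complex.conj_ofReal, Complex.conj_conj, inv_neg]
    linear_combination -key

/-- The pairing of a function in the Hardy space with a finite Blaschke product times a kernel,
through its values at the zeros. -/
lemma exists_integral_mul_conj_blaschke (S : Finset ℂ) (hS : ∀ a ∈ S, 0 < a.im) :
    ∀ μ : ℂ, 0 < μ.im → μ ∉ S → ∃ c : ℂ → ℂ, ∀ G g, HardyPair G g →
      ∫ t : ℝ, g t * conj ((∏ a ∈ S, blaschkeFactor a t) * hardyKernel t μ) =
        2 * Real.pi * (G μ / ∏ a ∈ S, blaschkeFactor a μ) + ∑ a ∈ S, c a * G a := by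
  classical
  induction S using Finset.induction_on with
  | empty =>
    intro μ hμ _
    refine ⟨0, fun G g h => ?_⟩
    simpa using h.integral_mul_conj_kernel hμ
  | insert b S hb ih =>
    intro μ hμ hμS
    have hb' := hS b (Finset.mem_insert_self _ _)
    have hS' : ∀ a ∈ S, 0 < a.im := fun a ha => hS a (Finset.mem_insert_of_mem ha)
    have hμb : μ ≠ b := fun h => hμS (by rw [h]; exact Finset.mem_insert_self _ _)
    obtain ⟨c, hc⟩ := ih hS' μ hμ fun h => hμS (Finset.mem_insert_of_mem h)
    -- Splitting off the factor at b produces kernels at both μ and b, so the induction runs over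
    -- all points μ outside the set.
    obtain ⟨c', hc'⟩ := ih hS' b hb' hb
    set β : ℂ := (if b.im ≤ 1 then 1 else -1) * ((b - conj b) / (b - μ)) with hβ
    refine ⟨fun a => if a = b then β * (2 * Real.pi * (1 / ∏ a ∈ S, blaschkeFactor a b))
      else (blaschkeFactor b μ)⁻¹ * c a + β * c' a, fun G g h => ?_⟩
    have hmem : ∀ ν : ℂ, 0 < ν.im →
        MemLp (fun t : ℝ => conj ((∏ a ∈ S, blaschkeFactor a t) * hardyKernel t ν)) 2 volume := by
      intro ν hν
      refine (memLp_hardyKernel hν.ne').of_le ?_ (Eventually.of_forall fun t => ?_)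
      · refine Continuous.aestronglyMeasurable (Complex.continuous_conj.comp (Continuous.mul ?_ ?_))
        · refine continuous_finsetProd _ fun a ha => continuous_iff_continuousAt.2 fun t => ?_
          exact ContinuousAt.comp (g := blaschkeFactor a) (f := fun t : ℝ => (t : ℂ))
            (differentiableAt_blaschkeFactor (hS' a ha) (by simp)).continuousAt
            Complex.continuous_ofReal.continuousAt
        · refine continuous_iff_continuousAt.2 fun t => ?_
          exact ContinuousAt.comp (g := fun z => hardyKernel z ν) (f := fun t : ℝ => (t : ℂ))
            (continuousAt_hardyKernel (by simp) hν) Complex.continuous_ofReal.continuousAt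
      · rw [RCLike.norm_conj, norm_mul, norm_prod, Finset.prod_eq_one, one_mul]
        exact fun a ha => norm_blaschkeFactor_ofReal (hS' a ha) t
    have hpt : ∀ t : ℝ, g t * conj ((∏ a ∈ insert b S, blaschkeFactor a t) * hardyKernel t μ) =
        (blaschkeFactor b μ)⁻¹ * (g t * conj ((∏ a ∈ S, blaschkeFactor a t) * hardyKernel t μ)) +
        β * (g t * conj ((∏ a ∈ S, blaschkeFactor a t) * hardyKernel t b)) := by
      intro t
      have := conj_blaschkeFactor_mul_conj_kernel hb' hμ hμb t
      rw [← hβ] at this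
      rw [Finset.prod_insert hb]
      simp only [map_mul]
      linear_combination (g t * conj (∏ a ∈ S, blaschkeFactor a t)) * this
    simp_rw [hpt]
    rw [integral_add ((integrable_mul_of_memLp_two h.memLp (hmem μ hμ)).const_mul _)
      ((integrable_mul_of_memLp_two h.memLp (hmem b hb')).const_mul _), integral_const_mul,
      integral_const_mul, hc G g h, hc' G g h, Finset.prod_insert hb, Finset.sum_insert hb]
    have hsum : ∑ a ∈ S, (if a = b then β * (2 * Real.pi * (1 / ∏ a ∈ S, blaschkeFactor a b))
        else (blaschkeFactor b μ)⁻¹ * c a + β * c' a) * G a =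
        (blaschkeFactor b μ)⁻¹ * ∑ a ∈ S, c a * G a + β * ∑ a ∈ S, c' a * G a := by
      rw [Finset.mul_sum, Finset.mul_sum, ← Finset.sum_add_distrib]
      refine Finset.sum_congr rfl fun a ha => ?_
      rw [if_neg (show ¬ a = b from fun h => hb (h ▸ ha))]
      ring
    rw [hsum, if_pos rfl, div_mul_eq_div_div, div_eq_mul_inv (G μ)]
    ring

/-! ### The outer function and the Blaschke product of scattering data -/

lemma neg_conj_line (t y : ℝ) : -conj ((t : ℂ) + y * Complex.I) = ((-t : ℝ) : ℂ) + y * Complex.I := by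
  simp [add_comm]

lemma HasBoundaryValues.boundaryValue_neg {F : ℂ → ℂ} {f : ℝ → ℂ} (h : HasBoundaryValues F f)
    (hF : ∀ z, F (-conj z) = conj (F z)) :
    ∀ᵐ t : ℝ, _root_.boundaryValue F (-t) = conj (_root_.boundaryValue F t) := by
  filter_upwards [h.boundaryValue] with t ht
  have h1 : Tendsto (fun y : ℝ => F ((-t : ℝ) + y * Complex.I)) (𝓝[>] 0)
      (𝓝 (conj (_root_.boundaryValue F t))) := by
    refine ((Complex.continuous_conj.tendsto _).comp ht).congr fun y => ?_
    rw [Function.comp_apply, ← hF, neg_conj_line]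
  exact h1.limUnder_eq

lemma ae_neg {p : ℝ → Prop} (h : ∀ᵐ t : ℝ, p t) : ∀ᵐ t : ℝ, p (-t) :=
  (Measure.measurePreserving_neg (volume : Measure ℝ)).quasiMeasurePreserving.ae h

namespace ScatteringData

variable (D : ScatteringData)

/-- The logarithm of the boundary modulus of `s_e`. -/
noncomputable def logModulus (t : ℝ) : ℝ := Real.log (Real.sqrt (1 - ‖D.s t‖ ^ 2))

lemma logModulus_nonpos (t : ℝ) : D.logModulus t ≤ 0 := by
  refine Real.log_nonpos (Real.sqrt_nonneg _) (Real.sqrt_le_one.2 ?_)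
  linarith [sq_nonneg ‖D.s t‖]

lemma one_sub_norm_sq_pos : ∀ᵐ t : ℝ, 0 < 1 - ‖D.s t‖ ^ 2 := by
  filter_upwards [D.norm_lt_one] with t ht
  nlinarith [norm_nonneg (D.s t)]

lemma integrable_logModulus : Integrable fun t => D.logModulus t / (1 + t ^ 2) := by
  refine (D.szego.const_mul (1 / 2)).congr ?_
  filter_upwards [D.one_sub_norm_sq_pos] with t ht
  rw [logModulus, Real.log_sqrt ht.le]
  ring

lemma logModulus_neg : ∀ᵐ t : ℝ, D.logModulus (-t) = D.logModulus t := by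
  filter_upwards [D.symm] with t ht
  unfold logModulus
  rw [ht, RCLike.norm_conj]

lemma outer_ne_zero (z : ℂ) : D.outer z ≠ 0 := outerFn_ne_zero _ z

lemma norm_outer_le_one {z : ℂ} (hz : 0 < z.im) : ‖D.outer z‖ ≤ 1 :=
  (norm_outerFn_le D.integrable_logModulus (M := 0) D.logModulus_nonpos hz).trans_eq Real.exp_zero

lemma isHardyInfty_outer : IsHardyInfty D.outer :=
  isHardyInfty_outerFn D.integrable_logModulus (M := 0) D.logModulus_nonpos

/-- The boundary values of `s_e`. -/
noncomputable def outerLine (t : ℝ) : ℂ := boundaryValue D.outer t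

lemma hasBoundaryValues_outer : HasBoundaryValues D.outer D.outerLine :=
  D.isHardyInfty_outer.hasBoundaryValues

lemma aestronglyMeasurable_outerLine : AEStronglyMeasurable D.outerLine volume :=
  D.hasBoundaryValues_outer.aestronglyMeasurable D.isHardyInfty_outer.1

lemma norm_outerLine : ∀ᵐ t : ℝ, ‖D.outerLine t‖ = Real.sqrt (1 - ‖D.s t‖ ^ 2) := by
  filter_upwards [D.hasBoundaryValues_outer, ae_tendsto_norm_outerFn D.integrable_logModulus,
    D.one_sub_norm_sq_pos] with t h1 h2 h3
  rw [tendsto_nhds_unique h1.norm h2, logModulus, Real.exp_log (Real.sqrt_pos.2 h3)]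

lemma outerLine_ne_zero : ∀ᵐ t : ℝ, D.outerLine t ≠ 0 := by
  filter_upwards [D.norm_outerLine, D.one_sub_norm_sq_pos] with t h1 h2
  rw [← norm_ne_zero_iff, h1]
  exact (Real.sqrt_pos.2 h2).ne'

lemma outerLine_mul_conj : ∀ᵐ t : ℝ, D.outerLine t * conj (D.outerLine t) = 1 - D.s t * conj (D.s t) := by
  filter_upwards [D.norm_outerLine, D.one_sub_norm_sq_pos] with t h1 h2
  rw [Complex.mul_conj', Complex.mul_conj', h1, ← Complex.ofReal_pow, Real.sq_sqrt h2.le]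
  push_cast; ring

lemma norm_outerLine_le_one : ∀ᵐ t : ℝ, ‖D.outerLine t‖ ≤ 1 :=
  D.hasBoundaryValues_outer.norm_le fun _ hz => D.norm_outer_le_one hz

lemma outer_neg_conj (z : ℂ) : D.outer (-conj z) = conj (D.outer z) :=
  outerFn_neg_conj D.logModulus_neg z

lemma outerLine_neg : ∀ᵐ t : ℝ, D.outerLine (-t) = conj (D.outerLine t) :=
  D.hasBoundaryValues_outer.boundaryValue_neg D.outer_neg_conj

lemma s_neg : ∀ᵐ t : ℝ, D.s (-t) = conj (D.s t) := by
  filter_upwards [D.symm] with t ht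
  rw [ht, Complex.conj_conj]

/-- Bounded holomorphic functions whose products with `s_e` tend to `1`. -/
noncomputable def outerInv (n : ℕ) : ℂ → ℂ := outerInvApprox D.logModulus n

lemma isHardyInfty_outerInv (n : ℕ) : IsHardyInfty (D.outerInv n) :=
  isHardyInfty_outerInvApprox D.logModulus_nonpos D.integrable_logModulus n

lemma norm_outer_mul_outerInv_le (n : ℕ) {z : ℂ} (hz : 0 < z.im) :
    ‖D.outer z * D.outerInv n z‖ ≤ 1 :=
  norm_outerFn_mul_outerInvApprox_le D.logModulus_nonpos D.integrable_logModulus n hz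

lemma tendsto_outer_mul_outerInv {z : ℂ} (hz : 0 < z.im) :
    Tendsto (fun n => D.outer z * D.outerInv n z) atTop (𝓝 1) :=
  tendsto_outerFn_mul_outerInvApprox D.logModulus_nonpos D.integrable_logModulus hz

lemma norm_twist_s (x t : ℝ) : ‖(D.twist x).s t‖ = ‖D.s t‖ := by
  simp [twist, Complex.norm_exp]

lemma outer_twist (x : ℝ) : (D.twist x).outer = D.outer := by
  unfold outer
  simp_rw [D.norm_twist_s x]

lemma outerLine_twist (x : ℝ) : (D.twist x).outerLine = D.outerLine := by
  unfold outerLine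
  rw [D.outer_twist]

lemma blaschkeSet : BlaschkeSet D.Λ := by
  refine ⟨D.mem_imag, ?_⟩
  have h1 := (summable_subtype_iff_indicator (s := {l : ℂ | l ∈ D.Λ ∧ l.im ≤ 1})).1 D.blaschke_small
  have h2 := (summable_subtype_iff_indicator (f := fun l : ℂ => 1 / l.im)
    (s := {l : ℂ | l ∈ D.Λ ∧ 1 < l.im})).1 D.blaschke_large
  refine (h1.add h2).congr fun a => ?_
  by_cases ha : a ∈ D.Λ
  · have hpos := (D.mem_imag a ha).2
    rcases le_or_gt a.im 1 with h | h
    · rw [Set.indicator_of_mem ha, Set.indicator_of_mem (s := {l : ℂ | l ∈ D.Λ ∧ l.im ≤ 1}) ⟨ha, h⟩,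
        Set.indicator_of_notMem (s := {l : ℂ | l ∈ D.Λ ∧ 1 < l.im}) fun h' => not_lt.2 h h'.2,
        min_eq_left (h.trans (one_le_inv_iff₀.2 ⟨hpos, h⟩)), add_zero]
    · rw [Set.indicator_of_mem ha,
        Set.indicator_of_notMem (s := {l : ℂ | l ∈ D.Λ ∧ l.im ≤ 1}) fun h' => not_le.2 h h'.2,
        Set.indicator_of_mem (s := {l : ℂ | l ∈ D.Λ ∧ 1 < l.im}) ⟨ha, h⟩,
        min_eq_right ((inv_le_one_of_one_le₀ h.le).trans h.le), zero_add, one_div]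
  · rw [Set.indicator_of_notMem ha, Set.indicator_of_notMem (fun h' => ha h'.1),
      Set.indicator_of_notMem (fun h' => ha h'.1), add_zero]

/-! ### The space as a subspace of a Hilbert space -/

/-- The two components of a function on the real line whose squared moduli add up to the density
of its norm. -/
noncomputable def diagPart (f : ℂ → ℂ) (t : ℝ) : ℂ := Real.sqrt (1 - ‖D.s t‖ ^ 2) * f t

/-- See `ScatteringData.diagPart`. -/
noncomputable def reflPart (f : ℂ → ℂ) (t : ℝ) : ℂ := f (-t) - D.s t * f t

/-- Completing the square in f(-t): the remainder has coefficient 1 - |s₊|² = |s_e|². In particular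
the form is positive, and s_e f is controlled by the norm. -/
lemma form_eq (f g : ℂ → ℂ) : ∀ᵐ t : ℝ, D.form f g t =
    D.reflPart f t * conj (D.reflPart g t) + D.diagPart f t * conj (D.diagPart g t) := by
  filter_upwards [D.one_sub_norm_sq_pos] with t ht
  have h1 : ((Real.sqrt (1 - ‖D.s t‖ ^ 2) : ℝ) : ℂ) * (Real.sqrt (1 - ‖D.s t‖ ^ 2) : ℝ) =
      1 - D.s t * conj (D.s t) := by
    rw [← Complex.ofReal_mul, Real.mul_self_sqrt ht.le, Complex.mul_conj']
    push_cast; ring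
  simp only [form, reflPart, diagPart, map_sub, map_mul, Complex.conj_ofReal]
  simp [Matrix.mulVec, dotProduct, Fin.sum_univ_two]
  linear_combination -(f t * conj (g t)) * h1

lemma form_self_re (f : ℂ → ℂ) : ∀ᵐ t : ℝ, ENNReal.ofReal (D.form f f t).re =
    ‖D.reflPart f t‖ₑ ^ 2 + ‖D.diagPart f t‖ₑ ^ 2 := by
  filter_upwards [D.form_eq f f] with t ht
  rw [ht, Complex.mul_conj', Complex.mul_conj', ← Complex.ofReal_pow, ← Complex.ofReal_pow,
    ← Complex.ofReal_add, Complex.ofReal_re, ENNReal.ofReal_add (by positivity) (by positivity),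
    ENNReal.ofReal_pow (norm_nonneg _), ENNReal.ofReal_pow (norm_nonneg _), ofReal_norm, ofReal_norm]

variable {D}

lemma aestronglyMeasurable_neg {f : ℝ → ℂ} (hf : AEStronglyMeasurable f volume) :
    AEStronglyMeasurable (fun t => f (-t)) volume :=
  hf.comp_measurePreserving (Measure.measurePreserving_neg _)

lemma aestronglyMeasurable_diagPart {f : ℂ → ℂ}
    (hf : AEStronglyMeasurable (fun t : ℝ => f t) volume) :
    AEStronglyMeasurable (D.diagPart f) volume := by
  refine AEStronglyMeasurable.mul ?_ hf
  have h1 : AEStronglyMeasurable (fun t => 1 - ‖D.s t‖ ^ 2) volume :=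
    aestronglyMeasurable_const.sub (D.aestronglyMeasurable.norm.pow 2)
  exact (Complex.continuous_ofReal.comp Real.continuous_sqrt).comp_aestronglyMeasurable h1

lemma aestronglyMeasurable_reflPart {f : ℂ → ℂ}
    (hf : AEStronglyMeasurable (fun t : ℝ => f t) volume) :
    AEStronglyMeasurable (D.reflPart f) volume := by
  have h1 := aestronglyMeasurable_neg hf
  push_cast at h1
  exact h1.sub (D.aestronglyMeasurable.mul hf)

lemma normSq_eq {f : ℂ → ℂ} (hf : AEStronglyMeasurable (fun t : ℝ => f t) volume) :
    D.normSq f = (∑' l : D.Λ, ENNReal.ofReal (‖f l‖ ^ 2 * D.ν l)) +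
      ENNReal.ofReal (1 / (4 * Real.pi)) *
        (eLpNorm (D.reflPart f) 2 volume ^ 2 + eLpNorm (D.diagPart f) 2 volume ^ 2) := by
  unfold normSq
  rw [lintegral_congr_ae (D.form_self_re f), lintegral_add_left'
    ((aestronglyMeasurable_reflPart hf).enorm.pow_const 2), eLpNorm_two_sq, eLpNorm_two_sq]

lemma memL2_iff {f : ℂ → ℂ} : D.MemL2 f ↔ AEStronglyMeasurable (fun t : ℝ => f t) volume ∧
    Memℓp (fun l : D.Λ => f l * (Real.sqrt (D.ν l) : ℂ)) 2 ∧
    MemLp (D.reflPart f) 2 volume ∧ MemLp (D.diagPart f) 2 volume := by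
  have hsum : (∑' l : D.Λ, ENNReal.ofReal (‖f l‖ ^ 2 * D.ν l)) < ∞ ↔
      Memℓp (fun l : D.Λ => f l * (Real.sqrt (D.ν l) : ℂ)) 2 := by
    rw [memℓp_gen_iff (by simp)]
    have h1 : ∀ l : D.Λ, ‖f l * (Real.sqrt (D.ν l) : ℂ)‖ ^ (2 : ℝ≥0∞).toReal = ‖f l‖ ^ 2 * D.ν l := by
      intro l
      rw [norm_mul, Complex.norm_real, Real.norm_of_nonneg (Real.sqrt_nonneg _)]
      simp only [ENNReal.toReal_ofNat, Real.rpow_ofNat, mul_pow]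
      rw [Real.sq_sqrt (D.ν_pos l l.2).le]
    simp_rw [h1]
    rw [lt_top_iff_ne_top]
    refine ⟨fun h => ?_, fun h => h.tsum_ofReal_ne_top⟩
    refine (ENNReal.summable_toReal h).congr fun l => ?_
    rw [ENNReal.toReal_ofReal (mul_nonneg (sq_nonneg _) (D.ν_pos l l.2).le)]
  have hpi : ENNReal.ofReal (1 / (4 * Real.pi)) ≠ 0 := by
    simp only [ne_eq, ENNReal.ofReal_eq_zero, not_le]
    have := Real.pi_pos
    positivity
  unfold MemL2
  refine and_congr_right fun hm => ?_
  rw [normSq_eq hm, ENNReal.add_lt_top, hsum, ← hsum]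
  refine and_congr_right fun _ => ?_
  rw [ENNReal.mul_lt_top_iff]
  simp only [ENNReal.ofReal_lt_top, true_and, hpi, false_or]
  constructor
  · rintro (h | h)
    · rw [ENNReal.add_lt_top] at h
      exact ⟨⟨aestronglyMeasurable_reflPart hm, (ENNReal.pow_lt_top_iff.1 h.1).resolve_right (by simp)⟩,
        ⟨aestronglyMeasurable_diagPart hm, (ENNReal.pow_lt_top_iff.1 h.2).resolve_right (by simp)⟩⟩
    · rw [add_eq_zero] at h
      simp only [ne_eq, OfNat.ofNat_ne_zero, not_false_eq_true, pow_eq_zero_iff] at h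
      exact ⟨⟨aestronglyMeasurable_reflPart hm, by simp [h.1]⟩,
        ⟨aestronglyMeasurable_diagPart hm, by simp [h.2]⟩⟩
  · rintro ⟨h1, h2⟩
    exact Or.inl (ENNReal.add_lt_top.2 ⟨ENNReal.pow_lt_top h1.2, ENNReal.pow_lt_top h2.2⟩)

lemma reflPart_add (f g : ℂ → ℂ) : D.reflPart (f + g) = D.reflPart f + D.reflPart g := by
  ext t; simp only [reflPart, Pi.add_apply]; ring

lemma reflPart_smul (c : ℂ) (f : ℂ → ℂ) : D.reflPart (c • f) = c • D.reflPart f := by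
  ext t; simp only [reflPart, Pi.smul_apply, smul_eq_mul]; ring

lemma diagPart_add (f g : ℂ → ℂ) : D.diagPart (f + g) = D.diagPart f + D.diagPart g := by
  ext t; simp only [diagPart, Pi.add_apply]; ring

lemma diagPart_smul (c : ℂ) (f : ℂ → ℂ) : D.diagPart (c • f) = c • D.diagPart f := by
  ext t; simp only [diagPart, Pi.smul_apply, smul_eq_mul]; ring

variable (D)

/-- The functions in `L²_{s₊,ν₊}` as a linear space. -/
def memL2Submodule : Submodule ℂ (ℂ → ℂ) where
  carrier := {f | D.MemL2 f}
  zero_mem' := memL2_iff.2 ⟨aestronglyMeasurable_const, by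
    simpa using! (zero_memℓp : Memℓp (0 : D.Λ → ℂ) 2), by
      have : D.reflPart 0 = 0 := by ext t; simp [reflPart]
      rw [this]; exact MemLp.zero, by
      have : D.diagPart 0 = 0 := by ext t; simp [diagPart]
      rw [this]; exact MemLp.zero⟩
  add_mem' {f g} hf hg := by
    obtain ⟨h1, h2, h3, h4⟩ := memL2_iff.1 hf
    obtain ⟨h1', h2', h3', h4'⟩ := memL2_iff.1 hg
    refine memL2_iff.2 ⟨h1.add h1', ?_, ?_, ?_⟩
    · have := h2.add h2'
      convert this using 1
      ext l; simp [add_mul]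
    · rw [reflPart_add]; exact h3.add h3'
    · rw [diagPart_add]; exact h4.add h4'
  smul_mem' c f hf := by
    obtain ⟨h1, h2, h3, h4⟩ := memL2_iff.1 hf
    refine memL2_iff.2 ⟨h1.const_smul c, ?_, ?_, ?_⟩
    · have := h2.const_smul c
      convert this using 1
      ext l; simp [mul_assoc]
    · rw [reflPart_smul]; exact h3.const_smul c
    · rw [diagPart_smul]; exact h4.const_smul c

/-- The Hilbert space which contains `L²_{s₊,ν₊}`. -/
abbrev Ambient : Type :=
  WithLp 2 (lp (fun _ : D.Λ => ℂ) 2 × WithLp 2 (Lp ℂ 2 (volume : Measure ℝ) × Lp ℂ 2 (volume : Measure ℝ)))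

/-- The normalizing factor `(4π)^{-1/2}`. -/
noncomputable def normFactor : ℂ := ((Real.sqrt (4 * Real.pi))⁻¹ : ℝ)

/-- The values on `Λ`, with weights. -/
noncomputable def embedΛ : D.memL2Submodule →ₗ[ℂ] lp (fun _ : D.Λ => ℂ) 2 where
  toFun f := ⟨_, (memL2_iff.1 f.2).2.1⟩
  map_add' _ _ := lp.ext (funext fun _ => add_mul _ _ _)
  map_smul' _ _ := lp.ext (funext fun _ => mul_assoc _ _ _)

/-- `ScatteringData.reflPart` as an element of `L²`. -/
noncomputable def embedRefl : D.memL2Submodule →ₗ[ℂ] Lp ℂ 2 (volume : Measure ℝ) where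
  toFun f := (memL2_iff.1 f.2).2.2.1.toLp _
  map_add' f g := by
    refine (MemLp.toLp_congr _ _ (Eventually.of_forall fun t => ?_)).trans (MemLp.toLp_add _ _)
    exact congrFun (reflPart_add f.1 g.1) t
  map_smul' c f := by
    refine (MemLp.toLp_congr _ _ (Eventually.of_forall fun t => ?_)).trans (MemLp.toLp_const_smul _ _)
    exact congrFun (reflPart_smul c f.1) t

/-- `ScatteringData.diagPart` as an element of `L²`. -/
noncomputable def embedDiag : D.memL2Submodule →ₗ[ℂ] Lp ℂ 2 (volume : Measure ℝ) where
  toFun f := (memL2_iff.1 f.2).2.2.2.toLp _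
  map_add' f g := by
    refine (MemLp.toLp_congr _ _ (Eventually.of_forall fun t => ?_)).trans (MemLp.toLp_add _ _)
    exact congrFun (diagPart_add f.1 g.1) t
  map_smul' c f := by
    refine (MemLp.toLp_congr _ _ (Eventually.of_forall fun t => ?_)).trans (MemLp.toLp_const_smul _ _)
    exact congrFun (diagPart_smul c f.1) t

/-- The isometric embedding of `L²_{s₊,ν₊}`. -/
noncomputable def embed : D.memL2Submodule →ₗ[ℂ] D.Ambient :=
  (WithLp.linearEquiv 2 ℂ _).symm.toLinearMap ∘ₗ D.embedΛ.prod
    ((WithLp.linearEquiv 2 ℂ _).symm.toLinearMap ∘ₗ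
      (normFactor • D.embedRefl).prod (normFactor • D.embedDiag))

lemma embed_apply (f : D.memL2Submodule) : D.embed f = WithLp.toLp 2 (D.embedΛ f,
    WithLp.toLp 2 (normFactor • D.embedRefl f, normFactor • D.embedDiag f)) := rfl

lemma embedΛ_apply (f : D.memL2Submodule) (l : D.Λ) :
    D.embedΛ f l = f.1 l * (Real.sqrt (D.ν l) : ℂ) := rfl

lemma norm_embedΛ_apply_sq (f : D.memL2Submodule) (l : D.Λ) :
    ‖D.embedΛ f l‖ ^ 2 = ‖f.1 l‖ ^ 2 * D.ν l := by
  rw [embedΛ_apply, norm_mul, Complex.norm_real, Real.norm_of_nonneg (Real.sqrt_nonneg _), mul_pow,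
    Real.sq_sqrt (D.ν_pos l l.2).le]

variable {D}

lemma normFactor_mul_conj : normFactor * conj normFactor = 1 / (4 * Real.pi) := by
  unfold normFactor
  rw [Complex.conj_ofReal, ← Complex.ofReal_mul, ← mul_inv, Real.mul_self_sqrt
    (by have := Real.pi_pos; positivity)]
  push_cast; ring

lemma norm_normFactor_sq : ‖normFactor‖ ^ 2 = 1 / (4 * Real.pi) := by
  have hpi := Real.pi_pos
  unfold normFactor
  rw [Complex.norm_real, Real.norm_of_nonneg (by positivity), inv_pow,
    Real.sq_sqrt (by positivity), one_div]

lemma inner_embed (f g : D.memL2Submodule) :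
    inner ℂ (D.embed g) (D.embed f) = D.scalar f g := by
  obtain ⟨-, -, h3, h4⟩ := memL2_iff.1 f.2
  obtain ⟨-, -, h3', h4'⟩ := memL2_iff.1 g.2
  rw [embed_apply, embed_apply, WithLp.prod_inner_apply, WithLp.prod_inner_apply]
  simp only [inner_smul_left, inner_smul_right]
  have e1 : inner ℂ (D.embedRefl g) (D.embedRefl f) = _ := inner_toLp h3' h3
  have e2 : inner ℂ (D.embedDiag g) (D.embedDiag f) = _ := inner_toLp h4' h4
  rw [e1, e2]
  unfold scalar
  congr 1
  · rw [lp.inner_eq_tsum]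
    refine tsum_congr fun l => ?_
    rw [embedΛ_apply, embedΛ_apply]
    simp only [RCLike.inner_apply, map_mul, Complex.conj_ofReal]
    have : ((Real.sqrt (D.ν l) : ℝ) : ℂ) * (Real.sqrt (D.ν l) : ℝ) = D.ν l := by
      rw [← Complex.ofReal_mul, Real.mul_self_sqrt (D.ν_pos l l.2).le]
    linear_combination (f.1 l * conj (g.1 l)) * this
  · rw [integral_congr_ae (D.form_eq f g), integral_add, ← normFactor_mul_conj]
    · ring
    · exact integrable_mul_of_memLp_two h3 h3'.star
    · exact integrable_mul_of_memLp_two h4 h4'.star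

lemma normSq_embed (f : D.memL2Submodule) : D.normSq f = ENNReal.ofReal (‖D.embed f‖ ^ 2) := by
  obtain ⟨h1, h2, h3, h4⟩ := memL2_iff.1 f.2
  have hpi := Real.pi_pos
  have hL : ∀ (g : ℝ → ℂ) (hg : MemLp g 2 volume),
      ENNReal.ofReal (‖normFactor • hg.toLp g‖ ^ 2) =
        ENNReal.ofReal (1 / (4 * Real.pi)) * eLpNorm g 2 volume ^ 2 := by
    intro g hg
    rw [norm_smul, mul_pow, norm_normFactor_sq, ENNReal.ofReal_mul (by positivity),
      ENNReal.ofReal_pow (norm_nonneg _), ofReal_norm, Lp.enorm_toLp]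
  rw [normSq_eq h1, embed_apply, WithLp.prod_norm_sq_eq_of_L2,
    ENNReal.ofReal_add (by positivity) (by positivity), WithLp.prod_norm_sq_eq_of_L2,
    ENNReal.ofReal_add (by positivity) (by positivity), mul_add]
  congr 1
  · have h5 := lp.norm_rpow_eq_tsum (p := 2) (by simp) (D.embedΛ f)
    simp only [ENNReal.toReal_ofNat, Real.rpow_ofNat, norm_embedΛ_apply_sq] at h5
    change _ = ENNReal.ofReal (‖D.embedΛ f‖ ^ 2)
    rw [h5, ENNReal.ofReal_tsum_of_nonneg (fun l : D.Λ => mul_nonneg (sq_nonneg _) (D.ν_pos l l.2).le)]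
    refine ((memℓp_gen_iff (by simp)).1 h2).congr fun l => ?_
    simp only [ENNReal.toReal_ofNat, Real.rpow_ofNat]
    exact norm_embedΛ_apply_sq D f l
  · exact congrArg₂ (· + ·) (hL _ h3).symm (hL _ h4).symm

end ScatteringData

lemma eLpNorm_comp_neg {f : ℝ → ℂ} (hf : AEStronglyMeasurable f volume) :
    eLpNorm (fun t => f (-t)) 2 volume = eLpNorm f 2 volume :=
  eLpNorm_comp_measurePreserving hf (Measure.measurePreserving_neg _)

lemma memLp_comp_neg {f : ℝ → ℂ} (hf : MemLp f 2 volume) : MemLp (fun t => f (-t)) 2 volume :=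
  hf.comp_measurePreserving (Measure.measurePreserving_neg _)

namespace ScatteringData

variable {D : ScatteringData}

/-! ### Norm estimates -/

lemma norm_s_le_one : ∀ᵐ t : ℝ, ‖D.s t‖ ≤ 1 := by
  filter_upwards [D.norm_lt_one] with t ht using ht.le

lemma eLpNorm_outerLine_mul (f : ℂ → ℂ) :
    eLpNorm (fun t : ℝ => D.outerLine t * f t) 2 volume = eLpNorm (D.diagPart f) 2 volume := by
  refine eLpNorm_congr_norm_ae ?_
  filter_upwards [D.norm_outerLine] with t ht
  rw [diagPart, norm_mul, norm_mul, ht, Complex.norm_real, Real.norm_of_nonneg (Real.sqrt_nonneg _)]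

/-- The diagonal component has the modulus of s_e f. This inequality makes evaluations in the upper
half-plane bounded on `Ĥ²`. -/
lemma eLpNorm_outerLine_mul_sq_le {f : ℂ → ℂ} (hf : AEStronglyMeasurable (fun t : ℝ => f t) volume) :
    eLpNorm (fun t : ℝ => D.outerLine t * f t) 2 volume ^ 2 ≤
      ENNReal.ofReal (4 * Real.pi) * D.normSq f := by
  have hpi := Real.pi_pos
  rw [eLpNorm_outerLine_mul, normSq_eq hf, mul_add, ← mul_assoc,
    ← ENNReal.ofReal_mul (by positivity), mul_one_div_cancel (by positivity), ENNReal.ofReal_one,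
    one_mul]
  exact le_add_self.trans le_add_self

lemma memLp_outerLine_mul {f : ℂ → ℂ} (hf : D.MemL2 f) :
    MemLp (fun t : ℝ => D.outerLine t * f t) 2 volume :=
  ⟨D.aestronglyMeasurable_outerLine.mul hf.1,
    by rw [eLpNorm_outerLine_mul]; exact (memL2_iff.1 hf).2.2.2.2⟩

lemma ofReal_norm_sq_mul_le_normSq (f : ℂ → ℂ) {l : ℂ} (hl : l ∈ D.Λ) :
    ENNReal.ofReal (‖f l‖ ^ 2 * D.ν l) ≤ D.normSq f :=
  (ENNReal.le_tsum (f := fun l : D.Λ => ENNReal.ofReal (‖f l‖ ^ 2 * D.ν l)) ⟨l, hl⟩).trans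
    le_self_add

lemma eLpNorm_diagPart_le (f : ℂ → ℂ) :
    eLpNorm (D.diagPart f) 2 volume ≤ eLpNorm (fun t : ℝ => f t) 2 volume := by
  refine eLpNorm_mono fun t => ?_
  rw [diagPart, norm_mul, Complex.norm_real, Real.norm_of_nonneg (Real.sqrt_nonneg _)]
  refine mul_le_of_le_one_left (norm_nonneg _) (Real.sqrt_le_one.2 ?_)
  linarith [sq_nonneg ‖D.s t‖]

lemma eLpNorm_reflPart_le {f : ℂ → ℂ} (hf : AEStronglyMeasurable (fun t : ℝ => f t) volume) :
    eLpNorm (D.reflPart f) 2 volume ≤ 2 * eLpNorm (fun t : ℝ => f t) 2 volume := by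
  have h1 := aestronglyMeasurable_neg hf
  have h2 := eLpNorm_comp_neg hf
  push_cast at h1 h2
  rw [two_mul]
  refine (eLpNorm_sub_le (f := fun t : ℝ => f (-t)) (g := fun t : ℝ => D.s t * f t) h1
    (D.aestronglyMeasurable.mul hf) one_le_two).trans (add_le_add h2.le ?_)
  refine eLpNorm_mono_ae ?_
  filter_upwards [D.norm_s_le_one] with t ht
  rw [norm_mul]
  exact mul_le_of_le_one_left (norm_nonneg _) ht

/-- The two squares add up to at most 8c², and 4π > 8. -/
lemma ofReal_mul_add_sq_le {a b c : ℝ≥0∞} (ha : a ≤ 2 * c) (hb : b ≤ 2 * c) :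
    ENNReal.ofReal (1 / (4 * Real.pi)) * (a ^ 2 + b ^ 2) ≤ c ^ 2 := by
  have hpi := Real.pi_gt_three
  calc ENNReal.ofReal (1 / (4 * Real.pi)) * (a ^ 2 + b ^ 2)
      ≤ ENNReal.ofReal (1 / 8) * ((2 * c) ^ 2 + (2 * c) ^ 2) := by
        gcongr
        linarith
    _ = ENNReal.ofReal (1 / 8) * 8 * c ^ 2 := by ring
    _ = c ^ 2 := by
        have : (8 : ℝ≥0∞) = ENNReal.ofReal 8 := by simp
        rw [this, ← ENNReal.ofReal_mul (by norm_num)]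
        norm_num

lemma normSq_le {f : ℂ → ℂ} (hf : AEStronglyMeasurable (fun t : ℝ => f t) volume) :
    D.normSq f ≤ (∑' l : D.Λ, ENNReal.ofReal (‖f l‖ ^ 2 * D.ν l)) +
      eLpNorm (fun t : ℝ => f t) 2 volume ^ 2 := by
  rw [normSq_eq hf]
  gcongr
  refine ofReal_mul_add_sq_le (eLpNorm_reflPart_le hf) ((eLpNorm_diagPart_le f).trans ?_)
  rw [two_mul]
  exact le_self_add

lemma tsum_ofReal_lt_top_of_finset {f : ℂ → ℂ} (S : Finset ℂ) (hS : ∀ l ∈ D.Λ, l ∉ S → f l = 0) :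
    ∑' l : D.Λ, ENNReal.ofReal (‖f l‖ ^ 2 * D.ν l) ≤
      ∑ l ∈ S, ENNReal.ofReal (‖f l‖ ^ 2 * D.ν l) := by
  rw [tsum_subtype D.Λ fun l => ENNReal.ofReal (‖f l‖ ^ 2 * D.ν l), tsum_eq_sum (s := S)]
  · exact Finset.sum_le_sum fun l _ => Set.indicator_le_self _ _ _
  · intro l hl
    by_cases hΛ : l ∈ D.Λ
    · simp [hΛ, hS l hΛ hl]
    · simp [hΛ]

lemma memL2_of_memLp {f : ℂ → ℂ} (hf : MemLp (fun t : ℝ => f t) 2 volume) (S : Finset ℂ)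
    (hS : ∀ l ∈ D.Λ, l ∉ S → f l = 0) : D.MemL2 f := by
  refine ⟨hf.1, (normSq_le hf.1).trans_lt (ENNReal.add_lt_top.2 ⟨?_, ENNReal.pow_lt_top hf.2⟩)⟩
  exact (tsum_ofReal_lt_top_of_finset S hS).trans_lt
    (ENNReal.sum_lt_top.2 fun _ _ => ENNReal.ofReal_lt_top)

lemma normSq_le_of_eq_zero {f : ℂ → ℂ} (hf : AEStronglyMeasurable (fun t : ℝ => f t) volume)
    (h : ∀ l ∈ D.Λ, f l = 0) : D.normSq f ≤ eLpNorm (fun t : ℝ => f t) 2 volume ^ 2 := by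
  refine (normSq_le hf).trans_eq ?_
  rw [(ENNReal.tsum_eq_zero).2 fun l : D.Λ => by simp [h l l.2], zero_add]

/-- Equality in the ambient space determines the function on ℝ ∪ Λ, since s_e is nonzero almost
everywhere and the masses are positive. -/
lemma ae_eq_of_embed_eq {f g : D.memL2Submodule} (h : D.embed f = D.embed g) :
    (∀ᵐ t : ℝ, f.1 t = g.1 t) ∧ ∀ l ∈ D.Λ, f.1 l = g.1 l := by
  have h0 : D.normSq (f - g : D.memL2Submodule) = 0 := by
    rw [normSq_embed, map_sub, h, sub_self]; simp
  constructor
  · have h1 := eLpNorm_outerLine_mul_sq_le (D := D) (f - g).2.1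
    rw [h0, mul_zero, nonpos_iff_eq_zero, pow_eq_zero_iff two_ne_zero,
      eLpNorm_eq_zero_iff (memLp_outerLine_mul (f - g).2).1 two_ne_zero] at h1
    filter_upwards [h1, D.outerLine_ne_zero] with t h2 h3
    simpa [h3, sub_eq_zero] using h2
  · intro l hl
    have h1 := ofReal_norm_sq_mul_le_normSq (D := D) (f - g : D.memL2Submodule) hl
    rw [h0, nonpos_iff_eq_zero, ENNReal.ofReal_eq_zero] at h1
    have h2 := D.ν_pos l hl
    have h3 : ‖(f - g : D.memL2Submodule).1 l‖ ^ 2 = 0 := by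
      by_contra hne
      have : 0 < ‖(f - g : D.memL2Submodule).1 l‖ ^ 2 := lt_of_le_of_ne (sq_nonneg _) (Ne.symm hne)
      nlinarith [mul_pos this h2]
    simpa [sub_eq_zero] using h3

/-! ### The two Hardy spaces -/

lemma isOuterMultiple_iff {f G : ℂ → ℂ} :
    D.IsOuterMultiple f G ↔ HardyPair G fun t => D.outerLine t * f t :=
  ⟨fun h => ⟨h.1, h.2⟩, fun h => ⟨h.hardy, h.bv⟩⟩

lemma mem_hatH2_iff {f : ℂ → ℂ} : f ∈ D.hatH2 ↔ D.MemL2 f ∧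
    ∃ G, HardyPair G (fun t => D.outerLine t * f t) ∧ ∀ l ∈ D.Λ, f l = G l / D.outer l := by
  simp only [hatH2, isOuterMultiple_iff]
  rfl

lemma mem_hatH2_congr {f g : ℂ → ℂ} (hf : f ∈ D.hatH2) (hg : D.MemL2 g)
    (h1 : ∀ᵐ t : ℝ, f t = g t) (h2 : ∀ l ∈ D.Λ, f l = g l) : g ∈ D.hatH2 := by
  obtain ⟨-, G, hG, hl⟩ := mem_hatH2_iff.1 hf
  refine mem_hatH2_iff.2 ⟨hg, G, hG.congr_ae ?_, fun l hl' => by rw [← h2 l hl', hl l hl']⟩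
  filter_upwards [h1] with t ht
  rw [ht]

variable (D)

/-- The space `Ĥ²` as a linear space. -/
def hatSubmodule : Submodule ℂ D.memL2Submodule where
  carrier := {f | f.1 ∈ D.hatH2}
  zero_mem' := mem_hatH2_iff.2 ⟨D.memL2Submodule.zero_mem, fun _ => 0,
    by simpa using HardyPair.zero, fun l _ => by simp⟩
  add_mem' {f g} hf hg := by
    obtain ⟨-, F, hF, hFl⟩ := mem_hatH2_iff.1 hf
    obtain ⟨-, G, hG, hGl⟩ := mem_hatH2_iff.1 hg
    refine mem_hatH2_iff.2 ⟨(f + g).2, fun z => F z + G z, ?_, fun l hl => ?_⟩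
    · refine (hF.add hG).congr_ae (Eventually.of_forall fun t => ?_)
      simp [mul_add]
    · simp [hFl l hl, hGl l hl, add_div]
  smul_mem' c f hf := by
    obtain ⟨-, F, hF, hFl⟩ := mem_hatH2_iff.1 hf
    refine mem_hatH2_iff.2 ⟨(c • f).2, fun z => c * F z, ?_, fun l hl => ?_⟩
    · refine (hF.const_mul c).congr_ae (Eventually.of_forall fun t => ?_)
      simp only [Submodule.coe_smul, Pi.smul_apply, smul_eq_mul]
      ring
    · simp [hFl l hl, mul_div_assoc]

variable {D}

lemma isHardyInfty_blaschke_inter (A : Set ℂ) (hA : A ⊆ D.Λ) : IsHardyInfty (blaschke A) :=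
  (D.blaschkeSet.mono hA).isHardyInfty

/-- Finitely many Blaschke factors are moved from B' into the bounded factor; this lets two
generators share one divisor and be added. -/
lemma exists_generator_of_subset {S S' : Finset ℂ} (h : S ⊆ S') {f g : ℂ → ℂ}
    (hg : IsHardyInfty g) (hg' : IsHardyTwo g)
    (hb : HasBoundaryValues (fun z => blaschke (D.Λ \ S) z * g z) fun t => f t)
    (hl : ∀ l ∈ D.Λ, f l = blaschke (D.Λ \ S) l * g l) :
    ∃ g', IsHardyInfty g' ∧ IsHardyTwo g' ∧
      HasBoundaryValues (fun z => blaschke (D.Λ \ S') z * g' z) (fun t => f t) ∧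
      ∀ l ∈ D.Λ, f l = blaschke (D.Λ \ S') l * g' l := by
  set A : Set ℂ := (D.Λ \ S) ∩ S' with hA
  have hAB : IsHardyInfty (blaschke A) :=
    isHardyInfty_blaschke_inter A fun l hl => hl.1.1
  have hS : ∀ z : ℂ, 0 < z.im → blaschke (D.Λ \ S) z * g z =
      blaschke (D.Λ \ S') z * (blaschke A z * g z) := by
    intro z hz
    have h1 : D.Λ \ S = (D.Λ \ S') ∪ A := by
      ext l
      simp only [hA, Set.mem_sdiff, Set.mem_union, Set.mem_inter_iff, Finset.mem_coe]
      constructor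
      · rintro ⟨h1, h2⟩
        by_cases h3 : l ∈ S'
        · exact Or.inr ⟨⟨h1, h2⟩, h3⟩
        · exact Or.inl ⟨h1, h3⟩
      · rintro (⟨h1, h2⟩ | ⟨h1, -⟩)
        · exact ⟨h1, fun h3 => h2 (h h3)⟩
        · exact h1
    rw [h1, BlaschkeSet.blaschke_union (D.blaschkeSet.mono Set.sdiff_subset)
      (D.blaschkeSet.mono fun l hl => hl.1.1) ?_ hz, mul_assoc]
    exact Set.disjoint_left.2 fun l hl hl' => hl.2 hl'.2
  refine ⟨fun z => blaschke A z * g z, hAB.mul hg, hAB.mul_isHardyTwo hg', hb.congr_upper hS,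
    fun l hΛ => ?_⟩
  rw [hl l hΛ, hS l (D.mem_imag l hΛ).2]

lemma IsGenerator.add {f g : ℂ → ℂ} (hf : D.IsGenerator f) (hg : D.IsGenerator g) :
    D.IsGenerator (f + g) := by
  classical
  obtain ⟨S, u, h1, h2, h3, h4⟩ := hf
  obtain ⟨S', u', h1', h2', h3', h4'⟩ := hg
  obtain ⟨v, i1, i2, i3, i4⟩ := exists_generator_of_subset (Finset.subset_union_left (s₂ := S')) h1 h2 h3 h4
  obtain ⟨v', i1', i2', i3', i4'⟩ :=
    exists_generator_of_subset (Finset.subset_union_right (s₁ := S)) h1' h2' h3' h4'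
  refine ⟨S ∪ S', fun z => v z + v' z, i1.add i1', i2.add i2', ?_, fun l hl => ?_⟩
  · refine (i3.add i3').congr_upper fun z _ => ?_
    ring
  · rw [Pi.add_apply, i4 l hl, i4' l hl]; ring

lemma IsGenerator.smul {f : ℂ → ℂ} (hf : D.IsGenerator f) (c : ℂ) : D.IsGenerator (c • f) := by
  obtain ⟨S, u, h1, h2, h3, h4⟩ := hf
  refine ⟨S, fun z => c * u z, (IsHardyInfty.const c).mul h1,
    (IsHardyInfty.const c).mul_isHardyTwo h2, ?_, fun l hl => ?_⟩
  · refine ((HasBoundaryValues.const c).mul h3).congr_upper fun z _ => ?_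
    ring
  · rw [Pi.smul_apply, h4 l hl, smul_eq_mul]; ring

lemma IsGenerator.hardyPair {f : ℂ → ℂ} (hf : D.IsGenerator f) : ∃ (S : Finset ℂ) (F : ℂ → ℂ),
    HardyPair F (fun t => f t) ∧ (∀ l ∈ D.Λ, f l = F l) ∧ ∀ l ∈ D.Λ, l ∉ S → f l = 0 := by
  obtain ⟨S, u, h1, h2, h3, h4⟩ := hf
  have hB := D.blaschkeSet.mono (A' := D.Λ \ S) Set.sdiff_subset
  refine ⟨S, fun z => blaschke (D.Λ \ S) z * u z, ⟨hB.isHardyInfty.mul_isHardyTwo h2, h3⟩, h4,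
    fun l hl hS => ?_⟩
  rw [h4 l hl, hB.eq_zero_of_mem ⟨hl, hS⟩, zero_mul]

/-- A generator is nonzero at only finitely many points of Λ, so its norm is finite whatever the
masses are, in particular for every twist. -/
lemma IsGenerator.memL2 {f : ℂ → ℂ} (hf : D.IsGenerator f) : D.MemL2 f := by
  obtain ⟨S, F, hF, -, hS⟩ := hf.hardyPair
  exact memL2_of_memLp hF.memLp S hS

lemma IsGenerator.mem_hatH2 {f : ℂ → ℂ} (hf : D.IsGenerator f) : f ∈ D.hatH2 := by
  obtain ⟨S, F, hF, hl, -⟩ := hf.hardyPair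
  refine mem_hatH2_iff.2 ⟨hf.memL2, fun z => D.outer z * F z,
    hF.mul_left D.isHardyInfty_outer D.hasBoundaryValues_outer, fun l hΛ => ?_⟩
  rw [mul_div_cancel_left₀ _ (D.outer_ne_zero l), hl l hΛ]

lemma isGenerator_zero : D.IsGenerator 0 := by
  refine ⟨∅, fun _ => 0, IsHardyInfty.const 0, HardyPair.zero.hardy, ?_, fun l _ => by simp⟩
  simpa using HasBoundaryValues.const 0

variable (D)

/-- The linear space of the functions whose closure is `H²_{s₊,ν₊}`. -/
def genSubmodule : Submodule ℂ D.memL2Submodule where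
  carrier := {f | D.IsGenerator f.1}
  zero_mem' := isGenerator_zero
  add_mem' hf hg := IsGenerator.add hf hg
  smul_mem' c _ hf := IsGenerator.smul hf c

lemma genSubmodule_le : D.genSubmodule ≤ D.hatSubmodule := fun _ hf => IsGenerator.mem_hatH2 hf

lemma tendsto_embed_parts {u : ℕ → D.memL2Submodule} {v : D.Ambient}
    (h : Tendsto (fun n => D.embed (u n)) atTop (𝓝 v)) :
    Tendsto (fun n => D.embedΛ (u n)) atTop (𝓝 v.fst) ∧
    Tendsto (fun n => D.embedRefl (u n)) atTop (𝓝 (normFactor⁻¹ • v.snd.fst)) ∧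
    Tendsto (fun n => D.embedDiag (u n)) atTop (𝓝 (normFactor⁻¹ • v.snd.snd)) := by
  have hn : normFactor ≠ 0 := by
    have hpi := Real.pi_pos
    unfold normFactor
    exact Complex.ofReal_ne_zero.2 (by positivity)
  have h1 := (WithLp.continuous_fst 2 _ _).tendsto v |>.comp h
  have h2 := (WithLp.continuous_snd 2 _ _).tendsto v |>.comp h
  have h3 := (WithLp.continuous_fst 2 _ _).tendsto v.snd |>.comp h2
  have h4 := (WithLp.continuous_snd 2 _ _).tendsto v.snd |>.comp h2
  refine ⟨h1, (h3.const_smul normFactor⁻¹).congr fun n => ?_,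
    (h4.const_smul normFactor⁻¹).congr fun n => ?_⟩
  · exact inv_smul_smul₀ hn _
  · exact inv_smul_smul₀ hn _

end ScatteringData

/-- A function on the real line as a function on the plane, zero off the line. -/
noncomputable def lineExt (p : ℝ → ℂ) (z : ℂ) : ℂ := if z.im = 0 then p z.re else 0

lemma lineExt_ofReal (p : ℝ → ℂ) (t : ℝ) : lineExt p t = p t := by simp [lineExt]

namespace ScatteringData

variable {D : ScatteringData}

lemma lineExt_mem (p : ℝ → ℂ) {l : ℂ} (hl : l ∈ D.Λ) : lineExt p l = 0 := by
  simp [lineExt, (D.mem_imag l hl).2.ne']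

variable (D)

lemma aestronglyMeasurable_sqrt :
    AEStronglyMeasurable (fun t => ((Real.sqrt (1 - ‖D.s t‖ ^ 2) : ℝ) : ℂ)) volume := by
  have h1 : AEStronglyMeasurable (fun t => 1 - ‖D.s t‖ ^ 2) volume :=
    aestronglyMeasurable_const.sub (D.aestronglyMeasurable.norm.pow 2)
  exact (Complex.continuous_ofReal.comp Real.continuous_sqrt).comp_aestronglyMeasurable h1

lemma exists_subseq_tendsto_parts {u : ℕ → D.memL2Submodule} {γ β : Lp ℂ 2 (volume : Measure ℝ)}
    (hγ : Tendsto (fun n => D.embedRefl (u n)) atTop (𝓝 γ))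
    (hβ : Tendsto (fun n => D.embedDiag (u n)) atTop (𝓝 β)) :
    ∃ ns : ℕ → ℕ, (∀ᵐ t : ℝ, Tendsto (fun n => D.reflPart (u (ns n)) t) atTop (𝓝 (γ t))) ∧
      ∀ᵐ t : ℝ, Tendsto (fun n => D.diagPart (u (ns n)) t) atTop (𝓝 (β t)) := by
  obtain ⟨ms, hm, h1⟩ := (tendstoInMeasure_of_tendsto_Lp hγ).exists_seq_tendsto_ae
  obtain ⟨ks, hk, h2⟩ := (tendstoInMeasure_of_tendsto_Lp
    (hβ.comp hm.tendsto_atTop)).exists_seq_tendsto_ae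
  have hr : ∀ᵐ t : ℝ, ∀ n, D.embedRefl (u n) t = D.reflPart (u n) t :=
    ae_all_iff.2 fun n => (memL2_iff.1 (u n).2).2.2.1.coeFn_toLp
  have hd : ∀ᵐ t : ℝ, ∀ n, D.embedDiag (u n) t = D.diagPart (u n) t :=
    ae_all_iff.2 fun n => (memL2_iff.1 (u n).2).2.2.2.coeFn_toLp
  refine ⟨fun n => ms (ks n), ?_, ?_⟩
  · filter_upwards [h1, hr] with t ht hrt
    exact (ht.comp hk.tendsto_atTop).congr fun n => hrt _
  · filter_upwards [h2, hd] with t ht hdt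
    exact ht.congr fun n => hdt _

/-- Convergence of the diagonal components is L² convergence of s_e f. So the limit of s_e f is
again in H², and its values in the upper half-plane, hence on Λ, are limits. The reflected component
is identified along an almost everywhere convergent subsequence. -/
lemma isClosed_map_hatSubmodule : IsClosed ((D.hatSubmodule.map D.embed : Submodule ℂ D.Ambient) :
    Set D.Ambient) := by
  refine isClosed_of_closure_subset fun v hv => ?_
  obtain ⟨x, hx, hxv⟩ := mem_closure_iff_seq_limit.1 hv
  choose u hu hux using hx
  obtain rfl : (fun n => D.embed (u n)) = x := funext hux
  obtain ⟨hΛ, hγ, hβ⟩ := D.tendsto_embed_parts hxv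
  set γ := normFactor⁻¹ • v.snd.fst with hγdef
  set β := normFactor⁻¹ • v.snd.snd with hβdef
  choose _ G hG hGl using fun n => mem_hatH2_iff.1 (hu n)
  -- The limit function on the line is recovered from the limit of the diagonal components.
  set p : ℝ → ℂ := fun t => β t / (Real.sqrt (1 - ‖D.s t‖ ^ 2) : ℝ) with hp
  have hsqrt : ∀ᵐ t : ℝ, ((Real.sqrt (1 - ‖D.s t‖ ^ 2) : ℝ) : ℂ) ≠ 0 := by
    filter_upwards [D.one_sub_norm_sq_pos] with t ht
    exact Complex.ofReal_ne_zero.2 (Real.sqrt_pos.2 ht).ne'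
  have hpm : AEStronglyMeasurable p volume :=
    ((Lp.aestronglyMeasurable β).aemeasurable.div D.aestronglyMeasurable_sqrt.aemeasurable).aestronglyMeasurable
  have hdiag : ∀ f : ℂ → ℂ, (∀ t : ℝ, f t = p t) → D.diagPart f =ᵐ[volume] (β : ℝ → ℂ) := by
    intro f hf
    filter_upwards [hsqrt] with t ht
    rw [diagPart, hf, hp, mul_div_cancel₀ _ ht]
  have hpL : MemLp (fun t => D.outerLine t * p t) 2 volume := by
    refine ⟨D.aestronglyMeasurable_outerLine.mul hpm, ?_⟩
    have := eLpNorm_outerLine_mul (D := D) (lineExt p)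
    simp only [lineExt_ofReal] at this
    rw [this, eLpNorm_congr_ae (hdiag _ (lineExt_ofReal p))]
    exact (Lp.memLp β).2
  have hlim : Tendsto (fun n => eLpNorm (fun t => D.outerLine t * (u n).1 t - D.outerLine t * p t) 2
      volume) atTop (𝓝 0) := by
    refine ((Lp.tendsto_Lp_iff_tendsto_eLpNorm' _ _).1 hβ).congr fun n => ?_
    refine eLpNorm_congr_norm_ae ?_
    filter_upwards [D.norm_outerLine, hdiag _ (lineExt_ofReal p),
      (memL2_iff.1 (u n).2).2.2.2.coeFn_toLp] with t h1 h2 h3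
    have h3 : D.embedDiag (u n) t = D.diagPart (u n) t := h3
    rw [Pi.sub_apply, h3, ← h2, diagPart, diagPart, lineExt_ofReal, ← mul_sub, ← mul_sub, norm_mul,
      norm_mul, h1, Complex.norm_real, Real.norm_of_nonneg (Real.sqrt_nonneg _)]
  obtain ⟨F, hF, hFlim⟩ := HardyPair.exists_of_tendsto hG hpL hlim
  set f : ℂ → ℂ := fun z => if z.im = 0 then p z.re else F z / D.outer z with hf
  have hft : ∀ t : ℝ, f t = p t := fun t => by simp [hf]
  have hfl : ∀ l ∈ D.Λ, f l = F l / D.outer l := fun l hl => by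
    simp [hf, (D.mem_imag l hl).2.ne']
  have hfv : ∀ l : D.Λ, f l * (Real.sqrt (D.ν l) : ℂ) = v.fst l := by
    intro l
    have h1 : Tendsto (fun n => D.embedΛ (u n) l) atTop (𝓝 (v.fst l)) := by
      rw [tendsto_iff_norm_sub_tendsto_zero] at hΛ ⊢
      refine squeeze_zero (fun _ => norm_nonneg _) (fun n => ?_) hΛ
      exact lp.norm_apply_le_norm two_ne_zero (D.embedΛ (u n) - v.fst) l
    refine tendsto_nhds_unique ?_ h1
    have h2 := ((hFlim l (D.mem_imag l l.2).2).div_const (D.outer l)).mul_const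
      (Real.sqrt (D.ν l) : ℂ)
    rw [hfl l l.2]
    exact h2.congr fun n => by rw [embedΛ_apply, hGl n l l.2]
  have hrefl : D.reflPart f =ᵐ[volume] (γ : ℝ → ℂ) := by
    obtain ⟨ns, h1, h2⟩ := D.exists_subseq_tendsto_parts hγ hβ
    have h3 : ∀ᵐ t : ℝ, Tendsto (fun n => (u (ns n)).1 t) atTop (𝓝 (p t)) := by
      filter_upwards [h2, hsqrt] with t ht ht0
      refine (ht.div_const _).congr fun n => ?_
      rw [diagPart, mul_div_cancel_left₀ _ ht0]
    filter_upwards [h1, h3, ae_neg h3] with t h4 h5 h6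
    refine tendsto_nhds_unique (f := fun n => D.reflPart (u (ns n)) t) (l := atTop) ?_ h4
    have h7 := h6.sub (h5.const_mul (D.s t))
    have h8 := hft (-t)
    push_cast at h7 h8
    rw [reflPart, h8, hft]
    exact h7
  have hmem : D.MemL2 f := by
    refine memL2_iff.2 ⟨?_, ?_, (Lp.memLp γ).ae_eq hrefl.symm, (Lp.memLp β).ae_eq (hdiag f hft).symm⟩
    · simpa only [hft] using hpm
    · simp_rw [hfv]
      exact lp.memℓp _
  refine ⟨⟨f, hmem⟩, mem_hatH2_iff.2 ⟨hmem, F, ?_, hfl⟩, ?_⟩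
  · simpa only [hft] using hF
  have hn : normFactor ≠ 0 := by
    have hpi := Real.pi_pos
    unfold normFactor
    exact Complex.ofReal_ne_zero.2 (by positivity)
  have e1 : D.embedΛ ⟨f, hmem⟩ = v.fst := lp.ext (funext hfv)
  have e2 : normFactor • D.embedRefl ⟨f, hmem⟩ = v.snd.fst := by
    have : D.embedRefl ⟨f, hmem⟩ = γ :=
      Lp.ext ((memL2_iff.1 hmem).2.2.1.coeFn_toLp.trans hrefl)
    rw [this, hγdef, smul_inv_smul₀ hn]
  have e3 : normFactor • D.embedDiag ⟨f, hmem⟩ = v.snd.snd := by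
    have : D.embedDiag ⟨f, hmem⟩ = β :=
      Lp.ext ((memL2_iff.1 hmem).2.2.2.coeFn_toLp.trans (hdiag f hft))
    rw [this, hβdef, smul_inv_smul₀ hn]
  rw [embed_apply, e1, e2, e3]
  rfl

/-! ### Functions which represent evaluations -/

/-- The function on the line with `⟨f, T u⟩ = (1 / 2π) ∫ s_e f conj u` for all `f`. -/
noncomputable def dualLift (u : ℝ → ℂ) : ℂ → ℂ :=
  lineExt fun t => u t / D.outerLine t + conj (D.s t) * u (-t) / conj (D.outerLine t)

variable {D}

lemma dualLift_ofReal (u : ℝ → ℂ) (t : ℝ) : D.dualLift u t =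
    u t / D.outerLine t + conj (D.s t) * u (-t) / conj (D.outerLine t) := lineExt_ofReal _ t

/-- By the symmetries of s₊ and s_e the terms with u(t) cancel, and those with u(-t) combine through
1 - |s₊|² = |s_e|², which removes the denominator. -/
lemma reflPart_dualLift (u : ℝ → ℂ) :
    ∀ᵐ t : ℝ, D.reflPart (D.dualLift u) t = D.outerLine t * u (-t) := by
  filter_upwards [D.outerLine_ne_zero, D.outerLine_mul_conj, D.outerLine_neg, D.s_neg]
    with t h1 h2 h3 h4
  have h1' : conj (D.outerLine t) ≠ 0 := (map_ne_zero _).2 h1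
  have h5 := dualLift_ofReal (D := D) u (-t)
  rw [Complex.ofReal_neg] at h5
  rw [reflPart, h5, dualLift_ofReal, h3, h4, Complex.conj_conj, Complex.conj_conj, neg_neg]
  field_simp
  linear_combination -(u (-t) * D.outerLine t) * h2

lemma form_dualLift (f : ℂ → ℂ) (u : ℝ → ℂ) : ∀ᵐ t : ℝ, D.form f (D.dualLift u) t =
    D.outerLine t * f t * conj (u t) + D.outerLine (-t) * f (-t) * conj (u (-t)) := by
  filter_upwards [D.form_eq f (D.dualLift u), reflPart_dualLift (D := D) u, D.outerLine_ne_zero,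
    D.outerLine_mul_conj, D.outerLine_neg, D.norm_outerLine] with t h1 h2 h3 h4 h5 h6
  have h3' : conj (D.outerLine t) ≠ 0 := (map_ne_zero _).2 h3
  have h7 : ((Real.sqrt (1 - ‖D.s t‖ ^ 2) : ℝ) : ℂ) * (Real.sqrt (1 - ‖D.s t‖ ^ 2) : ℝ) =
      D.outerLine t * conj (D.outerLine t) := by
    rw [← h6, Complex.mul_conj']; ring
  rw [h1, h2, h5]
  simp only [reflPart, diagPart, dualLift_ofReal, map_mul, map_add, map_div₀, Complex.conj_conj,
    Complex.conj_ofReal]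
  rw [mul_mul_mul_comm, h7]
  field_simp
  ring

lemma aestronglyMeasurable_dualLift {u : ℝ → ℂ} (hu : MemLp u 2 volume) :
    AEStronglyMeasurable (fun t : ℝ => D.dualLift u t) volume := by
  simp_rw [dualLift_ofReal]
  have h1 := D.aestronglyMeasurable_outerLine
  have h2 := (memLp_comp_neg hu).1
  have hc := Complex.continuous_conj.comp_aestronglyMeasurable D.aestronglyMeasurable
  have hc' := Complex.continuous_conj.comp_aestronglyMeasurable h1
  exact (hu.1.aemeasurable.div h1.aemeasurable).aestronglyMeasurable.add
    ((hc.mul h2).aemeasurable.div hc'.aemeasurable).aestronglyMeasurable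

/-- The bound does not involve the data, so for the twisted data it is uniform in x. -/
lemma normSq_dualLift_le {u : ℝ → ℂ} (hu : MemLp u 2 volume) :
    D.normSq (D.dualLift u) ≤ eLpNorm u 2 volume ^ 2 := by
  rw [normSq_eq (aestronglyMeasurable_dualLift hu), (ENNReal.tsum_eq_zero).2 fun l : D.Λ => by
    simp [dualLift, lineExt_mem _ l.2], zero_add]
  refine ofReal_mul_add_sq_le ?_ ?_
  · calc eLpNorm (D.reflPart (D.dualLift u)) 2 volume ≤ eLpNorm (fun t => u (-t)) 2 volume := by
          refine eLpNorm_mono_ae ?_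
          filter_upwards [reflPart_dualLift (D := D) u, D.norm_outerLine_le_one] with t h1 h2
          rw [h1, norm_mul]
          exact mul_le_of_le_one_left (norm_nonneg _) h2
      _ = eLpNorm u 2 volume := eLpNorm_comp_neg hu.1
      _ ≤ 2 * eLpNorm u 2 volume := by rw [two_mul]; exact le_self_add
  · rw [← eLpNorm_outerLine_mul]
    calc eLpNorm (fun t : ℝ => D.outerLine t * D.dualLift u t) 2 volume
        ≤ eLpNorm (fun t => ‖u t‖ + ‖u (-t)‖) 2 volume := by
          refine eLpNorm_mono_ae ?_
          filter_upwards [D.outerLine_ne_zero, D.norm_s_le_one] with t h1 h2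
          rw [dualLift_ofReal, mul_add, mul_div_cancel₀ _ h1, Real.norm_of_nonneg (by positivity)]
          refine (norm_add_le _ _).trans ?_
          gcongr
          rw [norm_mul, norm_div, norm_mul, RCLike.norm_conj, RCLike.norm_conj,
            mul_div_cancel₀ _ (norm_ne_zero_iff.2 h1)]
          exact mul_le_of_le_one_left (norm_nonneg _) h2
      _ ≤ eLpNorm (fun t => ‖u t‖) 2 volume + eLpNorm (fun t => ‖u (-t)‖) 2 volume :=
          eLpNorm_add_le hu.1.norm (memLp_comp_neg hu).1.norm one_le_two
      _ = 2 * eLpNorm u 2 volume := by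
          rw [eLpNorm_norm, eLpNorm_norm, eLpNorm_comp_neg hu.1, two_mul]

lemma memL2_dualLift {u : ℝ → ℂ} (hu : MemLp u 2 volume) : D.MemL2 (D.dualLift u) :=
  ⟨aestronglyMeasurable_dualLift hu, (normSq_dualLift_le hu).trans_lt (ENNReal.pow_lt_top hu.2)⟩

lemma scalar_dualLift {f : ℂ → ℂ} (hf : D.MemL2 f) {u : ℝ → ℂ} (hu : MemLp u 2 volume) :
    D.scalar f (D.dualLift u) =
      1 / (2 * Real.pi) * ∫ t : ℝ, D.outerLine t * f t * conj (u t) := by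
  have hi : Integrable (fun t : ℝ => D.outerLine t * f t * conj (u t)) :=
    integrable_mul_of_memLp_two (memLp_outerLine_mul hf) hu.star
  have h2 := hi.comp_neg
  have h3 := integral_neg_eq_self (fun t : ℝ => D.outerLine t * f t * conj (u t)) volume
  simp only [Complex.ofReal_neg] at h2 h3
  unfold scalar
  rw [(hasSum_zero.congr_fun (f := fun _ : D.Λ => (0 : ℂ)) fun l => by
    simp [dualLift, lineExt_mem _ l.2]).tsum_eq, zero_add, integral_congr_ae (form_dualLift f u),
    integral_add hi h2, h3]
  ring

end ScatteringData

namespace ScatteringData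

variable {D : ScatteringData}

/-! ### Reproducing kernels -/

/-- A closed space between the span of the generators and `Ĥ²`. -/
def IsHardySpace (D : ScatteringData) (H : Set (ℂ → ℂ)) : Prop :=
  ∃ M : Submodule ℂ D.Ambient, IsClosed (M : Set D.Ambient) ∧ D.genSubmodule.map D.embed ≤ M ∧
    M ≤ D.hatSubmodule.map D.embed ∧ ∀ f : ℂ → ℂ, f ∈ H ↔ ∃ h : D.MemL2 f, D.embed ⟨f, h⟩ ∈ M

lemma mem_hatH2_of_embed_mem {f : ℂ → ℂ} (hf : D.MemL2 f)
    (h : D.embed ⟨f, hf⟩ ∈ D.hatSubmodule.map D.embed) : f ∈ D.hatH2 := by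
  obtain ⟨g, hg, hgf⟩ := h
  obtain ⟨h1, h2⟩ := ae_eq_of_embed_eq hgf
  exact mem_hatH2_congr hg hf h1 h2

lemma isHardySpace_hatH2 : D.IsHardySpace D.hatH2 :=
  ⟨D.hatSubmodule.map D.embed, D.isClosed_map_hatSubmodule, Submodule.map_mono D.genSubmodule_le,
    le_rfl, fun f => ⟨fun hf => ⟨hf.1, ⟨f, hf.1⟩, hf, rfl⟩,
      fun ⟨hf, h⟩ => mem_hatH2_of_embed_mem hf h⟩⟩

lemma isHardySpace_H2 : D.IsHardySpace D.H2 := by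
  refine ⟨(D.genSubmodule.map D.embed).topologicalClosure,
    Submodule.isClosed_topologicalClosure _, Submodule.le_topologicalClosure _,
    Submodule.topologicalClosure_minimal _ (Submodule.map_mono D.genSubmodule_le)
      D.isClosed_map_hatSubmodule, fun f => ?_⟩
  have key : ∀ (hf : D.MemL2 f) (g : D.memL2Submodule),
      D.normSq (f - g) = ENNReal.ofReal (‖D.embed ⟨f, hf⟩ - D.embed g‖ ^ 2) := by
    intro hf g
    rw [← map_sub, ← normSq_embed]
    rfl
  constructor
  · rintro ⟨hf, h⟩
    refine ⟨hf, Metric.mem_closure_iff.2 fun ε hε => ?_⟩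
    obtain ⟨g, hg, hlt⟩ := h (ENNReal.ofReal (ε ^ 2)) (ENNReal.ofReal_pos.2 (by positivity))
    refine ⟨D.embed ⟨g, hg.memL2⟩, ⟨⟨g, hg.memL2⟩, hg, rfl⟩, ?_⟩
    have h1 := key hf ⟨g, hg.memL2⟩
    rw [h1, ENNReal.ofReal_lt_ofReal_iff (by positivity)] at hlt
    rw [dist_eq_norm]
    exact lt_of_pow_lt_pow_left₀ 2 hε.le hlt
  · rintro ⟨hf, h⟩
    refine ⟨hf, fun ε hε => ?_⟩
    obtain ⟨δ, -, hδ, hδε⟩ := ENNReal.lt_iff_exists_real_btwn.1 hε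
    have hδ : 0 < δ := ENNReal.ofReal_pos.1 hδ
    obtain ⟨-, ⟨g, hg, rfl⟩, hlt⟩ := Metric.mem_closure_iff.1 h (Real.sqrt δ) (Real.sqrt_pos.2 hδ)
    refine ⟨g.1, hg, ?_⟩
    rw [key hf g]
    refine lt_of_le_of_lt (ENNReal.ofReal_le_ofReal ?_) hδε
    rw [dist_eq_norm] at hlt
    calc _ ≤ Real.sqrt δ ^ 2 := by gcongr
      _ = δ := Real.sq_sqrt hδ.le

lemma hasValue_iff {f F : ℂ → ℂ} (hF : HardyPair F fun t => D.outerLine t * f t) {z v : ℂ}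
    (hz : 0 < z.im) : D.HasValue f z v ↔ v = F z / D.outer z := by
  constructor
  · rintro ⟨G, hG, rfl⟩
    rw [(isOuterMultiple_iff.1 hG).eq_of_ae_eq hF (ae_eq_refl _) hz]
  · exact fun h => ⟨F, isOuterMultiple_iff.2 hF, h⟩

/-- The lift of k_μ represents f ↦ s_e(μ) f(μ) on all of `Ĥ²`. Its orthogonal projection onto the
closed subspace, divided by conj(s_e(μ)), is the kernel. -/
lemma exists_isReproducingKernel {H : Set (ℂ → ℂ)} (hH : D.IsHardySpace H) {μ : ℂ}
    (hμ : 0 < μ.im) : ∃ k, D.IsReproducingKernel H μ k := by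
  obtain ⟨M, hMc, -, hM, hHM⟩ := hH
  have : CompleteSpace M := hMc.completeSpace_coe
  have hk := memLp_hardyKernel hμ.ne'
  set w : D.memL2Submodule := ⟨_, memL2_dualLift hk⟩ with hw
  set c : ℂ := 1 / D.outer μ with hc
  set v : D.Ambient := conj c • M.starProjection (D.embed w) with hv
  have hvM : v ∈ M := M.smul_mem _ (M.starProjection_apply_mem _)
  obtain ⟨f, hf, hfv⟩ := hM hvM
  obtain ⟨-, F, hF, hFl⟩ := mem_hatH2_iff.1 hf
  -- Membership in the space fixes values only on ℝ ∪ Λ, whereas a kernel must also take the values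
  -- of its continuation in the upper half-plane.
  set k : ℂ → ℂ := fun z => if 0 < z.im then F z / D.outer z else f.1 z with hkdef
  have hkt : ∀ t : ℝ, k t = f.1 t := fun t => by simp [hkdef]
  have hkz : ∀ z : ℂ, 0 < z.im → k z = F z / D.outer z := fun z hz => by simp [hkdef, hz]
  have hkl : ∀ l : D.Λ, k l = f.1 l := fun l => by
    rw [hkz l (D.mem_imag l l.2).2, hFl l l.2]
  have hform : ∀ g, D.form g k = D.form g f.1 := by
    intro g; ext t
    have h1 := hkt (-t)
    push_cast at h1
    simp only [form, hkt, h1]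
  have hscalar : ∀ g, D.scalar g k = D.scalar g f.1 := by
    intro g
    simp only [scalar, hkl, hform]
  have hkm : D.MemL2 k := by
    have h2 : D.MemL2 f.1 := f.2
    rw [memL2_iff] at h2 ⊢
    have hr : D.reflPart k = D.reflPart f.1 := by
      ext t
      have h1 := hkt (-t)
      push_cast at h1
      simp only [reflPart, hkt, h1]
    have hd : D.diagPart k = D.diagPart f.1 := by
      ext t
      simp only [diagPart, hkt]
    simpa only [hkt, hkl, hr, hd] using h2
  have hke : D.embed ⟨k, hkm⟩ = D.embed f := by
    rw [embed_apply, embed_apply]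
    have hr : D.embedRefl ⟨k, hkm⟩ = D.embedRefl f := MemLp.toLp_congr
      (memL2_iff.1 hkm).2.2.1 (memL2_iff.1 f.2).2.2.1
      (Eventually.of_forall fun t => by
        have h1 := hkt (-t)
        push_cast at h1
        simp only [reflPart, hkt, h1])
    have hd : D.embedDiag ⟨k, hkm⟩ = D.embedDiag f := MemLp.toLp_congr
      (memL2_iff.1 hkm).2.2.2 (memL2_iff.1 f.2).2.2.2
      (Eventually.of_forall fun t => by simp only [diagPart, hkt])
    have hl : D.embedΛ ⟨k, hkm⟩ = D.embedΛ f := lp.ext (funext fun l =>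
      congrArg (· * (Real.sqrt (D.ν l) : ℂ)) (hkl l))
    rw [hr, hd, hl]
  have hkF : HardyPair F fun t => D.outerLine t * k t := by simpa only [hkt] using hF
  refine ⟨k, (hHM k).2 ⟨hkm, by rw [hke, hfv]; exact hvM⟩,
    fun z hz => (hasValue_iff hkF hz).2 (hkz z hz), fun g hg => ?_⟩
  obtain ⟨hgm, hgM⟩ := (hHM g).1 hg
  obtain ⟨-, G, hG, -⟩ := mem_hatH2_iff.1 (mem_hatH2_of_embed_mem hgm (hM hgM))
  refine (hasValue_iff hG hμ).2 ?_
  have h1 := inner_embed (⟨g, hgm⟩ : D.memL2Submodule) f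
  have h2 := inner_embed (⟨g, hgm⟩ : D.memL2Submodule) w
  rw [hscalar, ← h1, hfv, hv, inner_smul_left, Complex.conj_conj,
    Submodule.inner_starProjection_left_eq_right, Submodule.starProjection_eq_self_iff.2 hgM, h2,
    hw, scalar_dualLift hgm hk, hG.integral_mul_conj_kernel hμ, hc]
  have hpi : (Real.pi : ℂ) ≠ 0 := Complex.ofReal_ne_zero.2 Real.pi_ne_zero
  field_simp

lemma isReproducingKernel_kernel {μ : ℂ} (hμ : 0 < μ.im) :
    D.IsReproducingKernel D.H2 μ fun z => D.kernel z μ :=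
  Classical.epsilon_spec (exists_isReproducingKernel isHardySpace_H2 hμ)

lemma isReproducingKernel_hatKernel {μ : ℂ} (hμ : 0 < μ.im) :
    D.IsReproducingKernel D.hatH2 μ fun z => D.hatKernel z μ :=
  Classical.epsilon_spec (exists_isReproducingKernel isHardySpace_hatH2 hμ)

namespace IsReproducingKernel

variable {H : Set (ℂ → ℂ)} {μ : ℂ} {κ : ℂ → ℂ}

lemma mem_hatH2 (hκ : D.IsReproducingKernel H μ κ) (hH : D.IsHardySpace H) : κ ∈ D.hatH2 := by
  obtain ⟨M, -, -, hM, hHM⟩ := hH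
  obtain ⟨h, hm⟩ := (hHM κ).1 hκ.1
  exact mem_hatH2_of_embed_mem h (hM hm)

lemma exists_hardyPair (hκ : D.IsReproducingKernel H μ κ) (hH : D.IsHardySpace H) :
    ∃ K, HardyPair K (fun t => D.outerLine t * κ t) ∧ ∀ z : ℂ, 0 < z.im → κ z = K z / D.outer z := by
  obtain ⟨-, K, hK, -⟩ := mem_hatH2_iff.1 (hκ.mem_hatH2 hH)
  exact ⟨K, hK, fun z hz => (hasValue_iff hK hz).1 (hκ.2.1 z hz)⟩

lemma scalar_eq (hκ : D.IsReproducingKernel H μ κ) (hμ : 0 < μ.im) {f F : ℂ → ℂ} (hf : f ∈ H)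
    (hF : HardyPair F fun t => D.outerLine t * f t) : D.scalar f κ = F μ / D.outer μ :=
  (hasValue_iff hF hμ).1 (hκ.2.2 f hf)

/-- A function which nearly represents the evaluation at `μ` on `Ĥ²`, and which is close to a
generator, is close to the reproducing kernel. -/
lemma norm_sub_le (hκ : D.IsReproducingKernel H μ κ) (hH : D.IsHardySpace H) (hμ : 0 < μ.im)
    (hκm : D.MemL2 κ) (h g : D.memL2Submodule) {c : ℂ} {ε δ : ℝ} (hε : 0 ≤ ε) (hg : D.IsGenerator g.1)
    (hgh : ‖D.embed g - D.embed h‖ ≤ δ)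
    (hh : ∀ f ∈ D.hatSubmodule, ∀ F, HardyPair F (fun t => D.outerLine t * f.1 t) →
      ‖D.scalar f.1 h.1 - c * (F μ / D.outer μ)‖ ≤ ε * ‖D.embed f‖) :
    ‖conj c • D.embed ⟨κ, hκm⟩ - D.embed h‖ ≤ 2 * δ + ε := by
  obtain ⟨M, -, hgM, hM, hHM⟩ := hH
  obtain ⟨_, hκM⟩ := (hHM κ).1 hκ.1
  set k : D.memL2Submodule := ⟨κ, hκm⟩ with hk
  set u : D.memL2Submodule := g - conj c • k with hu
  have hue : D.embed u = D.embed g - conj c • D.embed k := by rw [hu, map_sub, map_smul]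
  have huM : D.embed u ∈ M := by
    rw [hue]
    exact M.sub_mem (hgM ⟨g, hg, rfl⟩) (M.smul_mem _ hκM)
  have huH := mem_hatH2_of_embed_mem u.2 (hM huM)
  obtain ⟨-, U, hU, -⟩ := mem_hatH2_iff.1 huH
  -- Since u lies in the space, the kernel reproduces u(μ), and conj(c) κ inside u can be traded for
  -- h. What remains is the distance from g to h and the defect of h as a representing function,
  -- both against u.
  have h1 : inner ℂ (D.embed u) (D.embed u) =
      inner ℂ (D.embed g - D.embed h) (D.embed u) + (D.scalar u.1 h.1 - c * (U μ / D.outer μ)) := by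
    rw [← hκ.scalar_eq hμ ((hHM u.1).2 ⟨u.2, huM⟩) hU, ← inner_embed u h]
    have h2 := inner_embed u k
    change _ = D.scalar u.1 κ at h2
    rw [← h2]
    nth_rewrite 1 [hue]
    rw [inner_sub_left, inner_sub_left, inner_smul_left, Complex.conj_conj]
    ring
  have h3 : ‖D.embed u‖ * ‖D.embed u‖ ≤ (δ + ε) * ‖D.embed u‖ := by
    have h4 : ‖D.embed u‖ * ‖D.embed u‖ = ‖inner ℂ (D.embed u) (D.embed u)‖ := by
      rw [inner_self_eq_norm_sq_to_K]
      simp [sq]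
    rw [h4, h1, add_mul]
    refine (norm_add_le _ _).trans (add_le_add ?_ (hh u huH U hU))
    exact (norm_inner_le_norm _ _).trans (mul_le_mul_of_nonneg_right hgh (norm_nonneg _))
  have h5 : ‖D.embed u‖ ≤ δ + ε := by
    rcases (norm_nonneg (D.embed u)).eq_or_lt with h0 | h0
    · have h7 : 0 ≤ δ := (norm_nonneg _).trans hgh
      linarith
    · exact le_of_mul_le_mul_right h3 h0
  calc ‖conj c • D.embed k - D.embed h‖
      = ‖(D.embed g - D.embed h) - D.embed u‖ := by rw [hue]; congr 1; abel
    _ ≤ ‖D.embed g - D.embed h‖ + ‖D.embed u‖ := _root_.norm_sub_le _ _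
    _ ≤ 2 * δ + ε := by linarith

end IsReproducingKernel

end ScatteringData

/-! ### Approximations near the reproducing kernel of the standard Hardy space -/

lemma tendsto_zero_of_sq {ι : Type*} {l : Filter ι} {u : ι → ℝ≥0∞}
    (h : Tendsto (fun i => u i ^ 2) l (𝓝 0)) : Tendsto u l (𝓝 0) := by
  rw [ENNReal.tendsto_nhds_zero] at h ⊢
  intro ε hε
  filter_upwards [h (ε ^ 2) (pos_iff_ne_zero.2 (pow_ne_zero 2 hε.ne'))] with i hi
  exact (ENNReal.pow_le_pow_left_iff two_ne_zero).1 hi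

lemma tendsto_eLpNorm_sub_one_mul_kernel {ι : Type*} {l : Filter ι} {θ : ι → ℂ → ℂ}
    {θ' : ι → ℝ → ℂ} (hd : ∀ i, DifferentiableOn ℂ (θ i) {z | 0 < z.im})
    (h1 : ∀ i, ∀ z : ℂ, 0 < z.im → ‖θ i z‖ ≤ 1) (hb : ∀ i, HasBoundaryValues (θ i) (θ' i))
    {μ : ℂ} (hμ : 0 < μ.im) (hlim : Tendsto (fun i => θ i μ) l (𝓝 1)) :
    Tendsto (fun i => eLpNorm (fun t : ℝ => (θ' i t - 1) * hardyKernel t μ) 2 volume) l (𝓝 0) := by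
  refine tendsto_zero_of_sq ?_
  simp_rw [eLpNorm_two_sq]
  have h3 := (Complex.continuous_re.tendsto _).comp hlim
  have h4 := ENNReal.tendsto_ofReal (((h3.const_sub 1).div_const (2 * μ.im)).const_mul
    (4 * Real.pi))
  refine tendsto_of_tendsto_of_tendsto_of_le_of_le tendsto_const_nhds (g := fun _ => 0)
    (h := fun i => ENNReal.ofReal (4 * Real.pi * ((1 - (θ i μ).re) / (2 * μ.im)))) ?_
    (fun _ => zero_le) fun i => lintegral_sub_one_mul_kernel_le (hd i) (h1 i) (hb i) hμ
  simpa using h4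

lemma BlaschkeSet.tendsto_eLpNorm {A : Set ℂ} (h : BlaschkeSet A) {μ : ℂ} (hμ : 0 < μ.im) :
    Tendsto (fun S : Finset ℂ => eLpNorm (fun t : ℝ =>
      (boundaryValue (blaschke (A \ S)) t - 1) * hardyKernel t μ) 2 volume) atTop (𝓝 0) :=
  have hS := fun S : Finset ℂ => h.mono (A' := A \ S) Set.sdiff_subset
  tendsto_eLpNorm_sub_one_mul_kernel (fun S => (hS S).differentiableOn)
    (fun S _ hz => (hS S).norm_le_one hz) (fun S => (hS S).isHardyInfty.hasBoundaryValues) hμ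
    (h.tendsto_diff hμ)

namespace ScatteringData

variable (D : ScatteringData)

/-- Bounded functions whose products with `s_e` take the value `1` at `μ` and are close to `1`. -/
lemma exists_outer_mul_near {μ : ℂ} (hμ : 0 < μ.im) {ε : ℝ≥0∞} (hε : 0 < ε) :
    ∃ φ, IsHardyInfty φ ∧ D.outer μ * φ μ = 1 ∧ eLpNorm (fun t : ℝ =>
      (D.outerLine t * boundaryValue φ t - 1) * hardyKernel t μ) 2 volume ≤ ε := by
  have hk := memLp_hardyKernel hμ.ne'
  set c : ℕ → ℂ := fun n => D.outer μ * D.outerInv n μ with hc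
  have hc1 : Tendsto c atTop (𝓝 1) := D.tendsto_outer_mul_outerInv hμ
  have hcinv : Tendsto (fun n => (c n)⁻¹) atTop (𝓝 1) := by simpa using hc1.inv₀ one_ne_zero
  have hi := fun n => D.isHardyInfty_outer.mul (D.isHardyInfty_outerInv n)
  have hb := fun n => D.hasBoundaryValues_outer.mul (D.isHardyInfty_outerInv n).hasBoundaryValues
  have h1 := tendsto_eLpNorm_sub_one_mul_kernel (fun n => (hi n).1)
    (fun n _ hz => D.norm_outer_mul_outerInv_le n hz) hb hμ hc1
  have h2 : Tendsto (fun n => ‖(c n)⁻¹‖ₑ * (eLpNorm (fun t : ℝ => (D.outerLine t *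
      boundaryValue (D.outerInv n) t - 1) * hardyKernel t μ) 2 volume +
      ‖1 - c n‖ₑ * eLpNorm (fun t : ℝ => hardyKernel t μ) 2 volume)) atTop (𝓝 0) := by
    have h3 : Tendsto (fun n => ‖1 - c n‖ₑ) atTop (𝓝 0) := by
      have := (continuous_enorm.tendsto (0 : ℂ)).comp (by simpa using hc1.const_sub 1 :
        Tendsto (fun n => 1 - c n) atTop (𝓝 0))
      simpa [Function.comp_def] using this
    have h4 := ENNReal.Tendsto.mul_const h3 (Or.inr hk.2.ne)
    have h5 := (continuous_enorm.tendsto (1 : ℂ)).comp hcinv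
    have h6 := ENNReal.Tendsto.mul h5 (Or.inr (by simp)) (h1.add h4) (Or.inr (by simp))
    simpa using h6
  obtain ⟨n, hn, hn0⟩ := ((ENNReal.tendsto_nhds_zero.1 h2 ε hε).and
    (hc1.eventually_ne one_ne_zero)).exists
  -- Dividing by the value at μ makes the normalization at μ exact, at the cost of an error |1 - c
  -- n| times the norm of k_μ.
  refine ⟨fun z => (c n)⁻¹ * D.outerInv n z, (IsHardyInfty.const _).mul (D.isHardyInfty_outerInv n),
    ?_, le_trans ?_ hn⟩
  · rw [mul_left_comm]
    exact inv_mul_cancel₀ hn0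
  have h7 : eLpNorm (fun t : ℝ => (D.outerLine t *
      boundaryValue (fun z => (c n)⁻¹ * D.outerInv n z) t - 1) * hardyKernel t μ) 2 volume =
      eLpNorm ((c n)⁻¹ • ((fun t : ℝ => (D.outerLine t * boundaryValue (D.outerInv n) t - 1) *
        hardyKernel t μ) + (1 - c n) • fun t : ℝ => hardyKernel t μ)) 2 volume := by
    refine eLpNorm_congr_ae ?_
    filter_upwards [((HasBoundaryValues.const (c n)⁻¹).mul
      (D.isHardyInfty_outerInv n).hasBoundaryValues).boundaryValue_ae_eq] with t ht
    simp only [ht, Pi.smul_apply, Pi.add_apply, smul_eq_mul]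
    field_simp
    ring
  rw [h7, eLpNorm_const_smul]
  gcongr
  refine (eLpNorm_add_le ?_ (hk.1.const_smul _) one_le_two).trans_eq ?_
  · exact (((hb n).aestronglyMeasurable (hi n).1).sub aestronglyMeasurable_const).mul hk.1
  · rw [eLpNorm_const_smul]

variable {D}

/-! ### Norms in the space of scattering data -/

lemma norm_embed_le {f : D.memL2Submodule} {r : ℝ} (hr : 0 ≤ r)
    (h : D.normSq f ≤ ENNReal.ofReal (r ^ 2)) : ‖D.embed f‖ ≤ r := by
  rw [normSq_embed, ENNReal.ofReal_le_ofReal_iff (by positivity)] at h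
  exact le_of_sq_le_sq h hr

lemma eLpNorm_outerLine_mul_le (f : D.memL2Submodule) :
    eLpNorm (fun t : ℝ => D.outerLine t * f.1 t) 2 volume ≤ ENNReal.ofReal (4 * ‖D.embed f‖) := by
  refine (ENNReal.pow_le_pow_left_iff two_ne_zero).1
    ((eLpNorm_outerLine_mul_sq_le f.2.1).trans ?_)
  rw [normSq_embed, ← ENNReal.ofReal_mul (by have := Real.pi_pos; positivity),
    ← ENNReal.ofReal_pow (by positivity)]
  refine ENNReal.ofReal_le_ofReal ?_
  nlinarith [Real.pi_lt_four, sq_nonneg ‖D.embed f‖]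

lemma norm_sq_mul_le_norm_embed (f : D.memL2Submodule) {l : ℂ} (hl : l ∈ D.Λ) :
    ‖f.1 l‖ ^ 2 * D.ν l ≤ ‖D.embed f‖ ^ 2 := by
  have h := ofReal_norm_sq_mul_le_normSq f.1 hl
  rw [normSq_embed, ENNReal.ofReal_le_ofReal_iff (by positivity)] at h
  exact h

lemma memL2_lineExt {p : ℝ → ℂ} (hp : MemLp p 2 volume) : D.MemL2 (lineExt p) :=
  memL2_of_memLp (by simpa only [lineExt_ofReal] using hp) ∅ fun _ hl _ => lineExt_mem p hl

lemma scalar_eq_integral {f g : ℂ → ℂ} (h : ∀ l ∈ D.Λ, g l = 0) :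
    D.scalar f g = 1 / (4 * Real.pi) * ∫ t : ℝ, D.form f g t := by
  unfold scalar
  rw [tsum_congr (fun l : D.Λ => show f l * conj (g l) * (D.ν l : ℂ) = 0 by simp [h l l.2]),
    tsum_zero, zero_add]

/-- The form is the sum of one function and its reflection, so only one half is kept and 1/(4π)
becomes 1/(2π). The combination f - conj(s₊) f(-·) is square integrable because it is the reflected
component at -t, even if f itself is not. -/
lemma scalar_lineExt {f : ℂ → ℂ} (hf : D.MemL2 f) {p : ℝ → ℂ} (hp : MemLp p 2 volume) :
    D.scalar f (lineExt p) =
      1 / (2 * Real.pi) * ∫ t : ℝ, (f t - conj (D.s t) * f (-t)) * conj (p t) := by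
  have hL : MemLp (fun t : ℝ => f t - conj (D.s t) * f (-t)) 2 volume := by
    refine (memLp_comp_neg (memL2_iff.1 hf).2.2.1).ae_eq ?_
    filter_upwards [D.s_neg] with t ht
    simp only [reflPart, ht, Complex.ofReal_neg, neg_neg]
  have hi : Integrable (fun t : ℝ => (f t - conj (D.s t) * f (-t)) * conj (p t)) :=
    integrable_mul_of_memLp_two hL hp.star
  have h2 := hi.comp_neg
  have h3 := integral_neg_eq_self (fun t : ℝ => (f t - conj (D.s t) * f (-t)) * conj (p t)) volume
  have hform : ∀ᵐ t : ℝ, D.form f (lineExt p) t =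
      (f t - conj (D.s t) * f (-t)) * conj (p t) +
      (f ((-t : ℝ) : ℂ) - conj (D.s (-t)) * f (-((-t : ℝ) : ℂ))) * conj (p (-t)) := by
    filter_upwards [D.s_neg] with t ht
    have h5 := lineExt_ofReal p (-t)
    push_cast at h5
    rw [ht]
    simp only [form, lineExt_ofReal, h5]
    simp [Matrix.mulVec, dotProduct, Fin.sum_univ_two]
    ring
  rw [scalar_eq_integral fun l hl => lineExt_mem p hl, integral_congr_ae hform,
    integral_add hi h2, h3]
  ring

end ScatteringData

/-! ### The kernels as x → +∞. -/

namespace ScatteringData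

variable {D : ScatteringData}

lemma exists_generator (S : Finset ℂ) {u : ℂ → ℂ} {u' : ℝ → ℂ} (hu : IsHardyInfty u)
    (hu' : HardyPair u u') : ∃ g, D.IsGenerator g ∧
      (∀ t : ℝ, g t = boundaryValue (blaschke (D.Λ \ S)) t * u' t) ∧
      ∀ z : ℂ, 0 < z.im → g z = blaschke (D.Λ \ S) z * u z := by
  have hB := D.blaschkeSet.mono (A' := D.Λ \ S) Set.sdiff_subset
  set g : ℂ → ℂ := fun z => if 0 < z.im then blaschke (D.Λ \ S) z * u z else
    boundaryValue (blaschke (D.Λ \ S)) z.re * u' z.re with hg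
  have h1 : ∀ t : ℝ, g t = boundaryValue (blaschke (D.Λ \ S)) t * u' t := fun t => by simp [hg]
  have h2 : ∀ z : ℂ, 0 < z.im → g z = blaschke (D.Λ \ S) z * u z := fun z hz => by simp [hg, hz]
  refine ⟨g, ⟨S, u, hu, hu'.hardy, ?_, fun l hl => h2 l (D.mem_imag l hl).2⟩, h1, h2⟩
  simp_rw [h1]
  exact hB.isHardyInfty.hasBoundaryValues.mul hu'.bv

lemma twist_s (x t : ℝ) : (D.twist x).s t = D.s t * Complex.exp (2 * Complex.I * t * x) := rfl

lemma twist_ν (x : ℝ) (l : ℂ) : (D.twist x).ν l = D.ν l * Real.exp (-2 * l.im * x) := rfl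

lemma memLp_boundaryValue_mul {φ : ℂ → ℂ} (hφ : IsHardyInfty φ) {p : ℝ → ℂ} (hp : MemLp p 2 volume) :
    MemLp (fun t => boundaryValue φ t * p t) 2 volume := by
  obtain ⟨C, hC⟩ := hφ.2
  refine hp.of_le_mul (c := C) ((hφ.hasBoundaryValues.aestronglyMeasurable hφ.1).mul hp.1) ?_
  filter_upwards [hφ.hasBoundaryValues.norm_le hC] with t ht
  rw [norm_mul]
  gcongr

lemma memLp_mul_of_norm_le_one {a p : ℝ → ℂ} (ha : AEStronglyMeasurable a volume)
    (ha1 : ∀ᵐ t, ‖a t‖ ≤ 1) (hp : MemLp p 2 volume) : MemLp (fun t => a t * p t) 2 volume := by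
  refine hp.of_le (ha.mul hp.1) ?_
  filter_upwards [ha1] with t ht
  rw [norm_mul]
  exact mul_le_of_le_one_left (norm_nonneg _) ht

lemma aestronglyMeasurable_conj {f : ℝ → ℂ} (hf : AEStronglyMeasurable f volume) :
    AEStronglyMeasurable (fun t => conj (f t)) volume :=
  Complex.continuous_conj.comp_aestronglyMeasurable hf

/-- The function through which the scattering function enters the evaluation. -/
lemma memLp_scattered {φ : ℂ → ℂ} (hφ : IsHardyInfty φ) {μ : ℂ} (hμ : 0 < μ.im) :
    MemLp (fun t : ℝ => D.s t * (conj (D.outerLine t) / D.outerLine t) *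
      (boundaryValue φ (-t) * conj (hardyKernel (-t) μ))) 2 volume := by
  have h1 := memLp_comp_neg (f := fun t : ℝ => boundaryValue φ t * conj (hardyKernel t μ))
    (memLp_boundaryValue_mul hφ (memLp_hardyKernel hμ.ne').star)
  simp only [Complex.ofReal_neg] at h1
  refine memLp_mul_of_norm_le_one ?_ ?_ h1
  · have h2 := D.aestronglyMeasurable_outerLine
    exact D.aestronglyMeasurable.mul
      ((aestronglyMeasurable_conj h2).aemeasurable.div h2.aemeasurable).aestronglyMeasurable
  · filter_upwards [D.norm_s_le_one] with t ht
    rw [norm_mul, norm_div, RCLike.norm_conj]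
    exact mul_le_one₀ ht (by positivity) (div_self_le_one _)

/-- The factor conj(s_e φ) turns the direct term into the exact evaluation φ(μ) F(μ). After t ↦ -t
the reflected term is s_e f times e^{2itx} times a function independent of x. -/
lemma scalar_twist_lineExt {x : ℝ} {f F : ℂ → ℂ} (hf : (D.twist x).MemL2 f)
    (hF : HardyPair F fun t => D.outerLine t * f t) {φ : ℂ → ℂ} (hφ : IsHardyInfty φ) {μ : ℂ}
    (hμ : 0 < μ.im) :
    (D.twist x).scalar f
        (lineExt fun t => conj (D.outerLine t * boundaryValue φ t) * hardyKernel t μ) =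
      φ μ * F μ - 1 / (2 * Real.pi) * ∫ t : ℝ, D.outerLine t * f t *
        (Complex.exp (2 * Complex.I * t * x) * (D.s t * (conj (D.outerLine t) / D.outerLine t) *
          (boundaryValue φ (-t) * conj (hardyKernel (-t) μ)))) := by
  have hk := memLp_hardyKernel hμ.ne'
  have hp : MemLp (fun t : ℝ => conj (D.outerLine t * boundaryValue φ t) * hardyKernel t μ) 2
      volume := by
    have h1 := memLp_mul_of_norm_le_one D.aestronglyMeasurable_outerLine D.norm_outerLine_le_one
      (memLp_boundaryValue_mul hφ hk.star)
    refine h1.star.ae_eq (Eventually.of_forall fun t => ?_)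
    simp only [Pi.star_apply, RCLike.star_def, map_mul, Complex.conj_conj]
    ring
  set ρ : ℝ → ℂ := fun t => D.outerLine t * f t *
    (Complex.exp (2 * Complex.I * t * x) * (D.s t * (conj (D.outerLine t) / D.outerLine t) *
      (boundaryValue φ (-t) * conj (hardyKernel (-t) μ)))) with hρ
  have hρi : Integrable ρ := integrable_mul_of_memLp_two hF.memLp
    (memLp_exp_mul x (memLp_scattered hφ hμ))
  have hφF := hF.mul_left hφ hφ.hasBoundaryValues
  have hi : Integrable (fun t : ℝ => boundaryValue φ t * (D.outerLine t * f t) *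
    conj (hardyKernel t μ)) := integrable_mul_of_memLp_two hφF.memLp hk.star
  rw [scalar_lineExt hf hp]
  have hae : ∀ᵐ t : ℝ, (f t - conj ((D.twist x).s t) * f (-t)) *
      conj (conj (D.outerLine t * boundaryValue φ t) * hardyKernel t μ) =
      boundaryValue φ t * (D.outerLine t * f t) * conj (hardyKernel t μ) - ρ (-t) := by
    filter_upwards [D.s_neg, D.outerLine_neg, D.outerLine_ne_zero] with t h1 h2 h3
    have h3' : conj (D.outerLine t) ≠ 0 := (map_ne_zero _).2 h3
    have h4 : conj (Complex.exp (2 * Complex.I * t * x)) =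
        Complex.exp (2 * Complex.I * (-t : ℝ) * x) := by
      rw [← Complex.exp_conj]
      congr 1
      simp [Complex.conj_ofNat]
    simp only [hρ, h1, h2, twist_s, map_mul, Complex.conj_conj, h4, Complex.ofReal_neg, neg_neg]
    field_simp
  rw [integral_congr_ae hae, integral_sub hi hρi.comp_neg, integral_neg_eq_self ρ,
    hφF.integral_mul_conj_kernel hμ]
  have hpi : (Real.pi : ℂ) ≠ 0 := Complex.ofReal_ne_zero.2 Real.pi_ne_zero
  field_simp

end ScatteringData

lemma tendsto_zero_of_forall_ofReal {ι : Type*} {l : Filter ι} {u : ι → ℝ≥0∞} (C : ℝ)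
    (h : ∀ ε : ℝ, 0 < ε → ∀ᶠ i in l, u i ≤ ENNReal.ofReal ((C * ε) ^ 2)) : Tendsto u l (𝓝 0) := by
  rw [ENNReal.tendsto_nhds_zero]
  intro η hη
  have h1 : Tendsto (fun ε : ℝ => ENNReal.ofReal ((C * ε) ^ 2)) (𝓝[>] 0) (𝓝 0) := by
    have : Tendsto (fun ε : ℝ => ENNReal.ofReal ((C * ε) ^ 2)) (𝓝 0)
        (𝓝 (ENNReal.ofReal ((C * 0) ^ 2))) := by
      refine ENNReal.tendsto_ofReal (Continuous.tendsto ?_ 0)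
      fun_prop
    simpa using this.mono_left nhdsWithin_le_nhds
  obtain ⟨ε, hε1, hε⟩ := ((ENNReal.tendsto_nhds_zero.1 h1 η hη).and self_mem_nhdsWithin).exists
  exact (h ε hε).mono fun i hi => hi.trans hε1

namespace ScatteringData

variable {D : ScatteringData}

lemma normSq_sub_le {f g : D.memL2Submodule} {r : ℝ} (h : ‖D.embed f - D.embed g‖ ≤ r) :
    D.normSq (f.1 - g.1) ≤ ENNReal.ofReal (r ^ 2) := by
  have h1 := normSq_embed (f - g)
  rw [map_sub] at h1
  refine (le_of_eq h1).trans (ENNReal.ofReal_le_ofReal ?_)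
  gcongr

lemma norm_embed_sub_le {f g : D.memL2Submodule} {r : ℝ} (hr : 0 ≤ r)
    (h : D.normSq (f.1 - g.1) ≤ ENNReal.ofReal (r ^ 2)) : ‖D.embed f - D.embed g‖ ≤ r := by
  rw [← map_sub]
  exact norm_embed_le hr h

lemma norm_embed_sub_le_of_eLpNorm {f g : D.memL2Submodule} {r : ℝ} (hr : 0 ≤ r)
    (hΛ : ∀ l ∈ D.Λ, f.1 l = g.1 l)
    (h : eLpNorm (fun t : ℝ => f.1 t - g.1 t) 2 volume ≤ ENNReal.ofReal r) :
    ‖D.embed f - D.embed g‖ ≤ r := by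
  refine norm_embed_sub_le hr ((normSq_le_of_eq_zero (f.2.1.sub g.2.1) fun l hl => ?_).trans ?_)
  · rw [Pi.sub_apply, hΛ l hl, sub_self]
  · rw [ENNReal.ofReal_pow hr]
    gcongr
    exact h

lemma tendsto_twist_mass_atTop {l : ℂ} (hl : l ∈ D.Λ) (a : ℝ) :
    Tendsto (fun x => ENNReal.ofReal (a * (D.twist x).ν l)) atTop (𝓝 0) := by
  have hpos := (D.mem_imag l hl).2
  have h1 : Tendsto (fun x : ℝ => -2 * l.im * x) atTop atBot :=
    tendsto_id.const_mul_atTop_of_neg (by linarith)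
  have h2 := ENNReal.tendsto_ofReal
    (((Real.tendsto_exp_atBot.comp h1).const_mul (D.ν l)).const_mul a)
  simpa [twist_ν] using h2

/-- As `x → +∞`, the reproducing kernels are close to the kernel of the standard Hardy space. -/
lemma tendsto_normSq_kernel_sub_atTop {H : ℝ → Set (ℂ → ℂ)} {κ : ℝ → ℂ → ℂ} {μ : ℂ}
    (hμ : 0 < μ.im) (hH : ∀ x, (D.twist x).IsHardySpace (H x))
    (hκ : ∀ x, (D.twist x).IsReproducingKernel (H x) μ (κ x)) :
    Tendsto (fun x => (D.twist x).normSq (κ x - lineExt fun t => hardyKernel t μ)) atTop (𝓝 0) := by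
  classical
  refine tendsto_zero_of_forall_ofReal 8 fun ε hε => ?_
  have hk := memLp_hardyKernel hμ.ne'
  obtain ⟨φ, hφ, hφμ, hφε⟩ := D.exists_outer_mul_near hμ (ENNReal.ofReal_pos.2 hε)
  obtain ⟨S, hS⟩ := (ENNReal.tendsto_nhds_zero.1 (D.blaschkeSet.tendsto_eLpNorm hμ)
    (ENNReal.ofReal ε) (ENNReal.ofReal_pos.2 hε)).exists
  obtain ⟨g, hg, hgt, hgl⟩ := D.exists_generator S (isHardyInfty_hardyKernel hμ)
    (hardyPair_hardyKernel hμ)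
  set p : ℝ → ℂ := fun t => conj (D.outerLine t * boundaryValue φ t) * hardyKernel t μ with hp
  have hpk : eLpNorm (fun t => p t - hardyKernel t μ) 2 volume ≤ ENNReal.ofReal ε := by
    refine le_trans (le_of_eq (eLpNorm_congr_norm_ae (Eventually.of_forall fun t => ?_))) hφε
    simp only [hp]
    rw [← sub_one_mul, norm_mul, norm_mul, ← RCLike.norm_conj (D.outerLine t * _ - 1), map_sub,
      map_one]
  have hpm : AEStronglyMeasurable p volume :=
    (aestronglyMeasurable_conj (D.aestronglyMeasurable_outerLine.mul
      (hφ.hasBoundaryValues.aestronglyMeasurable hφ.1))).mul hk.1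
  have hpL : MemLp p 2 volume := by
    have : MemLp (fun t => p t - hardyKernel t μ) 2 volume :=
      ⟨hpm.sub hk.1, hpk.trans_lt ENNReal.ofReal_lt_top⟩
    exact (this.add hk).ae_eq (Eventually.of_forall fun t => sub_add_cancel (p t) _)
  have hgp : eLpNorm (fun t : ℝ => g t - p t) 2 volume ≤ ENNReal.ofReal (2 * ε) := by
    have h1 : (fun t : ℝ => g t - p t) = (fun t : ℝ =>
        (boundaryValue (blaschke (D.Λ \ S)) t - 1) * hardyKernel t μ) -
        fun t => p t - hardyKernel t μ := by
      ext t
      simp only [hgt, Pi.sub_apply]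
      ring
    have hB := D.blaschkeSet.mono (A' := D.Λ \ S) Set.sdiff_subset
    rw [h1, two_mul, ENNReal.ofReal_add hε.le hε.le]
    refine (eLpNorm_sub_le ?_ (hpm.sub hk.1) one_le_two).trans (add_le_add hS hpk)
    exact ((hB.isHardyInfty.hasBoundaryValues.aestronglyMeasurable hB.differentiableOn).sub
      aestronglyMeasurable_const).mul hk.1
  -- The generator is nonzero only at the points of Λ in the finite set S, and each of their masses
  -- decays as x → +∞.
  have hmass : ∀ᶠ x : ℝ in atTop, ∑ l ∈ S with l ∈ D.Λ,
      ENNReal.ofReal (‖g l‖ ^ 2 * (D.twist x).ν l) ≤ ENNReal.ofReal (ε ^ 2) := by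
    have h1 := tendsto_finsetSum (S.filter (· ∈ D.Λ)) fun l hl =>
      tendsto_twist_mass_atTop (Finset.mem_filter.1 hl).2 (‖g l‖ ^ 2)
    rw [Finset.sum_const_zero] at h1
    exact ENNReal.tendsto_nhds_zero.1 h1 _ (ENNReal.ofReal_pos.2 (by positivity))
  filter_upwards [hmass, eventually_integral_exp_mul_le (D.memLp_scattered hφ hμ) (ENNReal.ofReal ε)
    (ENNReal.ofReal_pos.2 hε)] with x hx1 hx2
  have hκm : (D.twist x).MemL2 (κ x) := ((hκ x).mem_hatH2 (hH x)).1
  have hgx : (D.twist x).IsGenerator g := hg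
  set h' : (D.twist x).memL2Submodule := ⟨lineExt p, memL2_lineExt hpL⟩ with hh'
  set g' : (D.twist x).memL2Submodule := ⟨g, hgx.memL2⟩ with hg'
  set k' : (D.twist x).memL2Submodule := ⟨lineExt fun t => hardyKernel t μ, memL2_lineExt hk⟩
    with hk'
  have h1 : ‖(D.twist x).embed g' - (D.twist x).embed h'‖ ≤ 3 * ε := by
    refine norm_embed_sub_le (by positivity) ((normSq_le (g'.2.1.sub h'.2.1)).trans ?_)
    have h2 : ∑' l : (D.twist x).Λ, ENNReal.ofReal (‖(g'.1 - h'.1) l‖ ^ 2 * (D.twist x).ν l) ≤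
        ENNReal.ofReal (ε ^ 2) := by
      have h3 : ∀ l ∈ D.Λ, (g'.1 - h'.1) l = g l := fun l hl => by
        simp [hg', hh', lineExt_mem p hl]
      refine ((tsum_ofReal_lt_top_of_finset (S.filter (· ∈ D.Λ)) fun l hl hlS => ?_).trans_eq
        (Finset.sum_congr rfl fun l hl => ?_)).trans hx1
      · have hl : l ∈ D.Λ := hl
        have hlS' : l ∉ S := fun h => hlS (Finset.mem_filter.2 ⟨h, hl⟩)
        rw [h3 l hl, hgl l (D.mem_imag l hl).2, (D.blaschkeSet.mono Set.sdiff_subset).eq_zero_of_mem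
          ⟨hl, hlS'⟩, zero_mul]
      · rw [h3 l (Finset.mem_filter.1 hl).2]
    have h4 : eLpNorm (fun t : ℝ => (g'.1 - h'.1) t) 2 volume ≤ ENNReal.ofReal (2 * ε) := by
      simpa [hg', hh', lineExt_ofReal] using hgp
    calc _ ≤ ENNReal.ofReal (ε ^ 2) + ENNReal.ofReal (2 * ε) ^ 2 := by gcongr
      _ ≤ ENNReal.ofReal ((3 * ε) ^ 2) := by
        rw [← ENNReal.ofReal_pow (by positivity), ← ENNReal.ofReal_add (by positivity)
          (by positivity)]
        refine ENNReal.ofReal_le_ofReal ?_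
        nlinarith
  -- Here φ(μ) = 1 / s_e(μ), so the direct term is the value at μ exactly and only the oscillating
  -- integral is left to estimate.
  have h2 := (hκ x).norm_sub_le (hH x) hμ hκm h' g' (c := 1) hε.le hgx h1 fun f _ F hF => by
    rw [outerLine_twist] at hF
    have h3 : 1 / D.outer μ = φ μ := by
      rw [div_eq_iff (D.outer_ne_zero μ), mul_comm]
      exact hφμ.symm
    rw [outer_twist, one_mul]
    change ‖(D.twist x).scalar f.1 (lineExt p) - _‖ ≤ _
    rw [scalar_twist_lineExt f.2 hF hφ hμ, ← h3, one_div_mul_eq_div, sub_sub_cancel_left, norm_neg,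
      norm_mul]
    have h4 := hx2 F _ hF
    have h5 := eLpNorm_outerLine_mul_le f
    rw [outerLine_twist] at h5
    have h6 := h4.trans (mul_le_mul_right h5 (ENNReal.ofReal ε))
    rw [← ENNReal.ofReal_mul hε.le, ← ofReal_norm, ENNReal.ofReal_le_ofReal_iff (by positivity)]
      at h6
    have h7 : ‖(1 / (2 * Real.pi) : ℂ)‖ ≤ 1 / 4 := by
      rw [norm_div, norm_mul, norm_one, Complex.norm_ofNat, Complex.norm_real,
        Real.norm_of_nonneg Real.pi_pos.le]
      exact one_div_le_one_div_of_le (by norm_num) (by linarith [Real.pi_gt_three])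
    calc _ ≤ 1 / 4 * (ε * (4 * ‖(D.twist x).embed f‖)) :=
          mul_le_mul h7 h6 (norm_nonneg _) (by norm_num)
      _ = ε * ‖(D.twist x).embed f‖ := by ring
  have h3 : ‖(D.twist x).embed h' - (D.twist x).embed k'‖ ≤ ε := by
    refine norm_embed_sub_le_of_eLpNorm hε.le (fun l hl => ?_) ?_
    · exact (lineExt_mem (D := D.twist x) p hl).trans
        (lineExt_mem (D := D.twist x) (fun t => hardyKernel t μ) hl).symm
    · simpa [hh', hk', lineExt_ofReal] using hpk
  -- The total is 2 · 3ε + ε from the comparison with h', plus ε for replacing h' by k_μ.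
  refine normSq_sub_le (f := ⟨κ x, hκm⟩) (g := k') ?_
  rw [map_one, one_smul] at h2
  calc _ ≤ _ := norm_sub_le_norm_sub_add_norm_sub _ ((D.twist x).embed h') _
    _ ≤ 8 * ε := by linarith

end ScatteringData

/-! ### The kernels as x → -∞. -/

lemma HardyPair.norm_le_of_eLpNorm_le {G : ℂ → ℂ} {g : ℝ → ℂ} (h : HardyPair G g) {r : ℝ}
    (hr : 0 ≤ r) (hg : eLpNorm g 2 volume ≤ ENNReal.ofReal r) {μ : ℂ} (hμ : 0 < μ.im) :
    ‖G μ‖ ≤ Real.sqrt (Real.pi / μ.im) * r := by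
  have hpi := Real.pi_pos
  have h1 := (h.enorm_sq_le hμ).trans (mul_le_mul_left (pow_le_pow_left' hg 2) _)
  rw [← ofReal_norm, ← ENNReal.ofReal_pow (norm_nonneg _), ← ENNReal.ofReal_pow hr,
    ← ENNReal.ofReal_mul (by positivity), ENNReal.ofReal_le_ofReal_iff (by positivity)] at h1
  refine le_of_sq_le_sq ?_ (by positivity)
  rw [mul_pow, Real.sq_sqrt (by positivity)]
  linarith

namespace ScatteringData

variable {D : ScatteringData}

lemma norm_le_inv_sqrt_mul (f : D.memL2Submodule) {l : ℂ} (hl : l ∈ D.Λ) :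
    ‖f.1 l‖ ≤ (Real.sqrt (D.ν l))⁻¹ * ‖D.embed f‖ := by
  have hν := D.ν_pos l hl
  rw [← div_eq_inv_mul, le_div_iff₀ (Real.sqrt_pos.2 hν)]
  refine le_of_sq_le_sq ?_ (norm_nonneg _)
  rw [mul_pow, Real.sq_sqrt hν.le]
  exact norm_sq_mul_le_norm_embed f hl

lemma tendsto_twist_mass_atBot {l : ℂ} (hl : l ∈ D.Λ) :
    Tendsto (fun x => (D.twist x).ν l) atBot atTop := by
  have hpos := (D.mem_imag l hl).2
  have h1 : Tendsto (fun x : ℝ => -2 * l.im * x) atBot atTop :=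
    tendsto_id.const_mul_atBot_of_neg (by linarith)
  exact (Real.tendsto_exp_atTop.comp h1).const_mul_atTop (D.ν_pos l hl)

lemma hardyPair_apply_eq {f : ℂ → ℂ} (hf : f ∈ D.hatH2) {F : ℂ → ℂ}
    (hF : HardyPair F fun t => D.outerLine t * f t) {l : ℂ} (hl : l ∈ D.Λ) :
    F l = D.outer l * f l := by
  obtain ⟨-, G, hG, hGl⟩ := mem_hatH2_iff.1 hf
  rw [hF.eq_of_ae_eq hG (ae_eq_refl _) (D.mem_imag l hl).2, hGl l hl,
    mul_div_cancel₀ _ (D.outer_ne_zero l)]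

/-- The boundary values of the Blaschke product. -/
noncomputable def blaschkeLine (D : ScatteringData) (t : ℝ) : ℂ := boundaryValue (blaschke D.Λ) t

lemma hasBoundaryValues_blaschke : HasBoundaryValues (blaschke D.Λ) D.blaschkeLine :=
  D.blaschkeSet.isHardyInfty.hasBoundaryValues

lemma aestronglyMeasurable_blaschkeLine : AEStronglyMeasurable D.blaschkeLine volume :=
  hasBoundaryValues_blaschke.aestronglyMeasurable D.blaschkeSet.differentiableOn

lemma norm_blaschkeLine : ∀ᵐ t : ℝ, ‖D.blaschkeLine t‖ = 1 := D.blaschkeSet.norm_boundaryValue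

lemma blaschkeLine_neg : ∀ᵐ t : ℝ, D.blaschkeLine (-t) = conj (D.blaschkeLine t) :=
  hasBoundaryValues_blaschke.boundaryValue_neg D.blaschkeSet.neg_conj

lemma memLp_blaschkeLine_mul {p : ℝ → ℂ} (hp : MemLp p 2 volume) :
    MemLp (fun t => D.blaschkeLine t * p t) 2 volume :=
  memLp_mul_of_norm_le_one aestronglyMeasurable_blaschkeLine
    (norm_blaschkeLine.mono fun _ h => h.le) hp

/-- As `x → -∞`, the lift of the function `B k_μ` nearly represents the evaluation at `μ`. -/
lemma eventually_scalar_dualLift_atBot {μ : ℂ} (hμ : 0 < μ.im) (hμΛ : μ ∉ D.Λ) {ε : ℝ}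
    (hε : 0 < ε) : ∀ᶠ x : ℝ in atBot, ∀ f ∈ (D.twist x).hatSubmodule, ∀ F,
      HardyPair F (fun t => D.outerLine t * f.1 t) →
      ‖(D.twist x).scalar f.1 ((D.twist x).dualLift fun t => D.blaschkeLine t * hardyKernel t μ) -
        D.trans μ * (F μ / D.outer μ)‖ ≤ ε * ‖(D.twist x).embed f‖ := by
  classical
  have hk := memLp_hardyKernel hμ.ne'
  have hBμ := D.blaschkeSet.ne_zero hμ hμΛ
  set K : ℝ := 4 * Real.sqrt (Real.pi / μ.im) / ‖blaschke D.Λ μ‖ with hK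
  have hK0 : 0 ≤ K := by positivity
  -- The three errors below add up to (K + 5/4) δ times the norm of f, where K bounds |F(μ) / B(μ)|.
  set δ : ℝ := ε / (K + 2) with hδdef
  have hδ : 0 < δ := by positivity
  have hδε : (K + 2) * δ = ε := mul_div_cancel₀ _ (by positivity)
  have hlim := tendsto_iff_norm_sub_tendsto_zero.1 (D.blaschkeSet.tendsto_diff hμ)
  -- One finite set must serve twice: the tail product is close to 1 on the line, to replace B by a
  -- finite product, and also close to 1 at μ.
  obtain ⟨S, hS1, hS2⟩ := ((ENNReal.tendsto_nhds_zero.1 (D.blaschkeSet.tendsto_eLpNorm hμ)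
    (ENNReal.ofReal δ) (ENNReal.ofReal_pos.2 hδ)).and (hlim.eventually_le_const hδ)).exists
  set S' := S.filter (· ∈ D.Λ) with hS'
  have hS'Λ : ∀ a ∈ S', a ∈ D.Λ := fun a ha => (Finset.mem_filter.1 ha).2
  have hB := D.blaschkeSet.mono (A' := D.Λ \ S) Set.sdiff_subset
  set P : ℂ → ℂ := fun z => ∏ a ∈ S', blaschkeFactor a z with hP
  have hPμ : P μ ≠ 0 := D.blaschkeSet.prod_ne_zero S hμ hμΛ
  have hPB : blaschke D.Λ μ = P μ * blaschke (D.Λ \ S) μ := D.blaschkeSet.blaschke_eq_mul S hμ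
  have hPt : ∀ t : ℝ, ‖P t‖ = 1 := fun t => by
    rw [hP]
    simp only [norm_prod]
    exact Finset.prod_eq_one fun a ha => norm_blaschkeFactor_ofReal (D.mem_imag a (hS'Λ a ha)).2 t
  have hPbv : HasBoundaryValues P fun t => P t := D.blaschkeSet.hasBoundaryValues_prod S
  have hPm : AEStronglyMeasurable (fun t : ℝ => P t) volume := by
    refine hPbv.aestronglyMeasurable ?_
    have := (D.blaschkeSet.mono (A' := D.Λ ∩ S) Set.inter_subset_left).differentiableOn
    refine this.congr fun z _ => ?_
    rw [← BlaschkeSet.coe_inter, blaschke_coe]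
  have hPB' : ∀ᵐ t : ℝ, D.blaschkeLine t = P t * boundaryValue (blaschke (D.Λ \ S)) t := by
    refine hasBoundaryValues_blaschke.ae_eq ?_
    exact (hPbv.mul hB.isHardyInfty.hasBoundaryValues).congr_upper fun z hz =>
      (D.blaschkeSet.blaschke_eq_mul S hz).symm
  obtain ⟨c, hc⟩ := exists_integral_mul_conj_blaschke S' (fun a ha => (D.mem_imag a (hS'Λ a ha)).2)
    μ hμ fun h => hμΛ (hS'Λ μ h)
  have hPk : MemLp (fun t : ℝ => P t * hardyKernel t μ) 2 volume :=
    memLp_mul_of_norm_le_one hPm (Eventually.of_forall fun t => (hPt t).le) hk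
  have hBk : MemLp (fun t : ℝ => D.blaschkeLine t * hardyKernel t μ) 2 volume :=
    memLp_blaschkeLine_mul hk
  have hdiff : eLpNorm (fun t : ℝ => conj (D.blaschkeLine t * hardyKernel t μ -
      P t * hardyKernel t μ)) 2 volume ≤ ENNReal.ofReal δ := by
    refine le_trans (le_of_eq (eLpNorm_congr_norm_ae ?_)) hS1
    filter_upwards [hPB'] with t ht
    rw [RCLike.norm_conj, ht, mul_assoc, ← mul_sub, norm_mul, hPt, one_mul, ← sub_one_mul]
  -- A function of norm N has values at most N / √ν on Λ, and the masses grow as x → -∞; so the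
  -- values at the zeros of the finite product drop out.
  have hmass : ∀ᶠ x : ℝ in atBot,
      ∑ a ∈ S', ‖c a‖ * (Real.sqrt ((D.twist x).ν a))⁻¹ ≤ δ := by
    have h1 := tendsto_finsetSum S' fun a ha =>
      ((tendsto_inv_atTop_zero.comp (Real.tendsto_sqrt_atTop.comp
        (tendsto_twist_mass_atBot (hS'Λ a ha)))).const_mul ‖c a‖)
    simp only [mul_zero, Finset.sum_const_zero] at h1
    exact h1.eventually_le_const hδ
  filter_upwards [hmass] with x hx f hf F hF
  set N := ‖(D.twist x).embed f‖ with hN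
  have hN0 : 0 ≤ N := norm_nonneg _
  have hA : eLpNorm (fun t : ℝ => D.outerLine t * f.1 t) 2 volume ≤ ENNReal.ofReal (4 * N) := by
    have := eLpNorm_outerLine_mul_le f
    rwa [outerLine_twist] at this
  have hFμ : ‖F μ‖ ≤ Real.sqrt (Real.pi / μ.im) * (4 * N) :=
    hF.norm_le_of_eLpNorm_le (by positivity) hA hμ
  have hFa : ∀ a ∈ S', ‖F a‖ ≤ (Real.sqrt ((D.twist x).ν a))⁻¹ * N := fun a ha => by
    have haΛ : a ∈ (D.twist x).Λ := hS'Λ a ha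
    have hF' : HardyPair F fun t => (D.twist x).outerLine t * f.1 t := by rwa [outerLine_twist]
    rw [hardyPair_apply_eq hf hF' haΛ, norm_mul]
    refine le_trans (mul_le_of_le_one_left (norm_nonneg _) ?_) (norm_le_inv_sqrt_mul f haΛ)
    exact (D.twist x).norm_outer_le_one (D.mem_imag a haΛ).2
  have hscalar : (D.twist x).scalar f.1
      ((D.twist x).dualLift fun t => D.blaschkeLine t * hardyKernel t μ) - D.trans μ *
        (F μ / D.outer μ) = F μ / blaschke D.Λ μ * (blaschke (D.Λ \ S) μ - 1) +
      1 / (2 * Real.pi) * ((∑ a ∈ S', c a * F a) + ∫ t : ℝ, D.outerLine t * f.1 t *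
        conj (D.blaschkeLine t * hardyKernel t μ - P t * hardyKernel t μ)) := by
    have h1 : ∫ t : ℝ, D.outerLine t * f.1 t * conj (D.blaschkeLine t * hardyKernel t μ) =
        (∫ t : ℝ, D.outerLine t * f.1 t * conj (P t * hardyKernel t μ)) +
        ∫ t : ℝ, D.outerLine t * f.1 t *
          conj (D.blaschkeLine t * hardyKernel t μ - P t * hardyKernel t μ) := by
      have i1 : Integrable (fun t : ℝ => D.outerLine t * f.1 t * conj (P t * hardyKernel t μ)) :=
        integrable_mul_of_memLp_two hF.memLp hPk.star
      have i2 : Integrable (fun t : ℝ => D.outerLine t * f.1 t *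
          conj (D.blaschkeLine t * hardyKernel t μ - P t * hardyKernel t μ)) :=
        integrable_mul_of_memLp_two hF.memLp (hBk.sub hPk).star
      rw [← integral_add i1 i2]
      congr with t
      simp only [map_sub]
      ring
    have hpi : (Real.pi : ℂ) ≠ 0 := Complex.ofReal_ne_zero.2 Real.pi_ne_zero
    have hB'μ : blaschke (D.Λ \ S) μ ≠ 0 := fun h => hBμ (by rw [hPB, h, mul_zero])
    have hoμ := D.outer_ne_zero μ
    rw [scalar_dualLift f.2 hBk, outerLine_twist, h1, hc F _ hF, trans, hPB]
    change _ * (2 * Real.pi * (F μ / P μ) + _ + _) - _ = _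
    field_simp
    ring
  have hint : ‖∫ t : ℝ, D.outerLine t * f.1 t *
      conj (D.blaschkeLine t * hardyKernel t μ - P t * hardyKernel t μ)‖ ≤ 4 * N * δ := by
    have h1 := enorm_integral_mul_le hF.memLp.1
      (aestronglyMeasurable_conj (hBk.sub hPk).1)
    have h2 := h1.trans (mul_le_mul' hA hdiff)
    rw [← ENNReal.ofReal_mul (by positivity), ← ofReal_norm,
      ENNReal.ofReal_le_ofReal_iff (by positivity)] at h2
    exact h2
  have hsum : ‖∑ a ∈ S', c a * F a‖ ≤ δ * N := by
    refine (norm_sum_le _ _).trans (le_trans (Finset.sum_le_sum fun a ha => ?_)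
      (le_trans (Finset.sum_mul _ _ N).symm.le (mul_le_mul_of_nonneg_right hx hN0)))
    rw [norm_mul, mul_assoc]
    exact mul_le_mul_of_nonneg_left (hFa a ha) (norm_nonneg _)
  have h7 : ‖(1 / (2 * Real.pi) : ℂ)‖ ≤ 1 / 4 := by
    rw [norm_div, norm_mul, norm_one, Complex.norm_ofNat, Complex.norm_real,
      Real.norm_of_nonneg Real.pi_pos.le]
    exact one_div_le_one_div_of_le (by norm_num) (by linarith [Real.pi_gt_three])
  rw [hscalar]
  calc _ ≤ K * N * δ + 1 / 4 * (δ * N + 4 * N * δ) := by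
        refine (norm_add_le _ _).trans (add_le_add ?_ ?_)
        · rw [norm_mul, norm_div]
          refine mul_le_mul ?_ hS2 (norm_nonneg _) (by positivity)
          calc ‖F μ‖ / ‖blaschke D.Λ μ‖
              ≤ Real.sqrt (Real.pi / μ.im) * (4 * N) / ‖blaschke D.Λ μ‖ := by gcongr
            _ = K * N := by rw [hK]; ring
        · rw [norm_mul]
          exact mul_le_mul h7 ((norm_add_le _ _).trans (add_le_add hsum hint)) (norm_nonneg _)
            (by norm_num)
    _ ≤ (K + 2) * δ * N := by nlinarith [mul_nonneg hN0 hδ.le]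
    _ = ε * N := by rw [hδε]

end ScatteringData

namespace ScatteringData

variable {D : ScatteringData}

lemma dualLift_sub (u v : ℝ → ℂ) :
    D.dualLift u - D.dualLift v = D.dualLift fun t => u t - v t := by
  ext z
  simp only [dualLift, lineExt, Pi.sub_apply]
  split_ifs
  · ring
  · ring

lemma dualLift_mem (u : ℝ → ℂ) {l : ℂ} (hl : l ∈ D.Λ) : D.dualLift u l = 0 := lineExt_mem _ hl

/-- As `x → -∞`, the lift of the function `B k_μ` is close to the generators. -/
lemma eventually_exists_generator_near_dualLift {μ : ℂ} (hμ : 0 < μ.im) {ε : ℝ} (hε : 0 < ε) :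
    ∀ᶠ x : ℝ in atBot, ∃ g : (D.twist x).memL2Submodule, (D.twist x).IsGenerator g.1 ∧
      ∀ h : (D.twist x).memL2Submodule,
        h.1 = ((D.twist x).dualLift fun t => D.blaschkeLine t * hardyKernel t μ) →
        ‖(D.twist x).embed g - (D.twist x).embed h‖ ≤ 3 * ε := by
  have hk := memLp_hardyKernel hμ.ne'
  have hεpos := ENNReal.ofReal_pos.2 hε
  obtain ⟨φ, hφ, -, hφε⟩ := D.exists_outer_mul_near hμ hεpos
  -- The factor s_e cancels the denominator in the lift, so that the direct term of the lift of ψ is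
  -- B times the bounded function φ k_μ.
  set ψ : ℝ → ℂ := fun t => D.blaschkeLine t * (D.outerLine t * (boundaryValue φ t * hardyKernel t μ))
    with hψdef
  have hψ : MemLp ψ 2 volume := memLp_blaschkeLine_mul (memLp_mul_of_norm_le_one
    D.aestronglyMeasurable_outerLine D.norm_outerLine_le_one (memLp_boundaryValue_mul hφ hk))
  have hBk := memLp_blaschkeLine_mul (D := D) hk
  have hBm := aestronglyMeasurable_conj (aestronglyMeasurable_blaschkeLine (D := D))
  -- The reflected term of the lift of ψ equals B e^{-2itx} w. One conjugate of B comes from B(-t),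
  -- the other from factoring out B.
  set w : ℝ → ℂ := fun t => conj (D.s t) * conj (D.blaschkeLine t) * conj (D.blaschkeLine t) *
    (boundaryValue φ (-t) * hardyKernel (-t) μ) with hwdef
  have hw : MemLp w 2 volume := by
    have h1 := memLp_comp_neg (f := fun t : ℝ => boundaryValue φ t * hardyKernel t μ)
      (memLp_boundaryValue_mul hφ hk)
    simp only [Complex.ofReal_neg] at h1
    refine memLp_mul_of_norm_le_one
      (((aestronglyMeasurable_conj D.aestronglyMeasurable).mul hBm).mul hBm) ?_ h1
    filter_upwards [D.norm_s_le_one, D.norm_blaschkeLine] with t h2 h3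
    rw [norm_mul, norm_mul, RCLike.norm_conj, RCLike.norm_conj, h3, mul_one, mul_one]
    exact h2
  filter_upwards [tendsto_neg_atBot_atTop.eventually
    (eventually_exp_mul_near_hardy hw (ENNReal.ofReal ε) hεpos)] with x hx
  obtain ⟨W, w', hW, hw'⟩ := hx
  obtain ⟨V, v, hV, hVi, hv⟩ := hW.exists_bounded_near hεpos
  have hφk := (hardyPair_hardyKernel hμ).mul_left hφ hφ.hasBoundaryValues
  -- The full Blaschke product is kept, so this generator vanishes on Λ as the lift does, and only
  -- the line contributes to the distance.
  obtain ⟨g, hg, hgt, hgl⟩ := (D.twist x).exists_generator ∅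
    ((hφ.mul (isHardyInfty_hardyKernel hμ)).add hVi) (hφk.add hV)
  set g' : (D.twist x).memL2Submodule := ⟨g, hg.memL2⟩ with hg'
  refine ⟨g', hg, fun h hh => ?_⟩
  have hgΛ : ∀ l ∈ (D.twist x).Λ, g l = 0 := fun l hl => by
    rw [hgl l ((D.twist x).mem_imag l hl).2, ((D.twist x).blaschkeSet.mono
      Set.sdiff_subset).eq_zero_of_mem ⟨hl, by simp⟩, zero_mul]
  have hgB : ∀ t : ℝ, g t = D.blaschkeLine t * (boundaryValue φ t * hardyKernel t μ + v t) := by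
    intro t
    rw [hgt, Finset.coe_empty, Set.sdiff_empty]
    rfl
  set ψ' : (D.twist x).memL2Submodule := ⟨(D.twist x).dualLift ψ, memL2_dualLift hψ⟩ with hψ'
  have h1 : ‖(D.twist x).embed g' - (D.twist x).embed ψ'‖ ≤ 2 * ε := by
    refine norm_embed_sub_le_of_eLpNorm (by positivity) (fun l hl => ?_) ?_
    · exact (hgΛ l hl).trans (dualLift_mem ψ hl).symm
    have h2 : eLpNorm (fun t : ℝ => g'.1 t - ψ'.1 t) 2 volume = eLpNorm ((fun t => v t - w' t) -
        fun t : ℝ => Complex.exp (2 * Complex.I * t * (-x : ℝ)) * w t - w' t) 2 volume := by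
      refine eLpNorm_congr_norm_ae ?_
      filter_upwards [D.norm_blaschkeLine, D.blaschkeLine_neg, D.outerLine_neg,
        D.outerLine_ne_zero] with t e1 e2 e3 e4
      have e4' : conj (D.outerLine t) ≠ 0 := (map_ne_zero _).2 e4
      have e5 : D.blaschkeLine t * conj (D.blaschkeLine t) = 1 := by
        rw [Complex.mul_conj', e1]; simp
      have e6 : conj (Complex.exp (2 * Complex.I * t * x)) =
          Complex.exp (2 * Complex.I * t * (-x : ℝ)) := by
        rw [← Complex.exp_conj]
        congr 1
        simp [Complex.conj_ofNat]
      have e7 : g'.1 t - ψ'.1 t = D.blaschkeLine t *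
          (v t - Complex.exp (2 * Complex.I * t * (-x : ℝ)) * w t) := by
        change g t - (D.twist x).dualLift ψ t = _
        rw [hgB, dualLift_ofReal, outerLine_twist, twist_s, map_mul, e6]
        generalize Complex.exp (2 * Complex.I * t * (-x : ℝ)) = E
        simp only [hψdef, hwdef, e2, e3, Complex.ofReal_neg]
        field_simp
        linear_combination (E * conj (D.s t) *
          conj (D.blaschkeLine t) * boundaryValue φ (-t) * hardyKernel (-t) μ) * e5
      rw [e7, norm_mul, e1, one_mul]
      simp
    have h3 : ENNReal.ofReal (2 * ε) = ENNReal.ofReal ε + ENNReal.ofReal ε := by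
      rw [two_mul, ENNReal.ofReal_add hε.le hε.le]
    rw [h2, h3]
    refine (eLpNorm_sub_le (hV.memLp.sub hW.memLp).1 ?_ one_le_two).trans (add_le_add hv hw')
    exact ((memLp_exp_mul (-x) hw).sub hW.memLp).1
  have h2 : ‖(D.twist x).embed ψ' - (D.twist x).embed h‖ ≤ ε := by
    refine norm_embed_sub_le hε.le ?_
    rw [hh]
    change (D.twist x).normSq ((D.twist x).dualLift ψ - _) ≤ _
    rw [dualLift_sub]
    refine (normSq_dualLift_le (hψ.sub hBk)).trans ?_
    rw [ENNReal.ofReal_pow hε.le]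
    gcongr
    refine le_trans (le_of_eq (eLpNorm_congr_norm_ae ?_)) hφε
    filter_upwards [D.norm_blaschkeLine] with t ht
    simp only [hψdef, Pi.sub_apply]
    rw [← mul_sub, norm_mul, ht, one_mul, sub_one_mul, mul_assoc]
  calc _ ≤ _ := norm_sub_le_norm_sub_add_norm_sub _ ((D.twist x).embed ψ') _
    _ ≤ 3 * ε := by linarith

/-- As `x → -∞`, the reproducing kernels are close to a lift of the function `B k_μ`. -/
lemma tendsto_normSq_kernel_sub_atBot {H : ℝ → Set (ℂ → ℂ)} {κ : ℝ → ℂ → ℂ} {μ : ℂ}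
    (hμ : 0 < μ.im) (hμΛ : μ ∉ D.Λ) (hH : ∀ x, (D.twist x).IsHardySpace (H x))
    (hκ : ∀ x, (D.twist x).IsReproducingKernel (H x) μ (κ x)) :
    Tendsto (fun x => (D.twist x).normSq (conj (D.trans μ) • κ x -
      (D.twist x).dualLift fun t => D.blaschkeLine t * hardyKernel t μ)) atBot (𝓝 0) := by
  refine tendsto_zero_of_forall_ofReal 7 fun ε hε => ?_
  filter_upwards [eventually_exists_generator_near_dualLift (D := D) hμ hε,
    eventually_scalar_dualLift_atBot hμ hμΛ hε] with x hx1 hx2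
  obtain ⟨g, hg, hgh⟩ := hx1
  have hκm : (D.twist x).MemL2 (κ x) := ((hκ x).mem_hatH2 (hH x)).1
  set h : (D.twist x).memL2Submodule := ⟨_, memL2_dualLift (D := D.twist x)
    (memLp_blaschkeLine_mul (D := D) (memLp_hardyKernel hμ.ne'))⟩ with hh
  have h1 := (hκ x).norm_sub_le (hH x) hμ hκm h g (c := D.trans μ) hε.le hg (hgh h rfl)
    fun f hf F hF => by
      rw [outerLine_twist] at hF
      rw [outer_twist]
      exact hx2 f hf F hF
  rw [← map_smul] at h1
  have h2 := normSq_sub_le (h1.trans_eq (show 2 * (3 * ε) + ε = 7 * ε by ring))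
  rwa [Submodule.coe_smul] at h2

/-! ### The transmission coefficient on the line -/

lemma transLine_ae_eq : ∀ᵐ t : ℝ, D.transLine t = D.outerLine t / D.blaschkeLine t := by
  filter_upwards [D.hasBoundaryValues_outer, hasBoundaryValues_blaschke (D := D),
    D.norm_blaschkeLine] with t h1 h2 h3
  refine (h1.div h2 fun h => ?_).limUnder_eq
  rw [h, norm_zero] at h3
  exact zero_ne_one h3

lemma norm_transLine : ∀ᵐ t : ℝ, ‖D.transLine t‖ = ‖D.outerLine t‖ := by
  filter_upwards [transLine_ae_eq (D := D), norm_blaschkeLine (D := D)] with t h1 h2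
  rw [h1, norm_div, h2, div_one]

/-- The comparison of kernels produces conj(s(μ)), which the symmetry of the data identifies with
s(-conj μ). -/
lemma trans_neg_conj (μ : ℂ) : D.trans (-conj μ) = conj (D.trans μ) := by
  rw [trans, trans, D.outer_neg_conj, D.blaschkeSet.neg_conj, map_div₀]

lemma norm_exp_I_mul (t x : ℝ) : ‖Complex.exp (Complex.I * t * x)‖ = 1 := by
  simp [Complex.norm_exp]

lemma tendsto_eLpNorm_outerLine_mul {F : Filter ℝ} {f : ℝ → ℂ → ℂ}
    (hf : ∀ x, AEStronglyMeasurable (fun t : ℝ => f x t) volume)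
    (h : Tendsto (fun x => (D.twist x).normSq (f x)) F (𝓝 0)) :
    Tendsto (fun x => eLpNorm (fun t : ℝ => D.outerLine t * f x t) 2 volume) F (𝓝 0) := by
  refine tendsto_zero_of_sq ?_
  have h1 : Tendsto (fun x => ENNReal.ofReal (4 * Real.pi) * (D.twist x).normSq (f x)) F (𝓝 0) := by
    have h2 := ENNReal.Tendsto.const_mul (a := ENNReal.ofReal (4 * Real.pi)) h
      (Or.inr ENNReal.ofReal_ne_top)
    rwa [mul_zero] at h2
  refine tendsto_of_tendsto_of_tendsto_of_le_of_le tendsto_const_nhds h1 (fun _ => zero_le)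
    fun x => ?_
  have := eLpNorm_outerLine_mul_sq_le (D := D.twist x) (hf x)
  rwa [outerLine_twist] at this

section Asymptotics

variable {H : ℝ → Set (ℂ → ℂ)} {κ : ℝ → ℂ → ℂ} {μ : ℂ}

lemma asympL2_atTop (hμ : 0 < μ.im) (hH : ∀ x, (D.twist x).IsHardySpace (H x))
    (hκ : ∀ x, (D.twist x).IsReproducingKernel (H x) μ (κ x)) :
    AsympL2 atTop (fun x t => D.transLine t * (Complex.exp (Complex.I * t * x) * κ x t))
      (fun x t => D.transLine t * Complex.exp (Complex.I * t * x) * hardyKernel t μ) := by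
  have h1 := tendsto_normSq_kernel_sub_atTop hμ hH hκ
  refine (tendsto_eLpNorm_outerLine_mul (D := D) (fun x => ?_) h1).congr fun x => ?_
  · exact ((hκ x).mem_hatH2 (hH x)).1.1.sub (memL2_lineExt (D := D) (memLp_hardyKernel hμ.ne')).1
  · refine eLpNorm_congr_norm_ae ?_
    filter_upwards [D.norm_transLine] with t ht
    have h2 : D.transLine t * (Complex.exp (Complex.I * t * x) * κ x t) -
        D.transLine t * Complex.exp (Complex.I * t * x) * hardyKernel t μ =
        D.transLine t * Complex.exp (Complex.I * t * x) * (κ x t - hardyKernel t μ) := by ring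
    rw [h2, norm_mul, norm_mul, norm_mul, ht, norm_exp_I_mul, mul_one, Pi.sub_apply,
      lineExt_ofReal]

/-- Since |e^{ilx}|² = e^{-2 Im l x}, the sum is exactly the part over Λ of the twisted norm, and
the approximating function is zero there. -/
lemma vanishesL2Nu_atTop (hμ : 0 < μ.im) (hH : ∀ x, (D.twist x).IsHardySpace (H x))
    (hκ : ∀ x, (D.twist x).IsReproducingKernel (H x) μ (κ x)) :
    VanishesL2Nu D atTop (fun x l => Complex.exp (Complex.I * l * x) * κ x l) := by
  have h1 := tendsto_normSq_kernel_sub_atTop hμ hH hκ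
  refine tendsto_of_tendsto_of_tendsto_of_le_of_le tendsto_const_nhds h1 (fun _ => zero_le)
    fun x => ?_
  refine le_trans (le_of_eq (tsum_congr fun l => ?_)) le_self_add
  congr 1
  have h2 : ‖Complex.exp (Complex.I * l * x)‖ = Real.exp (-(l : ℂ).im * x) := by
    simp [Complex.norm_exp]
  rw [Pi.sub_apply, lineExt_mem (D := D) _ l.2, sub_zero, norm_mul, h2, twist_ν, mul_pow,
    ← Real.exp_nat_mul]
  have h3 : ((2 : ℕ) : ℝ) * (-(l : ℂ).im * x) = -2 * (l : ℂ).im * x := by push_cast; ring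
  rw [h3]
  ring

/-- On the line s e^{itx} times the lift of B k_μ is exactly the claimed right-hand side, and |s| =
|s_e|; so the norm comparison bounds the difference. -/
lemma asympL2_atBot (hμ : 0 < μ.im) (hμΛ : μ ∉ D.Λ) (hH : ∀ x, (D.twist x).IsHardySpace (H x))
    (hκ : ∀ x, (D.twist x).IsReproducingKernel (H x) μ (κ x)) :
    AsympL2 atBot (fun x t => D.trans (-conj μ) * D.transLine t *
        (Complex.exp (Complex.I * t * x) * κ x t))
      (fun x t => Complex.exp (Complex.I * t * x) * hardyKernel t μ +
        D.sMinus t * Complex.exp (-Complex.I * t * x) * hardyKernel t (-μ)) := by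
  have h1 := tendsto_normSq_kernel_sub_atBot hμ hμΛ hH hκ
  refine (tendsto_eLpNorm_outerLine_mul (D := D) (fun x => ?_) h1).congr fun x => ?_
  · exact (((hκ x).mem_hatH2 (hH x)).1.1.const_smul (conj (D.trans μ))).sub
      (aestronglyMeasurable_dualLift (memLp_blaschkeLine_mul (memLp_hardyKernel hμ.ne')))
  · refine eLpNorm_congr_norm_ae ?_
    filter_upwards [D.transLine_ae_eq, D.norm_transLine, D.norm_blaschkeLine, D.blaschkeLine_neg,
      D.outerLine_ne_zero] with t e1 e0 e2 e3 e4
    have e4' : conj (D.outerLine t) ≠ 0 := (map_ne_zero _).2 e4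
    have e5 : D.blaschkeLine t ≠ 0 := by
      rw [← norm_ne_zero_iff, e2]; exact one_ne_zero
    have e5' : conj (D.blaschkeLine t) ≠ 0 := (map_ne_zero _).2 e5
    have e6 : conj (Complex.exp (2 * Complex.I * t * x)) * Complex.exp (Complex.I * t * x) =
        Complex.exp (-Complex.I * t * x) := by
      rw [← Complex.exp_conj, ← Complex.exp_add]
      congr 1
      simp only [map_mul, Complex.conj_ofNat, Complex.conj_I, Complex.conj_ofReal]
      ring
    have e7 : hardyKernel (-t) μ = -hardyKernel t (-μ) := by
      unfold hardyKernel
      rw [map_neg, ← div_neg]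
      congr 1
      ring
    have e8 : D.transLine t * Complex.exp (Complex.I * t * x) *
        (D.twist x).dualLift (fun t => D.blaschkeLine t * hardyKernel t μ) t =
        Complex.exp (Complex.I * t * x) * hardyKernel t μ +
          D.sMinus t * Complex.exp (-Complex.I * t * x) * hardyKernel t (-μ) := by
      rw [dualLift_ofReal, outerLine_twist, twist_s, map_mul, ← e6, sMinus, e1, e3, map_div₀,
        Complex.ofReal_neg, e7]
      field_simp
    rw [← e8, trans_neg_conj]
    have e9 : conj (D.trans μ) * D.transLine t * (Complex.exp (Complex.I * t * x) * κ x t) -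
        D.transLine t * Complex.exp (Complex.I * t * x) *
          (D.twist x).dualLift (fun t => D.blaschkeLine t * hardyKernel t μ) t =
        D.transLine t * Complex.exp (Complex.I * t * x) * ((conj (D.trans μ) • κ x -
          (D.twist x).dualLift fun t => D.blaschkeLine t * hardyKernel t μ) t) := by
      simp only [Pi.sub_apply, Pi.smul_apply, smul_eq_mul]
      ring
    rw [e9, norm_mul, norm_mul, norm_mul, norm_exp_I_mul, mul_one, e0]

end Asymptotics

end ScatteringData

/-! ### The diagonal of the kernels at points of Λ. -/

namespace ScatteringData

variable {D : ScatteringData}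

lemma IsGenerator.mem_of_isHardySpace {f : ℂ → ℂ} (hf : D.IsGenerator f) {H : Set (ℂ → ℂ)}
    (hH : D.IsHardySpace H) : f ∈ H := by
  obtain ⟨M, -, hM, -, hHM⟩ := hH
  exact (hHM f).2 ⟨hf.memL2, hM ⟨⟨f, hf.memL2⟩, hf, rfl⟩⟩

lemma IsReproducingKernel.apply_self {H : Set (ℂ → ℂ)} {μ : ℂ} {κ : ℂ → ℂ}
    (hκ : D.IsReproducingKernel H μ κ) (hH : D.IsHardySpace H) (hμ : 0 < μ.im)
    (hκm : D.MemL2 κ) : κ μ = (‖D.embed ⟨κ, hκm⟩‖ ^ 2 : ℝ) := by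
  obtain ⟨K, hK, hKz⟩ := hκ.exists_hardyPair hH
  have h1 := inner_embed (⟨κ, hκm⟩ : D.memL2Submodule) ⟨κ, hκm⟩
  rw [inner_self_eq_norm_sq_to_K] at h1
  rw [hKz μ hμ, ← hκ.scalar_eq hμ hκ.1 hK]
  refine h1.symm.trans ?_
  simp

lemma IsReproducingKernel.norm_apply_sq_le {H : Set (ℂ → ℂ)} {l : ℂ} {κ : ℂ → ℂ}
    (hκ : D.IsReproducingKernel H l κ) (hH : D.IsHardySpace H) (hl : l ∈ D.Λ)
    (hκm : D.MemL2 κ) {g : ℂ → ℂ} (hg : D.IsGenerator g) :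
    ‖g l‖ ^ 2 ≤ ‖D.embed ⟨g, hg.memL2⟩‖ ^ 2 * ‖D.embed ⟨κ, hκm⟩‖ ^ 2 := by
  obtain ⟨-, G, hG, hGl⟩ := mem_hatH2_iff.1 hg.mem_hatH2
  have h1 := hκ.scalar_eq (D.mem_imag l hl).2 (hg.mem_of_isHardySpace hH) hG
  rw [← hGl l hl] at h1
  have h2 := inner_embed (⟨g, hg.memL2⟩ : D.memL2Submodule) ⟨κ, hκm⟩
  rw [← h1, ← mul_pow]
  gcongr
  refine le_trans (le_of_eq (congrArg norm h2.symm)) ?_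
  rw [mul_comm]
  exact norm_inner_le_norm _ _

/-- The growth of the diagonal of the kernels at a point of `Λ`, as `x → -∞`. -/
lemma tendsto_exp_mul_kernel_atBot {H : ℝ → Set (ℂ → ℂ)} {κ : ℝ → ℂ → ℂ} {l : ℂ} (hl : l ∈ D.Λ)
    (hH : ∀ x, (D.twist x).IsHardySpace (H x))
    (hκ : ∀ x, (D.twist x).IsReproducingKernel (H x) l (κ x)) :
    Tendsto (fun x : ℝ => (Real.exp (-2 * l.im * x) : ℂ) * κ x l) atBot (𝓝 (1 / (D.ν l : ℂ))) := by
  have hlim := (D.mem_imag l hl).2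
  have hν := D.ν_pos l hl
  have hκm : ∀ x, (D.twist x).MemL2 (κ x) := fun x => ((hκ x).mem_hatH2 (hH x)).1
  set N : ℝ → ℝ := fun x => ‖(D.twist x).embed ⟨κ x, hκm x⟩‖ ^ 2 with hN
  set E : ℝ → ℝ := fun x => Real.exp (-2 * l.im * x) with hE
  have hE0 : ∀ x, 0 < E x := fun x => Real.exp_pos _
  have hEtop : Tendsto E atBot atTop :=
    Real.tendsto_exp_atTop.comp (tendsto_id.const_mul_atBot_of_neg (by linarith))
  have hNκ : ∀ x, κ x l = (N x : ℝ) := fun x => (hκ x).apply_self (hH x) hlim (hκm x)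
  have hN0 : ∀ x, 0 ≤ N x := fun x => sq_nonneg _
  -- The single term at l of the norm of κ is κ(l)² ν E with κ(l) = N = ‖κ‖², so N² ν E ≤ N.
  have hupper : ∀ x, E x * N x ≤ 1 / D.ν l := by
    intro x
    have h1 : ‖κ x l‖ ^ 2 * (D.ν l * E x) ≤ N x :=
      norm_sq_mul_le_norm_embed (D := D.twist x) ⟨κ x, hκm x⟩ hl
    rw [hNκ, Complex.norm_real, Real.norm_of_nonneg (hN0 x)] at h1
    rw [le_div_iff₀ hν]
    rcases (hN0 x).eq_or_lt with h0 | h0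
    · rw [← h0]; simp
    · refine le_of_mul_le_mul_left ?_ h0
      nlinarith
  have hB := D.blaschkeSet.mono (A' := D.Λ \ ({l} : Finset ℂ)) Set.sdiff_subset
  -- Omitting only the factor at l gives a generator independent of x that is nonzero at l and zero
  -- at all other points of Λ. Its norm is then the single term at l plus a bound C independent of
  -- x, which is negligible as E → ∞.
  obtain ⟨g, hg, hgt, hgz⟩ := D.exists_generator {l} (isHardyInfty_hardyKernel hlim)
    (hardyPair_hardyKernel hlim)
  have hgl : 0 < ‖g l‖ := by
    rw [norm_pos_iff, hgz l hlim]
    exact mul_ne_zero (hB.ne_zero hlim (by simp)) (hardyKernel_ne_zero hlim.le hlim)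
  have hgL : MemLp (fun t : ℝ => g t) 2 volume := by
    obtain ⟨_, F, hF, -, -⟩ := hg.hardyPair
    exact hF.memLp
  set C : ℝ := (eLpNorm (fun t : ℝ => g t) 2 volume).toReal ^ 2 with hC
  have hC0 : 0 ≤ C := sq_nonneg _
  have hgnorm : ∀ x, ‖(D.twist x).embed ⟨g, IsGenerator.memL2 (D := D.twist x) hg⟩‖ ^ 2 ≤
      ‖g l‖ ^ 2 * (D.ν l * E x) + C := by
    intro x
    have hgx : (D.twist x).IsGenerator g := hg
    have h1 := normSq_embed (D := D.twist x) ⟨g, hgx.memL2⟩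
    have h2 : (D.twist x).normSq g ≤ ENNReal.ofReal (‖g l‖ ^ 2 * (D.ν l * E x) + C) := by
      refine (normSq_le hgL.1).trans ?_
      rw [ENNReal.ofReal_add (by have := hE0 x; positivity) hC0]
      refine add_le_add ?_ ?_
      · refine (tsum_ofReal_lt_top_of_finset {l} fun a ha hal => ?_).trans_eq
          (Finset.sum_singleton _ _)
        have ha : a ∈ D.Λ := ha
        rw [hgz a (D.mem_imag a ha).2, hB.eq_zero_of_mem ⟨ha, by simpa using hal⟩, zero_mul]
      · rw [hC, ENNReal.ofReal_pow ENNReal.toReal_nonneg, ENNReal.ofReal_toReal hgL.2.ne]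
    rw [h1, ENNReal.ofReal_le_ofReal_iff (by have := hE0 x; positivity)] at h2
    exact h2
  -- Cauchy-Schwarz for g(l) = ⟨g, κ⟩, divided by E.
  have hlower : ∀ x, ‖g l‖ ^ 2 / (‖g l‖ ^ 2 * D.ν l + C / E x) ≤ E x * N x := by
    intro x
    have h1 : ‖g l‖ ^ 2 ≤ (‖g l‖ ^ 2 * (D.ν l * E x) + C) * N x :=
      ((hκ x).norm_apply_sq_le (hH x) hl (hκm x) (g := g) hg).trans
        (mul_le_mul_of_nonneg_right (hgnorm x) (hN0 x))
    have h2 := hE0 x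
    rw [div_le_iff₀ (by positivity)]
    refine h1.trans_eq ?_
    field_simp
  have hlow : Tendsto (fun x => ‖g l‖ ^ 2 / (‖g l‖ ^ 2 * D.ν l + C / E x)) atBot
      (𝓝 (1 / D.ν l)) := by
    have h1 : Tendsto (fun x => C / E x) atBot (𝓝 0) := hEtop.const_div_atTop C
    have h2 := (tendsto_const_nhds (x := ‖g l‖ ^ 2)).div (h1.const_add (‖g l‖ ^ 2 * D.ν l))
      (by rw [add_zero]; positivity)
    have h3 : ‖g l‖ ^ 2 / (‖g l‖ ^ 2 * D.ν l + 0) = 1 / D.ν l := by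
      field_simp
      ring
    rwa [h3] at h2
  have hreal : Tendsto (fun x => E x * N x) atBot (𝓝 (1 / D.ν l)) :=
    tendsto_of_tendsto_of_tendsto_of_le_of_le hlow tendsto_const_nhds hlower hupper
  have h4 := (Complex.continuous_ofReal.tendsto _).comp hreal
  have h5 : ((1 / D.ν l : ℝ) : ℂ) = 1 / (D.ν l : ℂ) := by push_cast; rfl
  rw [h5] at h4
  refine h4.congr fun x => ?_
  rw [Function.comp_apply, hNκ]
  exact Complex.ofReal_mul _ _

end ScatteringData

theorem theorem1p2 (D : ScatteringData) :
    -- the reproducing kernels exist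
    (∀ (x : ℝ) (μ : ℂ), 0 < μ.im →
      (D.twist x).IsReproducingKernel (D.twist x).H2 μ (fun z => (D.twist x).kernel z μ) ∧
      (D.twist x).IsReproducingKernel (D.twist x).hatH2 μ (fun z => (D.twist x).hatKernel z μ)) ∧
    (∀ μ : ℂ, 0 < μ.im →
      -- on the real line, as `x → +∞`
      AsympL2 atTop
        (fun x t => D.transLine t * (Complex.exp (Complex.I * t * x) * (D.twist x).kernel t μ))
        (fun x t => D.transLine t * Complex.exp (Complex.I * t * x) * hardyKernel t μ) ∧
      AsympL2 atTop
        (fun x t => D.transLine t * (Complex.exp (Complex.I * t * x) * (D.twist x).hatKernel t μ))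
        (fun x t => D.transLine t * Complex.exp (Complex.I * t * x) * hardyKernel t μ) ∧
      -- on the real line, as `x → -∞`
      (μ ∉ D.Λ →
        AsympL2 atBot
          (fun x t => D.trans (-(starRingEnd ℂ) μ) * D.transLine t *
            (Complex.exp (Complex.I * t * x) * (D.twist x).kernel t μ))
          (fun x t => Complex.exp (Complex.I * t * x) * hardyKernel t μ +
            D.sMinus t * Complex.exp (-Complex.I * t * x) * hardyKernel t (-μ)) ∧
        AsympL2 atBot
          (fun x t => D.trans (-(starRingEnd ℂ) μ) * D.transLine t *
            (Complex.exp (Complex.I * t * x) * (D.twist x).hatKernel t μ))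
          (fun x t => Complex.exp (Complex.I * t * x) * hardyKernel t μ +
            D.sMinus t * Complex.exp (-Complex.I * t * x) * hardyKernel t (-μ))) ∧
      -- on `Λ`, as `x → +∞`
      VanishesL2Nu D atTop
        (fun x l => Complex.exp (Complex.I * l * x) * (D.twist x).kernel l μ) ∧
      VanishesL2Nu D atTop
        (fun x l => Complex.exp (Complex.I * l * x) * (D.twist x).hatKernel l μ)) ∧
    -- at a point of `Λ`, as `x → -∞`
    (∀ l ∈ D.Λ,
      Tendsto (fun x : ℝ => (Real.exp (-2 * l.im * x) : ℂ) * (D.twist x).kernel l l)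
        atBot (𝓝 (1 / (D.ν l : ℂ))) ∧
      Tendsto (fun x : ℝ => (Real.exp (-2 * l.im * x) : ℂ) * (D.twist x).hatKernel l l)
        atBot (𝓝 (1 / (D.ν l : ℂ)))) := by
  have hH := fun x => ScatteringData.isHardySpace_H2 (D := D.twist x)
  have hH' := fun x => ScatteringData.isHardySpace_hatH2 (D := D.twist x)
  have hκ := fun (μ : ℂ) (hμ : 0 < μ.im) (x : ℝ) =>
    ScatteringData.isReproducingKernel_kernel (D := D.twist x) hμ
  have hκ' := fun (μ : ℂ) (hμ : 0 < μ.im) (x : ℝ) =>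
    ScatteringData.isReproducingKernel_hatKernel (D := D.twist x) hμ
  refine ⟨fun x μ hμ => ⟨hκ μ hμ x, hκ' μ hμ x⟩, fun μ hμ => ⟨?_, ?_, fun hμΛ => ⟨?_, ?_⟩, ?_, ?_⟩,
    fun l hl => ⟨?_, ?_⟩⟩
  · exact ScatteringData.asympL2_atTop hμ hH (hκ μ hμ)
  · exact ScatteringData.asympL2_atTop hμ hH' (hκ' μ hμ)
  · exact ScatteringData.asympL2_atBot hμ hμΛ hH (hκ μ hμ)
  · exact ScatteringData.asympL2_atBot hμ hμΛ hH' (hκ' μ hμ)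
  · exact ScatteringData.vanishesL2Nu_atTop hμ hH (hκ μ hμ)
  · exact ScatteringData.vanishesL2Nu_atTop hμ hH' (hκ' μ hμ)
  · exact ScatteringData.tendsto_exp_mul_kernel_atBot (κ := fun x z => (D.twist x).kernel z l) hl hH
      (hκ l (D.mem_imag l hl).2)
  · exact ScatteringData.tendsto_exp_mul_kernel_atBot (κ := fun x z => (D.twist x).hatKernel z l) hl hH'
      (hκ' l (D.mem_imag l hl).2)
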